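/- **Setting.** Let $\omega=e^{2\pi i/3}$, $\Lambda=\omega\mathbb Z\oplus\mathbb Z$, $\langle z,w\rangle=\operatorname{Re}(z\bar w)$, $\Lambda^*=\frac{4\pi i}{\sqrt3}\Lambda$, $K=\frac43\pi$ and $\mathcal K_0=\{K,-K\}+\Lambda^*$. Let $U_\pm:\mathbb C\to\mathbb C$ be continuous functions (for instance real analytic ones) with $$U_\pm(\omega z)=\omega U_\pm(z),\qquad U_\pm(z+\gamma)=e^{\pm i\langle\gamma,K\rangle}U_\pm(z)\quad(z\in\mathbb C,\ \gamma\in\Lambda),\qquad V(z)=\begin{pmatrix}0&U_+(z)\\U_-(z)&0\end{pmatrix}.$$ For $p\in\mathbb C$ let $L^2_p=L^2_p(\mathbb C/\Lambda;\mathbb C^2)$ be the space of all $u\in L^2_{\rm loc}(\mathbb C;\mathbb C^2)$ such that, for every $\gamma\in\Lambda$, $$\operatorname{diag}\big(e^{i\langle\gamma,K\rangle},e^{-i\langle\gamma,K\rangle}\big)\,u(z+\gamma)=e^{i\langle p,\gamma\rangle}u(z)\quad\text{for a.e. }z,$$ with the $L^2$ norm over a fundamental cell of $\Lambda$, and let $H^1_p=L^2_p\cap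 H^1_{\rm loc}$. Write $2D_{\bar z}=-i(\partial_x+i\partial_y)$ and $2D_z=-i(\partial_x-i\partial_y)$. For $\alpha\in\mathbb C$ put $$D_V(\alpha)=2D_{\bar z}+\alpha V,\qquad D_V(\alpha)^*=2D_z+\bar\alpha V^*,\qquad H(\alpha)=\begin{pmatrix}0&D_V(\alpha)^*\\D_V(\alpha)&0\end{pmatrix}.$$ On $L^2_p$ the operators $2D_{\bar z}$ and $D_V(\alpha)$ have domain $H^1_p$. On $L^2_k\times L^2_k$ the operator $H(\alpha)$ has domain $H^1_k\times H^1_k$, and $E_1(\alpha,k)$ denotes its smallest non-negative eigenvalue. The magic set is $$\mathcal A(V)=\{\alpha\in\mathbb C:\ E_1(\alpha,k)=0\ \text{for all }k\in\mathbb C\}.$$ **Proposition 2.2.** For $p\in\mathbb C$ and $k\in\mathbb C\setminus(\mathcal K_0+p)$ the resolvent $R(k)=(2D_{\bar z}-k)^{-1}:L^2_p\to L^2_p$ exists, and the operator $$T_k:=R(k)V:L^2_p\to L^2_p$$ is well defined and compact. Moreover: 1. $\operatorname{Spec}_{L^2_p}(T_k)=\operatorname{Spec}_{L^2_q}(T_{k'})$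 for all $p,q\in\mathbb C$, $k\notin\mathcal K_0+p$ and $k'\notin\mathcal K_0+q$. 2. $\mathcal A(V)=\{\alpha\in\mathbb C\setminus\{0\}:\ \alpha^{-1}\in\operatorname{Spec}_{L^2_p}(T_k)\}$ for all $p\in\mathbb C$ and $k\notin\mathcal K_0+p$. 3. If $\alpha\notin\mathcal A(V)$, then the spectrum of $D_V(\alpha)$ on $L^2_0$ is $\mathcal K_0$, and every point of it is a simple eigenvalue (of algebraic multiplicity one). If $\alpha\in\mathcal A(V)$, then the spectrum of $D_V(\alpha)$ on $L^2_0$ is $\mathbb C$. -/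

import Mathlib

open MeasureTheory Complex
open scoped ContDiff ComplexConjugate Real

noncomputable section

namespace ChiralTBG

/-! ### The lattices -/

/-- `ω = e^{2πi/3}`. -/
def omega : ℂ := exp (2 * π * I / 3)

theorem omega_re : omega.re = -(1 / 2) := by
  have h : (2 * π * I / 3 : ℂ) = ((2 * π / 3 : ℝ) : ℂ) * I := by push_cast; ring
  rw [omega, h, exp_ofReal_mul_I_re]
  have : (2 * π / 3 : ℝ) = π - π / 3 := by ring
  rw [this, Real.cos_pi_sub, Real.cos_pi_div_three]

theorem omega_im : omega.im = √3 / 2 := by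
  have h : (2 * π * I / 3 : ℂ) = ((2 * π / 3 : ℝ) : ℂ) * I := by push_cast; ring
  rw [omega, h, exp_ofReal_mul_I_im]
  have : (2 * π / 3 : ℝ) = π - π / 3 := by ring
  rw [this, Real.sin_pi_sub, Real.sin_pi_div_three]

/-- The pair of periods `ω`, `1`. -/
def periods : PeriodPair where
  ω₁ := omega
  ω₂ := 1
  indep := by
    rw [LinearIndependent.pair_iff]
    intro s t h
    have him := congrArg Complex.im h
    have hre := congrArg Complex.re h
    simp [omega_re, omega_im] at him hre
    subst him
    simpa using hre

/-- `Λ = ωℤ ⊕ ℤ`. -/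
abbrev lattice : Submodule ℤ ℂ := periods.lattice

/-- A fundamental cell `{sω + t : 0 ≤ s, t < 1}` of `Λ`. -/
def cell : Set ℂ := ZSpan.fundamentalDomain periods.basis

/-- `⟨z, w⟩ = Re (z w̄)`. -/
def pairing (z w : ℂ) : ℝ := (z * conj w).re

/-- `Λ* = (4πi/√3) Λ`. -/
def dualLattice : Set ℂ := {q | ∃ γ ∈ lattice, q = 4 * π * I / (√3 : ℝ) * γ}

/-- The Dirac point `K = 4π/3`. -/
def K : ℂ := 4 / 3 * π

/-- `𝒦₀ = {K, -K} + Λ*`. -/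
def diracPoints : Set ℂ := {q | q - K ∈ dualLattice ∨ q + K ∈ dualLattice}

theorem exp_three_pairing {γ : ℂ} (hγ : γ ∈ lattice) :
    exp (I * pairing γ K) * exp (I * pairing γ K) * exp (I * pairing γ K) = 1 := by
  obtain ⟨m, n, rfl⟩ := PeriodPair.mem_lattice.mp hγ
  rw [← exp_add, ← exp_add, exp_eq_one_iff]
  refine ⟨2 * n - m, ?_⟩
  have h : pairing (m * periods.ω₁ + n * periods.ω₂) K = 4 / 3 * π * (n - m / 2) := by
    have hK : K = ((4 / 3 * π : ℝ) : ℂ) := by simp [K]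
    rw [pairing, hK, conj_ofReal]
    simp [periods, omega_re]
    ring
  rw [h]
  push_cast
  ring

/-! ### The spaces `L²_p` -/

/-- `ℂ²` with its Euclidean norm. -/
abbrev C2 : Type := EuclideanSpace ℂ (Fin 2)

/-- The action of a `2 × 2` matrix on `ℂ²`. -/
abbrev act (M : Matrix (Fin 2) (Fin 2) ℂ) : C2 →L[ℂ] C2 := Matrix.toEuclideanCLM (𝕜 := ℂ) M

/-- The matrix `diag (e^{i⟨γ,K⟩}, e^{-i⟨γ,K⟩})`. -/
def twist (γ : ℂ) : Matrix (Fin 2) (Fin 2) ℂ :=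
  !![exp (I * pairing γ K), 0; 0, exp (-(I * pairing γ K))]

/-- `(𝓛_γ f)(z) = diag (e^{i⟨γ,K⟩}, e^{-i⟨γ,K⟩}) f(z + γ)`. -/
def translate (γ : ℂ) (f : ℂ → C2) : ℂ → C2 := fun z => act (twist γ) (f (z + γ))

/-- `f ∈ L²_loc(ℂ; ℂ²)`. -/
def LocL2 (f : ℂ → C2) : Prop := ∀ S : Set ℂ, IsCompact S → MemLp f 2 (volume.restrict S)

theorem LocL2.congr {f g : ℂ → C2} (hf : LocL2 f) (h : f =ᵐ[volume] g) : LocL2 g :=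
  fun S hS => (memLp_congr_ae (ae_restrict_of_ae h)).mp (hf S hS)

theorem LocL2.add {f g : ℂ → C2} (hf : LocL2 f) (hg : LocL2 g) : LocL2 (f + g) :=
  fun S hS => (hf S hS).add (hg S hS)

theorem LocL2.const_smul {f : ℂ → C2} (hf : LocL2 f) (c : ℂ) : LocL2 (c • f) :=
  fun S hS => (hf S hS).const_smul c

theorem LocL2.locallyIntegrable {f : ℂ → C2} (hf : LocL2 f) : LocallyIntegrable f volume := by
  rw [locallyIntegrable_iff]
  intro S hS
  have : IsFiniteMeasure (volume.restrict S) :=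
    ⟨by rw [Measure.restrict_apply_univ]; exact hS.measure_lt_top⟩
  exact (hf S hS).integrable (by norm_num)

theorem LocL2.aestronglyMeasurable {f : ℂ → C2} (hf : LocL2 f) :
    AEStronglyMeasurable f volume := hf.locallyIntegrable.aestronglyMeasurable

theorem ae_translate {P : ℂ → Prop} (γ : ℂ) (h : ∀ᵐ z, P z) : ∀ᵐ z : ℂ, P (z + γ) :=
  (measurePreserving_add_right volume γ).quasiMeasurePreserving.ae h

/-- The condition `𝓛_γ f = e^{i⟨p,γ⟩} f` for all `γ ∈ Λ`. -/
def QuasiPeriodic (p : ℂ) (f : ℂ → C2) : Prop :=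
  ∀ γ ∈ lattice, translate γ f =ᵐ[volume] fun z => exp (I * pairing p γ) • f z

theorem QuasiPeriodic.congr {p : ℂ} {f g : ℂ → C2} (hf : QuasiPeriodic p f)
    (h : f =ᵐ[volume] g) : QuasiPeriodic p g := by
  intro γ hγ
  filter_upwards [hf γ hγ, h, ae_translate γ h] with z h1 h2 h3
  simp only [translate] at h1 ⊢
  rw [← h3, h1, h2]

theorem QuasiPeriodic.add {p : ℂ} {f g : ℂ → C2} (hf : QuasiPeriodic p f)
    (hg : QuasiPeriodic p g) : QuasiPeriodic p (f + g) := by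
  intro γ hγ
  filter_upwards [hf γ hγ, hg γ hγ] with z h1 h2
  simp only [translate, Pi.add_apply, map_add, smul_add] at h1 h2 ⊢
  rw [h1, h2]

theorem QuasiPeriodic.const_smul {p : ℂ} {f : ℂ → C2} (hf : QuasiPeriodic p f) (c : ℂ) :
    QuasiPeriodic p (c • f) := by
  intro γ hγ
  filter_upwards [hf γ hγ] with z h1
  simp only [translate, Pi.smul_apply, map_smul] at h1 ⊢
  rw [h1, smul_comm]

/-- The space `L²_p(ℂ/Λ; ℂ²)` of the `u ∈ L²_loc(ℂ; ℂ²)` with `𝓛_γ u = e^{i⟨p,γ⟩} u` for all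
`γ ∈ Λ`. -/
def L2 (p : ℂ) : Submodule ℂ (ℂ →ₘ[volume] C2) where
  carrier := {u | LocL2 u ∧ QuasiPeriodic p u}
  zero_mem' := by
    have h0 : (fun _ => 0 : ℂ → C2) =ᵐ[volume] (0 : ℂ →ₘ[volume] C2) :=
      (AEEqFun.coeFn_zero (α := ℂ) (β := C2) (μ := volume)).symm
    refine ⟨LocL2.congr (fun S _ => MemLp.zero') h0, QuasiPeriodic.congr (fun γ _ => ?_) h0⟩
    exact Filter.Eventually.of_forall fun z => by simp [translate]
  add_mem' {u v} hu hv :=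
    ⟨(hu.1.add hv.1).congr (AEEqFun.coeFn_add u v).symm,
      (hu.2.add hv.2).congr (AEEqFun.coeFn_add u v).symm⟩
  smul_mem' c u hu :=
    ⟨(hu.1.const_smul c).congr (AEEqFun.coeFn_smul c u).symm,
      (hu.2.const_smul c).congr (AEEqFun.coeFn_smul c u).symm⟩

/-- The element of `L²_p` given by a function. -/
def L2.mk {p : ℂ} (f : ℂ → C2) (h1 : LocL2 f) (h2 : QuasiPeriodic p f) : L2 p :=
  ⟨AEEqFun.mk f h1.aestronglyMeasurable,
    h1.congr (AEEqFun.coeFn_mk f h1.aestronglyMeasurable).symm,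
    h2.congr (AEEqFun.coeFn_mk f h1.aestronglyMeasurable).symm⟩

theorem L2.coeFn_mk {p : ℂ} (f : ℂ → C2) (h1 : LocL2 f) (h2 : QuasiPeriodic p f) :
    (L2.mk f h1 h2 : L2 p).1 =ᵐ[volume] f :=
  AEEqFun.coeFn_mk f h1.aestronglyMeasurable

theorem LocL2.memLp_cell {f : ℂ → C2} (hf : LocL2 f) : MemLp f 2 (volume.restrict cell) := by
  have hb : Bornology.IsBounded cell := ZSpan.fundamentalDomain_isBounded periods.basis
  exact (hf (closure cell) hb.isCompact_closure).mono_measure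
    (Measure.restrict_mono subset_closure le_rfl)

/-- The restriction of `u ∈ L²_p` to a fundamental cell. -/
def restrictCell (p : ℂ) : L2 p →ₗ[ℂ] Lp C2 2 (volume.restrict cell) where
  toFun u := u.2.1.memLp_cell.toLp u.1
  map_add' u v := by
    rw [← MemLp.toLp_add]
    exact MemLp.toLp_congr _ _ (ae_restrict_of_ae (AEEqFun.coeFn_add u.1 v.1))
  map_smul' c u := by
    rw [RingHom.id_apply, ← MemLp.toLp_const_smul]
    exact MemLp.toLp_congr _ _ (ae_restrict_of_ae (AEEqFun.coeFn_smul c u.1))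

theorem act_twist_injective (γ : ℂ) : Function.Injective (act (twist γ)) := by
  intro x y h
  have h0 := congrArg (fun w : C2 => w 0) h
  have h1 := congrArg (fun w : C2 => w 1) h
  simp [twist, Matrix.mulVec, dotProduct,
    Fin.sum_univ_two, exp_ne_zero] at h0 h1
  ext i
  fin_cases i
  · exact h0
  · exact h1

theorem restrictCell_injective (p : ℂ) : Function.Injective (restrictCell p) := by
  rw [injective_iff_map_eq_zero]
  intro u hu
  have hmeas : MeasurableSet cell := ZSpan.fundamentalDomain_measurableSet periods.basis
  have h0 : ∀ᵐ z : ℂ, z ∈ cell → u.1 z = 0 := by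
    rw [← ae_restrict_iff' hmeas]
    have h1 : u.2.1.memLp_cell.toLp u.1 = 0 := hu
    have h2 := u.2.1.memLp_cell.coeFn_toLp
    rw [h1] at h2
    filter_upwards [h2, Lp.coeFn_zero C2 2 (volume.restrict cell)] with z h3 h4
    rw [← h3, h4]; rfl
  have : Countable lattice := inferInstance
  have h1 : ∀ᵐ z : ℂ, ∀ γ : lattice, z + γ ∈ cell → u.1 (z + γ) = 0 :=
    ae_all_iff.mpr fun γ => ae_translate (P := fun z => z ∈ cell → u.1 z = 0) γ h0
  have h2 : ∀ᵐ z : ℂ, ∀ γ : lattice,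
      translate γ u.1 z = exp (I * pairing p γ) • u.1 z :=
    ae_all_iff.mpr fun γ => u.2.2 γ γ.2
  apply Subtype.ext
  apply AEEqFun.ext
  filter_upwards [h1, h2, AEEqFun.coeFn_zero (α := ℂ) (β := C2) (μ := volume)] with z h3 h4 h5
  rw [show ((0 : L2 p) : ℂ →ₘ[volume] C2) = 0 from rfl, h5]
  obtain ⟨γ, hγ, -⟩ := ZSpan.exist_unique_vadd_mem_fundamentalDomain periods.basis z
  have hγ' : (γ : ℂ) ∈ lattice := by
    rw [lattice, PeriodPair.lattice_eq_span_range_basis]; exact γ.2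
  have hz : z + (γ : ℂ) ∈ cell := by
    rw [add_comm]; exact hγ
  have h6 := h4 ⟨γ, hγ'⟩
  have h7 := h3 ⟨γ, hγ'⟩ hz
  simp only [translate, h7, map_zero] at h6
  simpa using (smul_eq_zero.mp h6.symm).resolve_left (exp_ne_zero _)

/-- The norm of `L²_p` is the `L²` norm over a fundamental cell. -/
instance (p : ℂ) : NormedAddCommGroup (L2 p) :=
  NormedAddCommGroup.induced (L2 p) (Lp C2 2 (volume.restrict cell)) (restrictCell p)
    (restrictCell_injective p)

instance (p : ℂ) : NormedSpace ℂ (L2 p) :=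
  NormedSpace.induced ℂ (L2 p) (Lp C2 2 (volume.restrict cell)) (restrictCell p)

/-! ### Multiplication operators -/

theorem translate_act {γ : ℂ} {M : ℂ → Matrix (Fin 2) (Fin 2) ℂ} {f : ℂ → C2}
    (h : ∀ z, twist γ * M (z + γ) = M z * twist γ) (z : ℂ) :
    translate γ (fun z => act (M z) (f z)) z = act (M z) (translate γ f z) := by
  simp only [translate, act]
  rw [← mul_apply_eq_comp, ← mul_apply_eq_comp, ← map_mul, ← map_mul, h z]

theorem QuasiPeriodic.act {p : ℂ} {M : ℂ → Matrix (Fin 2) (Fin 2) ℂ} {f : ℂ → C2}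
    (hM : ∀ γ ∈ lattice, ∀ z, twist γ * M (z + γ) = M z * twist γ) (hf : QuasiPeriodic p f) :
    QuasiPeriodic p (fun z => ChiralTBG.act (M z) (f z)) := by
  intro γ hγ
  filter_upwards [hf γ hγ] with z hz
  rw [translate_act (hM γ hγ), hz, map_smul]

theorem continuous_act {M : ℂ → Matrix (Fin 2) (Fin 2) ℂ} (hM : Continuous M) :
    Continuous fun z => act (M z) := by
  let e : Matrix (Fin 2) (Fin 2) ℂ →ₗ[ℂ] (C2 →L[ℂ] C2) :=
    { toFun := act, map_add' := fun a b => map_add _ a b, map_smul' := fun c a => map_smul _ c a }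
  have h : Continuous e := LinearMap.continuous_of_finiteDimensional _
  exact h.comp hM

theorem exists_bound_act {M : ℂ → Matrix (Fin 2) (Fin 2) ℂ} (hM : Continuous M) {S : Set ℂ}
    (hS : IsCompact S) : ∃ C : ℝ, ∀ z ∈ S, ‖act (M z)‖ ≤ C :=
  hS.exists_bound_of_continuousOn (continuous_act hM).continuousOn

theorem ae_bound_act {M : ℂ → Matrix (Fin 2) (Fin 2) ℂ} {f : ℂ → C2} {S : Set ℂ} {C : ℝ}
    (hS : MeasurableSet S) (h : ∀ z ∈ S, ‖act (M z)‖ ≤ C) :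
    ∀ᵐ z ∂(volume.restrict S), ‖act (M z) (f z)‖ ≤ C * ‖f z‖ := by
  filter_upwards [ae_restrict_mem hS] with z hz
  exact (act (M z)).le_of_opNorm_le (h z hz) _

theorem aestronglyMeasurable_act {M : ℂ → Matrix (Fin 2) (Fin 2) ℂ} (hM : Continuous M)
    {f : ℂ → C2} {μ : Measure ℂ} (hf : AEStronglyMeasurable f μ) :
    AEStronglyMeasurable (fun z => act (M z) (f z)) μ :=
  isBoundedBilinearMap_apply.continuous.comp_aestronglyMeasurable
    ((continuous_act hM).aestronglyMeasurable.prodMk hf)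

theorem LocL2.act {M : ℂ → Matrix (Fin 2) (Fin 2) ℂ} (hM : Continuous M) {f : ℂ → C2}
    (hf : LocL2 f) : LocL2 (fun z => ChiralTBG.act (M z) (f z)) := by
  intro S hS
  obtain ⟨C, hC⟩ := exists_bound_act hM hS
  exact (hf S hS).of_le_mul (aestronglyMeasurable_act hM (hf S hS).1)
    (ae_bound_act hS.measurableSet hC)

theorem norm_def {p : ℂ} (u : L2 p) :
    ‖u‖ = (eLpNorm u.1 2 (volume.restrict cell)).toReal := by
  change ‖u.2.1.memLp_cell.toLp u.1‖ = _
  rw [Lp.norm_toLp]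

/-- Multiplication `u ↦ M u` on `L²_p` by a continuous matrix function `M` commuting with every
`𝓛_γ`, as a linear map. -/
def mulLin (p : ℂ) (M : ℂ → Matrix (Fin 2) (Fin 2) ℂ) (hM : Continuous M)
    (hMγ : ∀ γ ∈ lattice, ∀ z, twist γ * M (z + γ) = M z * twist γ) : L2 p →ₗ[ℂ] L2 p where
  toFun u := L2.mk (fun z => act (M z) (u.1 z)) (u.2.1.act hM) (u.2.2.act hMγ)
  map_add' u v := by
    apply Subtype.ext
    apply AEEqFun.ext
    refine (L2.coeFn_mk _ _ _).trans (Filter.EventuallyEq.trans ?_ (AEEqFun.coeFn_add _ _).symm)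
    filter_upwards [AEEqFun.coeFn_add u.1 v.1,
      L2.coeFn_mk _ (u.2.1.act hM) (u.2.2.act hMγ),
      L2.coeFn_mk _ (v.2.1.act hM) (v.2.2.act hMγ)] with z h1 h2 h3
    rw [Pi.add_apply, h2, h3, Submodule.coe_add, h1, Pi.add_apply, map_add]
  map_smul' c u := by
    apply Subtype.ext
    apply AEEqFun.ext
    refine (L2.coeFn_mk _ _ _).trans (Filter.EventuallyEq.trans ?_ (AEEqFun.coeFn_smul _ _).symm)
    filter_upwards [AEEqFun.coeFn_smul c u.1,
      L2.coeFn_mk _ (u.2.1.act hM) (u.2.2.act hMγ)] with z h1 h2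
    rw [RingHom.id_apply, Pi.smul_apply, h2, Submodule.coe_smul, h1, Pi.smul_apply, map_smul]

theorem mulLin_bound (p : ℂ) (M : ℂ → Matrix (Fin 2) (Fin 2) ℂ) (hM : Continuous M)
    (hMγ : ∀ γ ∈ lattice, ∀ z, twist γ * M (z + γ) = M z * twist γ) :
    ∃ C : ℝ, ∀ u : L2 p, ‖mulLin p M hM hMγ u‖ ≤ C * ‖u‖ := by
  have hb : Bornology.IsBounded cell := ZSpan.fundamentalDomain_isBounded periods.basis
  have hmeas : MeasurableSet cell := ZSpan.fundamentalDomain_measurableSet periods.basis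
  obtain ⟨C, hC⟩ := exists_bound_act hM hb.isCompact_closure
  refine ⟨max C 0, fun u => ?_⟩
  rw [norm_def, norm_def]
  have h := eLpNorm_le_mul_eLpNorm_of_ae_le_mul (ae_bound_act (f := u.1) hmeas
    (fun z hz => (hC z (subset_closure hz)).trans (le_max_left C 0))) 2
  have h2 := ENNReal.toReal_mono
    (ENNReal.mul_ne_top ENNReal.ofReal_ne_top u.2.1.memLp_cell.2.ne) h
  rw [ENNReal.toReal_mul, ENNReal.toReal_ofReal (le_max_right C 0)] at h2
  have h3 : eLpNorm (mulLin p M hM hMγ u).1 2 (volume.restrict cell)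
      = eLpNorm (fun z => act (M z) (u.1 z)) 2 (volume.restrict cell) :=
    eLpNorm_congr_ae (ae_restrict_of_ae (L2.coeFn_mk _ (u.2.1.act hM) (u.2.2.act hMγ)))
  rw [h3]
  exact h2

/-- Multiplication by `M` as a bounded operator on `L²_p`. -/
def mulOp (p : ℂ) (M : ℂ → Matrix (Fin 2) (Fin 2) ℂ) (hM : Continuous M)
    (hMγ : ∀ γ ∈ lattice, ∀ z, twist γ * M (z + γ) = M z * twist γ) : L2 p →L[ℂ] L2 p :=
  (mulLin p M hM hMγ).mkContinuousOfExistsBound (mulLin_bound p M hM hMγ)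

/-- The potentials: `U_±(ωz) = ω U_±(z)` and `U_±(z + γ) = e^{±i⟨γ,K⟩} U_±(z)`, `γ ∈ Λ`. -/
structure Potential where
  Uplus : ℂ → ℂ
  Uminus : ℂ → ℂ
  continuous_plus : Continuous Uplus
  continuous_minus : Continuous Uminus
  rot_plus : ∀ z, Uplus (omega * z) = omega * Uplus z
  rot_minus : ∀ z, Uminus (omega * z) = omega * Uminus z
  translate_plus : ∀ γ ∈ lattice, ∀ z, Uplus (z + γ) = exp (I * pairing γ K) * Uplus z
  translate_minus : ∀ γ ∈ lattice, ∀ z, Uminus (z + γ) = exp (-(I * pairing γ K)) * Uminus z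

namespace Potential

/-- `V = [[0, U_+], [U_-, 0]]`. -/
def mat (V : Potential) (z : ℂ) : Matrix (Fin 2) (Fin 2) ℂ := !![0, V.Uplus z; V.Uminus z, 0]

theorem continuous_mat (V : Potential) : Continuous V.mat := by
  refine continuous_matrix fun i j => ?_
  fin_cases i <;> fin_cases j
  · exact continuous_const
  · exact V.continuous_plus
  · exact V.continuous_minus
  · exact continuous_const

theorem mat_translate (V : Potential) :
    ∀ γ ∈ lattice, ∀ z, twist γ * V.mat (z + γ) = V.mat z * twist γ := by
  intro γ hγ z
  have h3 := exp_three_pairing hγ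
  have h := exp_ne_zero (I * pairing γ K)
  simp only [twist, mat, V.translate_plus γ hγ, V.translate_minus γ hγ, exp_neg]
  ext i j
  fin_cases i <;> fin_cases j <;> simp [Matrix.mul_apply, Fin.sum_univ_two] <;> field_simp
  · linear_combination V.Uplus z * h3
  · linear_combination (-V.Uminus z) * h3

theorem mat_conjTranspose_translate (V : Potential) :
    ∀ γ ∈ lattice, ∀ z,
      twist γ * (V.mat (z + γ)).conjTranspose = (V.mat z).conjTranspose * twist γ := by
  intro γ hγ z
  have h3 := exp_three_pairing hγ
  have h := exp_ne_zero (I * pairing γ K)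
  simp only [twist, mat, V.translate_plus γ hγ, V.translate_minus γ hγ, exp_neg]
  ext i j
  fin_cases i <;> fin_cases j <;>
    simp [Matrix.mul_apply, Fin.sum_univ_two, ← exp_conj, exp_neg] <;> field_simp
  · linear_combination conj (V.Uminus z) * h3
  · linear_combination (-conj (V.Uplus z)) * h3

/-- Multiplication by `V` on `L²_p`. -/
def mul (V : Potential) (p : ℂ) : L2 p →L[ℂ] L2 p :=
  mulOp p V.mat V.continuous_mat V.mat_translate

/-- Multiplication by the adjoint matrix `V(z)*` on `L²_p`. -/
def mulStar (V : Potential) (p : ℂ) : L2 p →L[ℂ] L2 p :=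
  mulOp p (fun z => (V.mat z).conjTranspose) V.continuous_mat.matrix_conjTranspose
    V.mat_conjTranspose_translate

end Potential

/-! ### Weak derivatives and the spaces `H¹_p` -/

/-- `g` is the weak derivative of `f` in the direction `v`. -/
def HasWeakDeriv (v : ℂ) (f g : ℂ → C2) : Prop :=
  ∀ φ : ℂ → ℝ, ContDiff ℝ ∞ φ → HasCompactSupport φ →
    ∫ z, fderiv ℝ φ z v • f z = -∫ z, φ z • g z

theorem integrable_test {φ : ℂ → ℝ} (h1 : Continuous φ) (h2 : HasCompactSupport φ)
    {f : ℂ → C2} (hf : LocL2 f) : Integrable (fun z => φ z • f z) :=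
  hf.locallyIntegrable.integrable_smul_left_of_hasCompactSupport h1 h2

theorem integrable_test_fderiv {φ : ℂ → ℝ} (h1 : ContDiff ℝ ∞ φ) (h2 : HasCompactSupport φ)
    (v : ℂ) {f : ℂ → C2} (hf : LocL2 f) : Integrable (fun z => fderiv ℝ φ z v • f z) :=
  integrable_test ((h1.continuous_fderiv (by simp)).clm_apply continuous_const)
    (h2.fderiv_apply (𝕜 := ℝ) v) hf

theorem HasWeakDeriv.congr {v : ℂ} {f f' g g' : ℂ → C2} (h : HasWeakDeriv v f g)
    (hf : f =ᵐ[volume] f') (hg : g =ᵐ[volume] g') : HasWeakDeriv v f' g' := by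
  intro φ h1 h2
  have e1 : ∫ z, fderiv ℝ φ z v • f' z = ∫ z, fderiv ℝ φ z v • f z :=
    integral_congr_ae (by filter_upwards [hf] with z hz; rw [hz])
  have e2 : ∫ z, φ z • g' z = ∫ z, φ z • g z :=
    integral_congr_ae (by filter_upwards [hg] with z hz; rw [hz])
  rw [e1, e2, h φ h1 h2]

theorem HasWeakDeriv.add {v : ℂ} {f f' g g' : ℂ → C2} (h : HasWeakDeriv v f g)
    (h' : HasWeakDeriv v f' g') (hf : LocL2 f) (hf' : LocL2 f') (hg : LocL2 g) (hg' : LocL2 g') :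
    HasWeakDeriv v (f + f') (g + g') := by
  intro φ h1 h2
  simp only [Pi.add_apply, smul_add]
  rw [integral_add (integrable_test_fderiv h1 h2 v hf) (integrable_test_fderiv h1 h2 v hf'),
    integral_add (integrable_test h1.continuous h2 hg) (integrable_test h1.continuous h2 hg'),
    h φ h1 h2, h' φ h1 h2, neg_add]

theorem HasWeakDeriv.clm {v : ℂ} {f g : ℂ → C2} (h : HasWeakDeriv v f g) (hf : LocL2 f)
    (hg : LocL2 g) (A : C2 →L[ℂ] C2) : HasWeakDeriv v (fun z => A (f z)) (fun z => A (g z)) := by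
  intro φ h1 h2
  have e1 := A.integral_comp_comm (integrable_test_fderiv h1 h2 v hf)
  have e2 := A.integral_comp_comm (integrable_test h1.continuous h2 hg)
  simp only [A.map_smul_of_tower] at e1 e2
  rw [e1, e2, h φ h1 h2, map_neg]

theorem HasWeakDeriv.const_smul {v : ℂ} {f g : ℂ → C2} (h : HasWeakDeriv v f g) (hf : LocL2 f)
    (hg : LocL2 g) (c : ℂ) : HasWeakDeriv v (c • f) (c • g) :=
  h.clm hf hg (c • ContinuousLinearMap.id ℂ C2)

theorem HasWeakDeriv.comp_add {v : ℂ} {f g : ℂ → C2} (h : HasWeakDeriv v f g) (γ : ℂ) :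
    HasWeakDeriv v (fun z => f (z + γ)) (fun z => g (z + γ)) := by
  intro φ h1 h2
  have h3 := h (fun z => φ (z - γ)) (h1.comp (contDiff_id.sub contDiff_const))
    (h2.comp_homeomorph (Homeomorph.subRight γ))
  rw [← integral_add_right_eq_self _ γ, ← integral_add_right_eq_self (fun z => φ (z - γ) • g z) γ]
    at h3
  simpa [fderiv_comp_sub] using h3

theorem HasWeakDeriv.unique {v : ℂ} {f g g' : ℂ → C2} (h : HasWeakDeriv v f g)
    (h' : HasWeakDeriv v f g') (hg : LocL2 g) (hg' : LocL2 g') : g =ᵐ[volume] g' := by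
  have h0 := ae_eq_zero_of_integral_contDiff_smul_eq_zero (μ := volume) (f := g - g')
    (hg.locallyIntegrable.sub hg'.locallyIntegrable) (fun φ h1 h2 => by
      simp only [Pi.sub_apply, smul_sub]
      rw [integral_sub (integrable_test h1.continuous h2 hg)
        (integrable_test h1.continuous h2 hg'), sub_eq_zero, ← neg_inj, ← h φ h1 h2, h' φ h1 h2])
  filter_upwards [h0] with z hz
  exact sub_eq_zero.mp hz

theorem LocL2.comp_add {f : ℂ → C2} (hf : LocL2 f) (γ : ℂ) : LocL2 (fun z => f (z + γ)) := by
  intro S hS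
  have hS' : IsCompact ((fun z => z + γ) '' S) := hS.image (by fun_prop)
  have hmp : MeasurePreserving (fun z : ℂ => z + γ) (volume.restrict S)
      (volume.restrict ((fun z => z + γ) '' S)) :=
    (measurePreserving_add_right volume γ).restrict_image_emb
      (MeasurableEquiv.addRight γ).measurableEmbedding S
  exact (hf _ hS').comp_measurePreserving hmp

theorem LocL2.clm {f : ℂ → C2} (hf : LocL2 f) (A : C2 →L[ℂ] C2) : LocL2 (fun z => A (f z)) :=
  fun S hS => A.comp_memLp' (hf S hS)

theorem QuasiPeriodic.hasWeakDeriv {p v : ℂ} {f g : ℂ → C2} (hq : QuasiPeriodic p f)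
    (h : HasWeakDeriv v f g) (hf : LocL2 f) (hg : LocL2 g) : QuasiPeriodic p g := by
  intro γ hγ
  have h1 : HasWeakDeriv v (translate γ f) (translate γ g) :=
    (h.comp_add γ).clm (hf.comp_add γ) (hg.comp_add γ) _
  have h2 : HasWeakDeriv v (exp (I * pairing p γ) • f) (exp (I * pairing p γ) • g) :=
    h.const_smul hf hg _
  exact (h1.congr (hq γ hγ) Filter.EventuallyEq.rfl).unique h2
    ((hg.comp_add γ).clm _) (hg.const_smul _)

/-- `H¹_p = L²_p ∩ H¹_loc`: the `u ∈ L²_p` whose weak derivatives are in `L²_loc`. -/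
def H1 (p : ℂ) : Submodule ℂ (L2 p) where
  carrier := {u | ∀ v : ℂ, ∃ g : ℂ → C2, LocL2 g ∧ HasWeakDeriv v u.1 g}
  zero_mem' v := by
    refine ⟨0, fun S _ => MemLp.zero, ?_⟩
    refine HasWeakDeriv.congr (f := 0) (g := 0) (fun φ _ _ => by simp) ?_ Filter.EventuallyEq.rfl
    exact (AEEqFun.coeFn_zero (α := ℂ) (β := C2) (μ := volume)).symm
  add_mem' {a b} ha hb v := by
    obtain ⟨g, hg, h⟩ := ha v
    obtain ⟨g', hg', h'⟩ := hb v
    exact ⟨g + g', hg.add hg', (h.add h' a.2.1 b.2.1 hg hg').congr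
      (AEEqFun.coeFn_add a.1 b.1).symm Filter.EventuallyEq.rfl⟩
  smul_mem' c a ha v := by
    obtain ⟨g, hg, h⟩ := ha v
    exact ⟨c • g, hg.const_smul c, (h.const_smul a.2.1 hg c).congr
      (AEEqFun.coeFn_smul c a.1).symm Filter.EventuallyEq.rfl⟩

theorem exists_weakDeriv {p : ℂ} (v : ℂ) (u : H1 p) :
    ∃ g : L2 p, HasWeakDeriv v u.1.1 g.1 := by
  obtain ⟨g, hg, h⟩ := u.2 v
  have hq := u.1.2.2.hasWeakDeriv h u.1.2.1 hg
  exact ⟨L2.mk g hg hq, h.congr Filter.EventuallyEq.rfl (L2.coeFn_mk g hg hq).symm⟩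

theorem weakDeriv_unique {p v : ℂ} {f : ℂ → C2} {g g' : L2 p} (h : HasWeakDeriv v f g.1)
    (h' : HasWeakDeriv v f g'.1) : g = g' :=
  Subtype.ext (AEEqFun.ext (h.unique h' g.2.1 g'.2.1))

/-- The weak derivative in the direction `v`, as a map `H¹_p → L²_p`. -/
def weakDeriv (p v : ℂ) : H1 p →ₗ[ℂ] L2 p where
  toFun u := (exists_weakDeriv v u).choose
  map_add' a b := by
    refine weakDeriv_unique (exists_weakDeriv v (a + b)).choose_spec ?_
    exact ((exists_weakDeriv v a).choose_spec.add (exists_weakDeriv v b).choose_spec a.1.2.1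
      b.1.2.1 (exists_weakDeriv v a).choose.2.1 (exists_weakDeriv v b).choose.2.1).congr
      (AEEqFun.coeFn_add _ _).symm (AEEqFun.coeFn_add _ _).symm
  map_smul' c a := by
    refine weakDeriv_unique (exists_weakDeriv v (c • a)).choose_spec ?_
    exact ((exists_weakDeriv v a).choose_spec.const_smul a.1.2.1
      (exists_weakDeriv v a).choose.2.1 c).congr
      (AEEqFun.coeFn_smul _ _).symm (AEEqFun.coeFn_smul _ _).symm

theorem hasWeakDeriv_weakDeriv {p : ℂ} (v : ℂ) (u : H1 p) :
    HasWeakDeriv v u.1.1 (weakDeriv p v u).1 :=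
  (exists_weakDeriv v u).choose_spec

/-! ### Unbounded operators -/

section Unbounded

variable {E : Type*} [NormedAddCommGroup E] [NormedSpace ℂ E]

/-- `R` is a bounded two-sided inverse of `A - z : Dom A → E`. -/
def IsResolventAt (A : E →ₗ.[ℂ] E) (z : ℂ) (R : E →L[ℂ] E) : Prop :=
  (∀ f : E, ∃ h : R f ∈ A.domain, A ⟨R f, h⟩ - z • R f = f) ∧
    ∀ u : A.domain, R (A u - z • (u : E)) = u

/-- The resolvent set of an unbounded operator. -/
def resolventSetOf (A : E →ₗ.[ℂ] E) : Set ℂ := {z | ∃ R : E →L[ℂ] E, IsResolventAt A z R}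

/-- The spectrum of an unbounded operator. -/
def Spec (A : E →ₗ.[ℂ] E) : Set ℂ := (resolventSetOf A)ᶜ

open Classical in
/-- `(A - z)⁻¹` for `z` in the resolvent set (and `0` otherwise). -/
def resolventOf (A : E →ₗ.[ℂ] E) (z : ℂ) : E →L[ℂ] E :=
  if h : z ∈ resolventSetOf A then h.choose else 0

/-- `ker (A - z)ⁿ`, with its natural domain. -/
def genKer (A : E →ₗ.[ℂ] E) (z : ℂ) : ℕ → Submodule ℂ E
  | 0 => ⊥
  | n + 1 => ((genKer A z n).comap (A.toFun - z • A.domain.subtype)).map A.domain.subtype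

/-- `z` is an eigenvalue of algebraic multiplicity one: the space `⋃ₙ ker (A - z)ⁿ` of
generalized eigenvectors is one-dimensional. -/
def IsSimpleEigenvalue (A : E →ₗ.[ℂ] E) (z : ℂ) : Prop :=
  Module.finrank ℂ (⨆ n, genKer A z n : Submodule ℂ E) = 1

end Unbounded

/-! ### The operators of the chiral model -/

/-- `2D_z̄ = -i(∂_x + i∂_y) : H¹_p → L²_p`. -/
def dbarMap (p : ℂ) : H1 p →ₗ[ℂ] L2 p := (-I) • (weakDeriv p 1 + I • weakDeriv p I)

/-- `2D_z = -i(∂_x - i∂_y) : H¹_p → L²_p`. -/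
def dMap (p : ℂ) : H1 p →ₗ[ℂ] L2 p := (-I) • (weakDeriv p 1 - I • weakDeriv p I)

/-- `2D_z̄` on `L²_p`, with domain `H¹_p`. -/
def twoDbar (p : ℂ) : L2 p →ₗ.[ℂ] L2 p where
  domain := H1 p
  toFun := dbarMap p

/-- `D_V(α) = 2D_z̄ + αV` on `L²_p`, with domain `H¹_p`. -/
def D (V : Potential) (α p : ℂ) : L2 p →ₗ.[ℂ] L2 p where
  domain := H1 p
  toFun := dbarMap p + α • (V.mul p).toLinearMap.comp (H1 p).subtype

/-- `D_V(α)* = 2D_z + ᾱV*` on `L²_p`, with domain `H¹_p`. -/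
def Dstar (V : Potential) (α p : ℂ) : L2 p →ₗ.[ℂ] L2 p where
  domain := H1 p
  toFun := dMap p + conj α • (V.mulStar p).toLinearMap.comp (H1 p).subtype

/-- `H(α) = [[0, D_V(α)*], [D_V(α), 0]]` on `L²_k(ℂ/Λ; ℂ⁴) = L²_k(ℂ/Λ; ℂ²) × L²_k(ℂ/Λ; ℂ²)`, with
domain `H¹_k(ℂ/Λ; ℂ⁴)`: the map `(u, v) ↦ (D_V(α)* v, D_V(α) u)`. -/
def H (V : Potential) (α k : ℂ) : (L2 k × L2 k) →ₗ.[ℂ] (L2 k × L2 k) where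
  domain := (H1 k).prod (H1 k)
  toFun :=
    { toFun := fun w => (Dstar V α k ⟨w.1.2, w.2.2⟩, D V α k ⟨w.1.1, w.2.1⟩)
      map_add' := fun a b => Prod.ext
        ((Dstar V α k).map_add ⟨a.1.2, a.2.2⟩ ⟨b.1.2, b.2.2⟩)
        ((D V α k).map_add ⟨a.1.1, a.2.1⟩ ⟨b.1.1, b.2.1⟩)
      map_smul' := fun c a => Prod.ext
        ((Dstar V α k).map_smul c ⟨a.1.2, a.2.2⟩)
        ((D V α k).map_smul c ⟨a.1.1, a.2.1⟩) }

/-- `E₁(α, k)`: the smallest non-negative eigenvalue of `H(α)` on `L²_k(ℂ/Λ; ℂ⁴)`. -/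
def E1 (V : Potential) (α k : ℂ) : ℝ :=
  sInf {E : ℝ | 0 ≤ E ∧ ∃ w : (H V α k).domain, w ≠ 0 ∧
    H V α k w = (E : ℂ) • (w : L2 k × L2 k)}

/-- The magic set `𝒜(V)`: the first band is identically zero. -/
def magicSet (V : Potential) : Set ℂ := {α | ∀ k, E1 V α k = 0}

/-- `T_k = R(k) V` on `L²_p`, with `R(k) = (2D_z̄ - k)⁻¹`. -/
def T (V : Potential) (p k : ℂ) : L2 p →L[ℂ] L2 p := (resolventOf (twoDbar p) k).comp (V.mul p)

end ChiralTBG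
end

noncomputable section

namespace ChiralTBG

/-! ### Compact perturbations of the identity -/

section Compact

open Filter Topology Module.End

variable {E : Type*} [NormedAddCommGroup E] [InnerProductSpace ℂ E]

/-! Plane waves whose frequencies run over the Dirac points, shifted by p, identify L²_p with ℓ²(𝒦₀)
(`fourierL2`). In these variables 2D_z̄ becomes multiplication by j + p, and V becomes one operator
W that does not depend on p. Hence D_V(α) - z on L²_p becomes A + αW - (z - p) with A = diag(j).
Since 0 is not a Dirac point, A⁻¹ exists and is compact, and everything reduces to invertibility of
the compact perturbation of the identity `pencil` = 1 + A⁻¹(αW - k). Up to shifts, its singular k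
form the spectrum of D_V(α). For z ≠ 0, z is in the spectrum of T_k exactly when the pencil at (z⁻¹,
k - p) is singular. E₁(α, k) vanishes exactly when the pencil at (α, -k) is singular
(`Potential.E1_eq_zero_iff`).

What remains is a rigidity statement, `SkewPencil.not_degenerate`: if the pencil at α is invertible
for one k, then its singular points are exactly the Dirac points, and they are simple. Two
symmetries of the potential carry it. Rotation about a Dirac point j₀ makes j₀ an eigenvalue for
every α, by an index-one argument (`IsPotentialMatrix.exists_protected`). The bilinear form ∫ det(u,
v) makes A and W skew, so eigenvectors at k and k' pair to zero unless k + k' = 0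
(`IsPotentialMatrix.skewForm_pencil`).

Call k degenerate if it is an eigenvalue outside 𝒦₀, or if some nonzero eigenvector at k annihilates
some nonzero eigenvector at -k. For α = 0 nothing is degenerate. Fix k₀ outside 𝒦₀. The α for which
k₀ is not an eigenvalue form the complement of a countable set, hence a connected set. Absence of
degenerate points is open in α by compactness and Λ*-periodicity (`SkewPencil.isClosed_degenerate`).
It is closed relative to this connected set, by convergence of the residues of the resolvent
(`SkewPencil.not_degenerate_of_tendsto`). So it holds on all of it. Nondegeneracy forces a
one-dimensional kernel, and the skew identity excludes Jordan chains. -/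

theorem finite_eigenvalues_of_le_norm {C : E →L[ℂ] E} (hC : IsCompactOperator C) {ε : ℝ}
    (hε : 0 < ε) : {μ : ℂ | ε ≤ ‖μ‖ ∧ HasEigenvalue (C : Module.End ℂ E) μ}.Finite := by
  by_contra hinf
  let f := Set.Infinite.natEmbedding _ hinf
  let μ : ℕ → ℂ := fun n => (f n).1
  have hμ : Function.Injective μ := Subtype.val_injective.comp f.injective
  choose v hv using fun n => (f n).2.2.exists_hasEigenvector
  have hli : LinearIndependent ℂ v := eigenvectors_linearIndependent' _ μ hμ v hv
  -- Riesz's argument. After orthonormalization C y_n = μ_n y_n modulo the span W n of the earlier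
  -- vectors, which C preserves. So the C y_n stay ε apart, against compactness of C on the unit
  -- ball.
  let y := InnerProductSpace.gramSchmidtNormed ℂ v
  have hy : Orthonormal ℂ y := InnerProductSpace.gramSchmidtNormed_orthonormal hli
  let W : ℕ → Submodule ℂ E := fun n => Submodule.span ℂ (v '' Set.Iio n)
  have hCv : ∀ n, C (v n) = μ n • v n := fun n => (hv n).apply_eq_smul
  have hCW : ∀ n, ∀ w ∈ W n, C w ∈ W n := by
    intro n w hw
    have : W n ≤ (W n).comap (C : E →ₗ[ℂ] E) := by
      refine Submodule.span_le.mpr ?_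
      rintro _ ⟨m, hm, rfl⟩
      have : C (v m) ∈ W n := by
        rw [hCv]
        exact Submodule.smul_mem _ _ (Submodule.subset_span ⟨m, hm, rfl⟩)
      exact this
    exact this hw
  have hWmono : Monotone W := fun m n h =>
    Submodule.span_mono (Set.image_mono (Set.Iio_subset_Iio h))
  have hspan : ∀ n, W n = Submodule.span ℂ (y '' Set.Iio n) := by
    intro n
    rw [show W n = _ from (InnerProductSpace.span_gramSchmidt_Iio ℂ v n).symm]
    exact (InnerProductSpace.span_gramSchmidtNormed _ _).symm
  have hyW : ∀ m n, m < n → y m ∈ W n := by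
    intro m n h
    rw [hspan]
    exact Submodule.subset_span ⟨m, h, rfl⟩
  have horth : ∀ n, ∀ w ∈ W n, inner ℂ (y n) w = 0 := by
    intro n w hw
    rw [hspan] at hw
    have : Submodule.span ℂ (y '' Set.Iio n) ≤ (innerₛₗ ℂ (y n)).ker := by
      refine Submodule.span_le.mpr ?_
      rintro _ ⟨m, hm, rfl⟩
      exact hy.2 (ne_of_gt hm)
    exact this hw
  have hdiff : ∀ n, C (y n) - μ n • y n ∈ W n := by
    intro n
    have h1 : y n ∈ Submodule.span ℂ (insert (v n) (v '' Set.Iio n)) := by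
      have h2 := hyW n (n + 1) n.lt_succ_self
      have h3 : Set.Iio (n + 1) = insert n (Set.Iio n) := by
        ext m
        simp only [Set.mem_Iio, Set.mem_insert_iff]
        omega
      rwa [← Set.image_insert_eq, ← h3]
    obtain ⟨c, w, hw, h⟩ := Submodule.mem_span_insert.mp h1
    rw [h, map_add, map_smul, hCv]
    have : c • μ n • v n + C w - μ n • (c • v n + w) = C w - μ n • w := by module
    rw [this]
    exact Submodule.sub_mem _ (hCW n w hw) (Submodule.smul_mem _ _ hw)
  have hfar : ∀ m n, m < n → ε ≤ ‖C (y n) - C (y m)‖ := by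
    intro m n h
    have h1 : C (y m) ∈ W n := hCW n _ (hyW m n h)
    have h2 : inner ℂ (y n) (C (y n) - C (y m)) = μ n := by
      have h3 := horth n _ (Submodule.sub_mem _ (hdiff n) h1)
      have h4 : C (y n) - C (y m) = μ n • y n + (C (y n) - μ n • y n - C (y m)) := by module
      rw [h4, inner_add_right, h3, inner_smul_right, inner_self_eq_norm_sq_to_K, hy.1 n]
      simp
    calc ε ≤ ‖μ n‖ := (f n).2.1
      _ = ‖inner ℂ (y n) (C (y n) - C (y m))‖ := by rw [h2]
      _ ≤ ‖y n‖ * ‖C (y n) - C (y m)‖ := norm_inner_le_norm _ _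
      _ = _ := by rw [hy.1 n, one_mul]
  obtain ⟨Q, hQ, hQ'⟩ := hC.image_closedBall_subset_compact 1
  obtain ⟨z, -, ψ, hψ, hz⟩ := hQ.tendsto_subseq (x := fun n => C (y n))
    (fun n => hQ' ⟨y n, by simp [hy.1 n], rfl⟩)
  obtain ⟨N, hN⟩ := Metric.cauchySeq_iff'.mp hz.cauchySeq ε hε
  have h1 := hN (N + 1) N.le_succ
  rw [dist_eq_norm] at h1
  exact (hfar _ _ (hψ N.lt_succ_self)).not_gt h1

/-- The operator `1 + S(aV - k)`, which is `A⁻¹(A + aV - k)` for `S = A⁻¹`. -/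
def pencil (S V : E →L[ℂ] E) (a k : ℂ) : E →L[ℂ] E := 1 + S * (a • V - k • 1)

variable {S V : E →L[ℂ] E}

theorem pencil_apply (a k : ℂ) (x : E) : pencil S V a k x = x + S (a • V x - k • x) := by
  simp [pencil]

theorem tendsto_pencil {ι : Type*} {l : Filter ι} {an kn : ι → ℂ} {a k : ℂ}
    (ha : Tendsto an l (𝓝 a)) (hk : Tendsto kn l (𝓝 k)) :
    Tendsto (fun n => pencil S V (an n) (kn n)) l (𝓝 (pencil S V a k)) :=
  tendsto_const_nhds.add <| tendsto_const_nhds.mul <|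
    (ha.smul_const V).sub (hk.smul_const (1 : E →L[ℂ] E))

theorem eq_zero_of_isUnit {A : E →L[ℂ] E} (h : IsUnit A) {x : E} (hx : A x = 0) : x = 0 := by
  obtain ⟨u, rfl⟩ := h
  have h1 : (↑u⁻¹ * ↑u : E →L[ℂ] E) x = 0 := by
    rw [mul_apply_eq_comp, hx, map_zero]
  simpa using h1

/-- Approximate null vectors have the form x_n = -S w_n + o(1) with w_n bounded, so compactness of S
gives a convergent subsequence. Its limit keeps norm one and is a null vector of the limit pencil.
-/
theorem exists_tendsto_subseq_pencil (hS : IsCompactOperator S) {a k : ℂ} {an kn : ℕ → ℂ}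
    (ha : Tendsto an atTop (𝓝 a)) (hk : Tendsto kn atTop (𝓝 k)) {x : ℕ → E}
    (hx : ∀ n, ‖x n‖ = 1)
    (h : Tendsto (fun n => pencil S V (an n) (kn n) (x n)) atTop (𝓝 0)) :
    ∃ (y : E) (φ : ℕ → ℕ), StrictMono φ ∧ Tendsto (x ∘ φ) atTop (𝓝 y) ∧ ‖y‖ = 1 ∧
      pencil S V a k y = 0 := by
  let w : ℕ → E := fun n => an n • V (x n) - kn n • x n
  obtain ⟨C1, hC1⟩ := isBounded_iff_forall_norm_le.mp (Metric.isBounded_range_of_tendsto _ ha)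
  obtain ⟨C2, hC2⟩ := isBounded_iff_forall_norm_le.mp (Metric.isBounded_range_of_tendsto _ hk)
  have hw : ∀ n, ‖w n‖ ≤ C1 * ‖V‖ + C2 := by
    intro n
    refine (norm_sub_le _ _).trans (add_le_add ?_ ?_)
    · rw [norm_smul]
      have := hC1 _ ⟨n, rfl⟩
      have h2 := V.le_opNorm (x n)
      rw [hx, mul_one] at h2
      exact mul_le_mul this h2 (norm_nonneg _) ((norm_nonneg _).trans this)
    · rw [norm_smul, hx, mul_one]
      exact hC2 _ ⟨n, rfl⟩
  obtain ⟨Q, hQ, hQ'⟩ := hS.image_closedBall_subset_compact (C1 * ‖V‖ + C2)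
  obtain ⟨z, -, φ, hφ, hz⟩ := hQ.tendsto_subseq (x := fun n => S (w n))
    (fun n => hQ' ⟨w n, by simpa using hw n, rfl⟩)
  have hxφ : Tendsto (x ∘ φ) atTop (𝓝 (-z)) := by
    have h1 := (h.comp hφ.tendsto_atTop).sub hz
    rw [zero_sub] at h1
    refine h1.congr fun n => ?_
    simp [pencil_apply, w]
  refine ⟨-z, φ, hφ, hxφ, ?_, ?_⟩
  · refine tendsto_nhds_unique hxφ.norm ?_
    simp [hx]
  · have hc : Tendsto (fun n => pencil S V (an (φ n)) (kn (φ n)) (x (φ n))) atTop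
        (𝓝 (pencil S V a k (-z))) := by
      have h2 := tendsto_pencil (S := S) (V := V) (ha.comp hφ.tendsto_atTop)
        (hk.comp hφ.tendsto_atTop)
      exact (isBoundedBilinearMap_apply.continuous.tendsto _).comp (h2.prodMk_nhds hxφ)
    exact tendsto_nhds_unique hc (h.comp hφ.tendsto_atTop)

variable [CompleteSpace E]

theorem isUnit_one_add_of_injective {C : E →L[ℂ] E} (hC : IsCompactOperator C)
    (h : ∀ x, x + C x = 0 → x = 0) : IsUnit (1 + C) := by
  rcases hC.hasEigenvalue_or_mem_resolventSet (μ := -1) (by simp) with h1 | h1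
  · obtain ⟨v, hv⟩ := h1.exists_hasEigenvector
    refine absurd (h v ?_) hv.2
    have : C v = (-1 : ℂ) • v := hv.apply_eq_smul
    rw [this]; module
  · rw [spectrum.mem_resolventSet_iff, ← IsUnit.neg_iff] at h1
    convert h1 using 1
    simp [add_comm]

/-- A singular 1 + tC makes -1/t an eigenvalue of C of modulus at least 1/R. Replacing R by max R 1
only ensures a positive radius. -/
theorem finite_not_isUnit {C : E →L[ℂ] E} (hC : IsCompactOperator C) (R : ℝ) :
    {t : ℂ | ‖t‖ ≤ R ∧ ¬ IsUnit (1 + t • C)}.Finite := by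
  have hR : (0 : ℝ) < max R 1 := lt_max_of_lt_right one_pos
  refine ((finite_eigenvalues_of_le_norm hC (inv_pos.mpr hR)).image fun μ => -μ⁻¹).subset ?_
  rintro t ⟨ht, hu⟩
  have hcomp : IsCompactOperator (t • C) := hC.smul t
  have h1 : ∃ x, x + t • C x = 0 ∧ x ≠ 0 := by
    by_contra! h
    exact hu (isUnit_one_add_of_injective hcomp h)
  obtain ⟨x, hx, hx0⟩ := h1
  have ht0 : t ≠ 0 := by
    rintro rfl
    simp at hx
    exact hx0 hx
  refine ⟨-t⁻¹, ⟨?_, ?_⟩, by simp⟩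
  · rw [norm_neg, norm_inv]
    exact inv_anti₀ (norm_pos_iff.mpr ht0) (ht.trans (le_max_left _ _))
  · refine hasEigenvalue_of_hasEigenvector (x := x) ⟨mem_eigenspace_iff.mpr ?_, hx0⟩
    have h2 : t • C x = -x := by rw [eq_neg_iff_add_eq_zero, add_comm]; exact hx
    change C x = -t⁻¹ • x
    rw [neg_smul, ← smul_neg, ← h2, inv_smul_smul₀ ht0]

theorem countable_not_isUnit {C : E →L[ℂ] E} (hC : IsCompactOperator C) :
    {t : ℂ | ¬ IsUnit (1 + t • C)}.Countable := by
  refine (Set.countable_iUnion fun n : ℕ => (finite_not_isUnit hC n).countable).mono ?_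
  intro t ht
  obtain ⟨n, hn⟩ := exists_nat_ge ‖t‖
  exact Set.mem_iUnion.mpr ⟨n, hn, ht⟩

theorem isUnit_pencil (hS : IsCompactOperator S) {a k : ℂ}
    (h : ∀ x, pencil S V a k x = 0 → x = 0) : IsUnit (pencil S V a k) := by
  refine isUnit_one_add_of_injective (hS.comp_clm _) fun x hx => h x ?_
  rw [pencil_apply]
  simpa using hx

theorem not_isUnit_pencil (hS : IsCompactOperator S) {a k : ℂ} :
    ¬ IsUnit (pencil S V a k) ↔ ∃ x, x ≠ 0 ∧ pencil S V a k x = 0 := by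
  constructor
  · intro h
    by_contra! h'
    exact h (isUnit_pencil hS fun x hx => by_contra fun h0 => h' x h0 hx)
  · rintro ⟨x, hx0, hx⟩ h
    exact hx0 (eq_zero_of_isUnit h hx)

end Compact

/-! ### Rigidity of the spectrum of a skew family -/

section Rigidity

open Filter Topology

/-- Removable singularity followed by the maximum principle. This is how residues are bounded by the
values of a resolvent on a circle. -/
theorem norm_limit_le_of_punctured {F : Type*} [NormedAddCommGroup F] [NormedSpace ℂ F]
    [CompleteSpace F] {f : ℂ → F} {c : ℂ} {r : ℝ} (hr : 0 < r)
    (hd : ∀ z, z ≠ c → ‖z - c‖ ≤ r → DifferentiableAt ℂ f z) {L : F}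
    (hL : Tendsto f (𝓝[≠] c) (𝓝 L)) {C : ℝ} (hC : ∀ z, ‖z - c‖ = r → ‖f z‖ ≤ C) : ‖L‖ ≤ C := by
  let g := Function.update f c L
  have hgc : ContinuousAt g c := continuousAt_update_same.mpr hL
  have hgd : ∀ z, z ≠ c → ‖z - c‖ ≤ r → DifferentiableAt ℂ g z := by
    intro z hz hzr
    refine (hd z hz hzr).congr_of_eventuallyEq ?_
    filter_upwards [isOpen_ne.mem_nhds hz] with w hw
    exact Function.update_of_ne hw _ _
  have h1 : DifferentiableOn ℂ g (Metric.ball c r) := by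
    refine (Complex.differentiableOn_compl_singleton_and_continuousAt_iff
      (Metric.ball_mem_nhds c hr)).mp ⟨fun z hz => ?_, hgc⟩
    exact (hgd z hz.2 (by simpa [dist_eq_norm] using (Metric.mem_ball.mp hz.1).le)
      ).differentiableWithinAt
  have h2 : ContinuousOn g (Metric.closedBall c r) := by
    intro z hz
    by_cases h : z = c
    · rw [h]; exact hgc.continuousWithinAt
    · exact (hgd z h (by simpa [dist_eq_norm] using hz)).continuousAt.continuousWithinAt
  have h3 : ‖g c‖ ≤ C := by
    refine Complex.norm_le_of_forall_mem_frontier_norm_le (U := Metric.ball c r)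
      Metric.isBounded_ball ⟨h1, h2.mono Metric.closure_ball_subset_closedBall⟩ (fun z hz => ?_)
      (subset_closure (Metric.mem_ball_self hr))
    rw [frontier_ball c hr.ne'] at hz
    have hz' : ‖z - c‖ = r := by simpa [dist_eq_norm] using hz
    have hne : z ≠ c := by
      rintro rfl
      simp at hz'
      exact hr.ne hz'
    have : g z = f z := Function.update_of_ne hne _ _
    rw [this]
    exact hC z hz'
  simpa [g] using h3

variable {E : Type*} [NormedAddCommGroup E] [InnerProductSpace ℂ E]

/-- `k` is an eigenvalue of the pencil outside of `D`, or the pairing of its eigenvectors with those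
at `-k` is degenerate. -/
def Degenerate (S V : E →L[ℂ] E) (D : Set ℂ) (B : E →L[ℂ] E →L[ℂ] ℂ) (a k : ℂ) : Prop :=
  ∃ x, x ≠ 0 ∧ pencil S V a k x = 0 ∧
    (k ∉ D ∨ ∃ y, y ≠ 0 ∧ pencil S V a (-k) y = 0 ∧ B x y = 0)

/-- The pencil of `A + aV - k`, `A = S⁻¹`, where `A` and `V` are skew with respect to a
nondegenerate bilinear form, the points of `D` are always eigenvalues, and the spectra are periodic.
-/
structure SkewPencil (S V : E →L[ℂ] E) (D : Set ℂ) (B : E →L[ℂ] E →L[ℂ] ℂ) : Prop where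
  compact : IsCompactOperator S
  skew : ∀ a k k' w f y, pencil S V a k w = S f → pencil S V a k' y = 0 →
    B f y = -((k + k') * B w y)
  nondeg : ∀ y, y ≠ 0 → ∃ f, B f y ≠ 0
  eigenvalue : ∀ k ∈ D, ∀ a, ∃ x, x ≠ 0 ∧ pencil S V a k x = 0
  neg_mem : ∀ k ∈ D, -k ∈ D
  periodic : ∃ R : ℝ, ∀ k, ∃ k', ‖k'‖ ≤ R ∧ ∀ a, Degenerate S V D B a k → Degenerate S V D B a k'
  zero : ∀ k, ¬ Degenerate S V D B 0 k

variable {S V : E →L[ℂ] E} {D : Set ℂ} {B : E →L[ℂ] E →L[ℂ] ℂ}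

theorem pencil_smul_inv_norm {a k : ℂ} {x : E} (hx : x ≠ 0) (h : pencil S V a k x = 0) :
    ‖(‖x‖⁻¹ : ℂ) • x‖ = 1 ∧ pencil S V a k ((‖x‖⁻¹ : ℂ) • x) = 0 := by
  refine ⟨?_, by rw [map_smul, h, smul_zero]⟩
  rw [norm_smul, norm_inv, norm_real, norm_norm, inv_mul_cancel₀ (norm_ne_zero_iff.mpr hx)]

namespace SkewPencil

/-- Periodicity moves the degenerate points k_n into a bounded set. Limits of k_n and of normalized
eigenvectors then exist along a subsequence and witness degeneracy of the limit. -/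
theorem isClosed_degenerate (h : SkewPencil S V D B) :
    IsClosed {a | ∃ k, Degenerate S V D B a k} := by
  obtain ⟨R, hR⟩ := h.periodic
  refine IsSeqClosed.isClosed fun an a han ha => ?_
  have h1 : ∀ n, ∃ k, ‖k‖ ≤ R ∧ Degenerate S V D B (an n) k := by
    intro n
    obtain ⟨k, hk⟩ := han n
    obtain ⟨k', hk', hd⟩ := hR k
    exact ⟨k', hk', hd _ hk⟩
  choose k0 hk0 hdeg0 using h1
  obtain ⟨k, -, φ, hφ, hk⟩ := (isCompact_closedBall (0 : ℂ) R).tendsto_subseq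
    (x := k0) (fun n => by simpa using hk0 n)
  replace ha : Tendsto (an ∘ φ) atTop (𝓝 a) := ha.comp hφ.tendsto_atTop
  have hdeg : ∀ n, Degenerate S V D B ((an ∘ φ) n) ((k0 ∘ φ) n) := fun n => hdeg0 _
  generalize an ∘ φ = bn at ha hdeg
  generalize k0 ∘ φ = kn at hk hdeg
  have hxn : ∀ n, ∃ x, ‖x‖ = 1 ∧ pencil S V (bn n) (kn n) x = 0 ∧ (k ∈ D →
      ∃ y, ‖y‖ = 1 ∧ pencil S V (bn n) (-k) y = 0 ∧ B x y = 0) := by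
    intro n
    obtain ⟨x, hx0, hx, hor⟩ := hdeg n
    obtain ⟨hx1, hx2⟩ := pencil_smul_inv_norm hx0 hx
    refine ⟨_, hx1, hx2, fun hkD => ?_⟩
    -- The partner is sought at -k, where k is the limit, rather than at -k_n. If k_n ≠ k, the
    -- protected eigenvector at -k will do: the skew identity gives (k_n - k) B(x, y) = 0.
    have hy : ∃ y, y ≠ 0 ∧ pencil S V (bn n) (-k) y = 0 ∧ B x y = 0 := by
      by_cases hkk : kn n = k
      · rw [hkk] at hor
        exact hor.resolve_left (not_not_intro hkD)
      · obtain ⟨y, hy0, hy⟩ := h.eigenvalue (-k) (h.neg_mem k hkD) (bn n)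
        refine ⟨y, hy0, hy, ?_⟩
        have h2 := h.skew (bn n) (kn n) (-k) x 0 y (by rw [hx, map_zero]) hy
        rw [map_zero, zero_apply, eq_comm, neg_eq_zero, ← sub_eq_add_neg] at h2
        exact (mul_eq_zero.mp h2).resolve_left (sub_ne_zero.mpr hkk)
    obtain ⟨y, hy0, hy, hB⟩ := hy
    obtain ⟨hy1, hy2⟩ := pencil_smul_inv_norm hy0 hy
    exact ⟨_, hy1, hy2, by rw [map_smul, map_smul, smul_apply, hB, smul_zero, smul_zero]⟩
  choose x hx1 hx2 hxy using hxn
  obtain ⟨x', ψ, hψ, hx', hx'1, hx'2⟩ := exists_tendsto_subseq_pencil h.compact (V := V) ha hk hx1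
    (by simp [hx2])
  refine ⟨k, x', norm_ne_zero_iff.mp (hx'1 ▸ one_ne_zero), hx'2, ?_⟩
  by_cases hkD : k ∈ D
  · right
    choose y hy1 hy2 hB using fun n => hxy n hkD
    obtain ⟨y', χ, hχ, hy', hy'1, hy'2⟩ := exists_tendsto_subseq_pencil h.compact
      (V := V) (ha.comp hψ.tendsto_atTop) (tendsto_const_nhds (x := -k)) (x := y ∘ ψ)
      (fun n => hy1 _) (by simp [hy2])
    refine ⟨y', norm_ne_zero_iff.mp (hy'1 ▸ one_ne_zero), hy'2, ?_⟩
    have h3 : Tendsto (fun n => B (x (ψ (χ n))) (y (ψ (χ n)))) atTop (𝓝 (B x' y')) :=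
      (B.isBoundedBilinearMap.continuous.tendsto (x', y')).comp
        ((hx'.comp hχ.tendsto_atTop).prodMk_nhds hy')
    refine tendsto_nhds_unique h3 ?_
    simp [hB]
  · exact Or.inl hkD

end SkewPencil

/-- The resolvent `(A + aV - k)⁻¹`, `A = S⁻¹`. -/
def pencilResolvent (S V : E →L[ℂ] E) (a k : ℂ) : E →L[ℂ] E :=
  Ring.inverse (pencil S V a k) * S

theorem pencil_pencilResolvent {a k : ℂ} (h : IsUnit (pencil S V a k)) (f : E) :
    pencil S V a k (pencilResolvent S V a k f) = S f := by
  rw [← mul_apply_eq_comp, pencilResolvent, ← mul_assoc, Ring.mul_inverse_cancel _ h, one_mul]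

theorem inverse_pencil_apply {a k : ℂ} (h : IsUnit (pencil S V a k)) (x : E) :
    Ring.inverse (pencil S V a k) (pencil S V a k x) = x := by
  rw [← mul_apply_eq_comp, Ring.inverse_mul_cancel _ h, one_apply_eq_self]

theorem continuous_pencil : Continuous fun z : ℂ × ℂ => pencil S V z.1 z.2 :=
  continuous_iff_continuousAt.mpr fun z =>
    tendsto_pencil (continuous_fst.tendsto z) (continuous_snd.tendsto z)

variable [CompleteSpace E]

theorem continuousAt_pencilResolvent {z : ℂ × ℂ} (h : IsUnit (pencil S V z.1 z.2)) :
    ContinuousAt (fun z : ℂ × ℂ => pencilResolvent S V z.1 z.2) z := by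
  obtain ⟨u, hu⟩ := h
  have h1 := NormedRing.inverse_continuousAt u
  rw [hu] at h1
  have h2 : ContinuousAt (fun z : ℂ × ℂ => Ring.inverse (pencil S V z.1 z.2)) z :=
    ContinuousAt.comp (f := fun z : ℂ × ℂ => pencil S V z.1 z.2) h1
      continuous_pencil.continuousAt
  exact h2.mul continuousAt_const

theorem differentiableAt_pencilResolvent {a k : ℂ} (h : IsUnit (pencil S V a k)) :
    DifferentiableAt ℂ (pencilResolvent S V a) k := by
  have h1 : DifferentiableAt ℂ (pencil S V a) k := by
    unfold pencil
    fun_prop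
  have h2 : DifferentiableAt ℂ (fun k => Ring.inverse (pencil S V a k)) k :=
    (differentiableAt_inverse h).comp k h1
  exact h2.mul_const S

/-- The pencil at k is the pencil at k₀ times 1 - (k - k₀)C with C the compact resolvent at k₀, so
its singular points are isolated. -/
theorem exists_radius_isUnit (hS : IsCompactOperator S) {a k₀ : ℂ}
    (h : IsUnit (pencil S V a k₀)) (c : ℂ) :
    ∃ r : ℝ, 0 < r ∧ ∀ k, k ≠ c → ‖k - c‖ ≤ r → IsUnit (pencil S V a k) := by
  let C := pencilResolvent S V a k₀
  have hC : IsCompactOperator C := hS.clm_comp _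
  have hfac : ∀ k, pencil S V a k = pencil S V a k₀ * (1 + (-(k - k₀)) • C) := by
    intro k
    have h1 : pencil S V a k₀ * C = S := by
      ext f
      exact pencil_pencilResolvent h f
    rw [mul_add, mul_smul_comm, h1, mul_one]
    simp only [pencil, mul_sub, mul_smul_comm, mul_one]
    module
  let Z := (fun t => k₀ - t) '' {t : ℂ | ‖t‖ ≤ ‖c - k₀‖ + 1 ∧ ¬ IsUnit (1 + t • C)}
  have hfin : Z.Finite := (finite_not_isUnit hC (‖c - k₀‖ + 1)).image _
  have h2 : ∀ᶠ k in 𝓝[≠] c, k ∉ Z := by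
    have := (hfin.subset (Set.sdiff_subset (s := Z) (t := {c}))).isClosed.isOpen_compl.mem_nhds
      (x := c) (by simp)
    rw [eventually_nhdsWithin_iff]
    filter_upwards [this] with k hk hkc hk'
    exact hk ⟨hk', hkc⟩
  obtain ⟨δ, hδ, h3⟩ := (nhdsWithin_hasBasis Metric.nhds_basis_closedBall _).eventually_iff.mp h2
  refine ⟨min δ 1, lt_min hδ one_pos, fun k hkc hk => ?_⟩
  have h4 := @h3 k ⟨by simpa [dist_eq_norm] using hk.trans (min_le_left _ _), hkc⟩
  rw [hfac]
  refine h.mul ?_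
  by_contra hu
  refine h4 ⟨-(k - k₀), ⟨?_, hu⟩, by ring⟩
  rw [norm_neg]
  calc ‖k - k₀‖ ≤ ‖k - c‖ + ‖c - k₀‖ := norm_sub_le_norm_sub_add_norm_sub _ _ _
    _ ≤ _ := by linarith [hk.trans (min_le_right _ _)]

namespace SkewPencil

theorem isUnit_of_not_degenerate (h : SkewPencil S V D B) {a k : ℂ} (hk : k ∉ D)
    (hd : ¬ Degenerate S V D B a k) : IsUnit (pencil S V a k) := by
  by_contra hu
  obtain ⟨x, hx0, hx⟩ := (not_isUnit_pencil h.compact).mp hu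
  exact hd ⟨x, hx0, hx, Or.inl hk⟩

/-- At a nondegenerate point the resolvent has at most a simple pole. Otherwise the vectors (k_n -
c)(A + aV - k_n)⁻¹f_n, once normalized, converge to an eigenvector at c, while the normalized data
tend to zero. The skew identity then makes that eigenvector annihilate the kernel at -c. -/
theorem eventually_norm_le (h : SkewPencil S V D B) {a c : ℂ} (hd : ¬ Degenerate S V D B a c)
    (hu : ∀ᶠ k in 𝓝[≠] c, IsUnit (pencil S V a k)) :
    ∃ M : ℝ, ∀ᶠ k in 𝓝[≠] c, ‖(k - c) • pencilResolvent S V a k‖ ≤ M := by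
  by_contra! hcon
  have h1 : ∀ n : ℕ, ∃ k, IsUnit (pencil S V a k) ∧ ‖k - c‖ < 1 / ((n : ℝ) + 1) ∧
      (n : ℝ) + 1 < ‖(k - c) • pencilResolvent S V a k‖ := by
    intro n
    have h2 : ∀ᶠ k in 𝓝[≠] c, ‖k - c‖ < 1 / ((n : ℝ) + 1) := by
      refine nhdsWithin_le_nhds ?_
      filter_upwards [Metric.ball_mem_nhds c (Nat.one_div_pos_of_nat (α := ℝ) (n := n))] with k hk
      simpa [dist_eq_norm] using hk
    have h3 := (hcon ((n : ℝ) + 1)).and_eventually (hu.and h2)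
    obtain ⟨k, hk1, hk2, hk3⟩ := (h3.mono fun k hk => hk).exists
    exact ⟨k, hk2, hk3, by simpa using hk1⟩
  choose k hku hkc hkn using h1
  have h2 : ∀ n : ℕ, ∃ f : E, ((n : ℝ) + 1) * ‖f‖ < ‖(k n - c) • pencilResolvent S V a (k n) f‖ := by
    intro n
    by_contra! hf
    exact (hkn n).not_ge (ContinuousLinearMap.opNorm_le_bound _ (by positivity) hf)
  choose f hf using h2
  let w : ℕ → E := fun n => (k n - c) • pencilResolvent S V a (k n) (f n)
  have hw : ∀ n, 0 < ‖w n‖ := fun n => lt_of_le_of_lt (by positivity) (hf n)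
  let x : ℕ → E := fun n => (‖w n‖⁻¹ : ℂ) • w n
  have hx1 : ∀ n, ‖x n‖ = 1 := fun n => by
    simp only [x]
    rw [norm_smul, norm_inv, norm_real, norm_norm, inv_mul_cancel₀ (hw n).ne']
  have hfw : ∀ n, ‖(‖w n‖⁻¹ : ℂ) • f n‖ ≤ 1 / ((n : ℝ) + 1) := by
    intro n
    rw [norm_smul, norm_inv, norm_real, norm_norm, inv_mul_eq_div, div_le_div_iff₀ (hw n)
      (by positivity), one_mul, mul_comm]
    exact (hf n).le
  have hlim : Tendsto (fun n : ℕ => 1 / ((n : ℝ) + 1)) atTop (𝓝 0) :=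
    tendsto_one_div_add_atTop_nhds_zero_nat
  have hk : Tendsto k atTop (𝓝 c) :=
    tendsto_iff_norm_sub_tendsto_zero.mpr
      (squeeze_zero (fun _ => norm_nonneg _) (fun n => (hkc n).le) hlim)
  have hfw0 : Tendsto (fun n => (‖w n‖⁻¹ : ℂ) • f n) atTop (𝓝 0) :=
    squeeze_zero_norm hfw hlim
  have hpen : ∀ n, pencil S V a (k n) (x n) = (k n - c) • S ((‖w n‖⁻¹ : ℂ) • f n) := by
    intro n
    simp only [x, w, map_smul, pencil_pencilResolvent (hku n)]
    rw [smul_comm]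
  obtain ⟨y, φ, hφ, hy, hy1, hy2⟩ := exists_tendsto_subseq_pencil h.compact
    (V := V) (tendsto_const_nhds (x := a)) hk hx1 (by
      simp only [hpen]
      have h3 : Tendsto (fun n => S ((‖w n‖⁻¹ : ℂ) • f n)) atTop (𝓝 0) := by
        have h9 := (S.continuous.tendsto 0).comp hfw0
        rwa [map_zero] at h9
      simpa using (hk.sub_const c).smul h3)
  refine hd ⟨y, norm_ne_zero_iff.mp (hy1 ▸ one_ne_zero), hy2, ?_⟩
  by_cases hcD : c ∈ D
  · right
    obtain ⟨z, hz0, hz⟩ := h.eigenvalue (-c) (h.neg_mem c hcD) a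
    refine ⟨z, hz0, hz, ?_⟩
    -- In the skew identity k + k' = k_n - c, which is exactly the factor in the definition of w, so
    -- it cancels.
    have h4 : ∀ n, B (x n) z = -B ((‖w n‖⁻¹ : ℂ) • f n) z := by
      intro n
      have h5 := h.skew a (k n) (-c) _ (f n) z (pencil_pencilResolvent (hku n) (f n)) hz
      simp only [x, w, map_smul, smul_apply, smul_eq_mul, h5]
      ring
    have h6 : Tendsto (fun n => B (x (φ n)) z) atTop (𝓝 (B y z)) :=
      ((B.flip z).continuous.tendsto y).comp hy
    have h7 : Tendsto (fun n => B (x (φ n)) z) atTop (𝓝 0) := by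
      simp only [h4]
      have h8 := ((B.flip z).continuous.tendsto 0).comp (hfw0.comp hφ.tendsto_atTop)
      simpa [Function.comp_def] using h8.neg
    exact tendsto_nhds_unique h6 h7
  · exact Or.inl hcD

/-- Near an isolated spectral point `c` of the limit, minus the residues of the resolvents. -/
theorem exists_residues (h : SkewPencil S V D B) {a k₀ : ℂ} (hu : IsUnit (pencil S V a k₀))
    {an : ℕ → ℂ} (ha : Tendsto an atTop (𝓝 a)) (hd : ∀ n k, ¬ Degenerate S V D B (an n) k)
    (c : ℂ) : ∃ (Y : ℕ → E →L[ℂ] E) (M : ℝ), (∀ᶠ n in atTop, ‖Y n‖ ≤ M) ∧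
      (∀ n f, pencil S V (an n) c (Y n f) = 0) ∧
      (∀ n f y, pencil S V (an n) (-c) y = 0 → B (Y n f) y = -B f y) ∧
      ∀ x, pencil S V a c x = 0 → Tendsto (fun n => Y n x) atTop (𝓝 (-x)) := by
  obtain ⟨r, hr, hiso⟩ := exists_radius_isUnit h.compact hu c
  have hunit : ∀ n k, k ≠ c → ‖k - c‖ ≤ r → IsUnit (pencil S V (an n) k) := by
    intro n k hkc hk
    -- Points of `D` are eigenvalues of the limit pencil too. Hence the punctured disc, chosen for
    -- the limit, contains none of them and serves all n at once.
    refine h.isUnit_of_not_degenerate (fun hkD => ?_) (hd n k)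
    obtain ⟨x, hx0, hx⟩ := h.eigenvalue k hkD a
    exact hx0 (eq_zero_of_isUnit (hiso k hkc hk) hx)
  have hpunct : ∀ᶠ k in 𝓝[≠] c, k ≠ c ∧ ‖k - c‖ ≤ r := by
    rw [eventually_nhdsWithin_iff]
    filter_upwards [Metric.closedBall_mem_nhds c hr] with k hk hkc
    exact ⟨hkc, by simpa [dist_eq_norm] using hk⟩
  -- The limit of N at c will be `Y`. Since the pole is at most simple, it is minus the spectral
  -- projection onto the kernel at c, and zero if c is regular.
  let N : ℕ → ℂ → E →L[ℂ] E := fun n k => (k - c) • pencilResolvent S V (an n) k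
  have hNd : ∀ n k, k ≠ c → ‖k - c‖ ≤ r → DifferentiableAt ℂ (N n) k := fun n k hkc hk =>
    (differentiableAt_id.sub_const c).smul (differentiableAt_pencilResolvent (hunit n k hkc hk))
  have hlim : ∀ n, ∃ L, Tendsto (N n) (𝓝[≠] c) (𝓝 L) := by
    intro n
    obtain ⟨M, hM⟩ := h.eventually_norm_le (hd n c) (hpunct.mono fun k hk => hunit n k hk.1 hk.2)
    refine ⟨_, tendsto_limUnder_of_differentiable_on_punctured_nhds_of_bounded_under
      (hpunct.mono fun k hk => hNd n k hk.1 hk.2) ⟨M, ?_⟩⟩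
    rw [eventually_map]
    filter_upwards [hM] with k hk
    simpa [N] using hk
  choose Y hY using hlim
  -- The circle is compact and avoids the singular points of the limit, so joint continuity of the
  -- resolvent in (a, k) gives a bound uniform in n.
  have hsphere : ∃ M₀ : ℝ, ∀ᶠ n in atTop, ∀ k, ‖k - c‖ = r →
      ‖pencilResolvent S V (an n) k‖ ≤ M₀ := by
    have hne : ∀ k ∈ Metric.sphere c r, k ≠ c ∧ ‖k - c‖ ≤ r := by
      intro k hk
      have hk' : ‖k - c‖ = r := by simpa [dist_eq_norm] using hk
      exact ⟨fun e => hr.ne (by simpa [e] using hk'), hk'.le⟩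
    have hcont : ContinuousOn (fun k => pencilResolvent S V a k) (Metric.sphere c r) :=
      fun k hk => (differentiableAt_pencilResolvent
        (hiso k (hne k hk).1 (hne k hk).2)).continuousAt.continuousWithinAt
    obtain ⟨M₁, hM₁⟩ := (isCompact_sphere c r).exists_bound_of_continuousOn hcont
    refine ⟨M₁ + 1, ?_⟩
    have h1 : ∀ᶠ b in 𝓝 a, ∀ k ∈ Metric.sphere c r, ‖pencilResolvent S V b k‖ < M₁ + 1 := by
      refine (isCompact_sphere c r).eventually_forall_of_forall_eventually fun k hk => ?_
      exact (continuousAt_pencilResolvent (z := (a, k))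
        (hiso k (hne k hk).1 (hne k hk).2)).norm.eventually_lt_const
          (lt_of_le_of_lt (hM₁ k hk) (lt_add_one _))
    filter_upwards [ha.eventually h1] with n hn k hk
    exact (hn k (by simpa [dist_eq_norm] using hk)).le
  obtain ⟨M₀, hM₀⟩ := hsphere
  have hclm : ∀ n f, Tendsto (fun k => N n k f) (𝓝[≠] c) (𝓝 (Y n f)) := fun n f =>
    ((ContinuousLinearMap.apply ℂ E f).continuous.tendsto _).comp (hY n)
  have hk0 : Tendsto (fun k : ℂ => k - c) (𝓝[≠] c) (𝓝 0) := by
    have : Tendsto (fun k : ℂ => k - c) (𝓝 c) (𝓝 (c - c)) := tendsto_id.sub_const c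
    rw [sub_self] at this
    exact this.mono_left nhdsWithin_le_nhds
  refine ⟨Y, r * M₀, ?_, ?_, ?_, ?_⟩
  · filter_upwards [hM₀] with n hn
    refine norm_limit_le_of_punctured hr (hNd n) (hY n) fun k hk => ?_
    simp only [N]
    rw [norm_smul, hk]
    exact mul_le_mul_of_nonneg_left (hn k hk) hr.le
  · intro n f
    have h1 : Tendsto (fun k => pencil S V (an n) k (N n k f)) (𝓝[≠] c)
        (𝓝 (pencil S V (an n) c (Y n f))) :=
      (isBoundedBilinearMap_apply.continuous.tendsto _).comp
        ((tendsto_pencil tendsto_const_nhds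
          (tendsto_id.mono_left nhdsWithin_le_nhds)).prodMk_nhds (hclm n f))
    refine tendsto_nhds_unique h1 ?_
    have h2 : Tendsto (fun k : ℂ => (k - c) • S f) (𝓝[≠] c) (𝓝 0) := by
      simpa using hk0.smul_const (S f)
    refine h2.congr' ?_
    filter_upwards [hpunct] with k hk
    simp only [N, smul_apply, map_smul, pencil_pencilResolvent (hunit n k hk.1 hk.2)]
  · intro n f y hy
    have h1 : Tendsto (fun k => B (N n k f) y) (𝓝[≠] c) (𝓝 (B (Y n f) y)) :=
      ((B.flip y).continuous.tendsto _).comp (hclm n f)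
    refine tendsto_nhds_unique h1 (tendsto_const_nhds.congr' ?_)
    filter_upwards [hpunct] with k hk
    have h5 := h.skew (an n) k (-c) _ f y (pencil_pencilResolvent (hunit n k hk.1 hk.2) f) hy
    simp only [N, map_smul, smul_apply, smul_eq_mul, h5]
    ring
  · intro x hx
    -- Since (A + aV - c)x = 0, one has (A + a_nV - k)x = (a_n - a)Vx - (k - c)x. Applying the
    -- resolvent leaves an error of size |a_n - a|, controlled on the circle.
    have h1 : ∀ n k, k ≠ c → ‖k - c‖ ≤ r →
        N n k x + x = (an n - a) • pencilResolvent S V (an n) k (V x) := by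
      intro n k hkc hk
      have hu' := hunit n k hkc hk
      have h2 : pencil S V (an n) k x = (an n - a) • S (V x) - (k - c) • S x := by
        rw [← sub_zero (pencil S V (an n) k x), ← hx, pencil_apply, pencil_apply]
        simp only [map_sub, map_smul]
        module
      have h3 := inverse_pencil_apply hu' x
      rw [h2, map_sub, map_smul, map_smul] at h3
      simp only [N, smul_apply, pencilResolvent, mul_apply_eq_comp]
      rw [sub_eq_iff_eq_add.mp h3, add_comm]
    rw [tendsto_iff_norm_sub_tendsto_zero]
    refine squeeze_zero' (g := fun n => ‖an n - a‖ * (M₀ * ‖V x‖))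
      (Eventually.of_forall fun _ => norm_nonneg _) ?_ ?_
    · filter_upwards [hM₀] with n hn
      rw [sub_neg_eq_add]
      refine norm_limit_le_of_punctured (f := fun k => N n k x + x) hr
        (fun k hkc hk => ((hNd n k hkc hk).clm_apply (differentiableAt_const x)).add_const x)
        ((hclm n x).add_const x) fun k hk => ?_
      have hkc : k ≠ c := fun e => hr.ne (by simpa [e] using hk)
      rw [h1 n k hkc hk.le, norm_smul]
      exact mul_le_mul_of_nonneg_left
        ((pencilResolvent S V (an n) k).le_of_opNorm_le (hn k hk) _) (norm_nonneg _)
    · simpa using (tendsto_iff_norm_sub_tendsto_zero.mp ha).mul_const (M₀ * ‖V x‖)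

/-- An eigenvector x at the limit is approximated by the eigenvectors -Y_n x of the approximating
pencils at the same point c. Eigenvalues therefore cannot appear outside `D`, and a degenerate
pairing in the limit contradicts the nondegenerate ones. -/
theorem not_degenerate_of_tendsto (h : SkewPencil S V D B) {a k₀ : ℂ}
    (hu : IsUnit (pencil S V a k₀)) {an : ℕ → ℂ} (ha : Tendsto an atTop (𝓝 a))
    (hd : ∀ n k, ¬ Degenerate S V D B (an n) k) (c : ℂ) : ¬ Degenerate S V D B a c := by
  rintro ⟨x, hx0, hx, hor⟩
  obtain ⟨Y, M, hM, hY1, hY2, hY3⟩ := h.exists_residues hu ha hd c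
  have hYx := hY3 x hx
  rcases hor with hcD | ⟨y, hy0, hy, hB⟩
  · have h1 : ∀ n, Y n x = 0 := by
      intro n
      by_contra h0
      exact hd n c ⟨_, h0, hY1 n x, Or.inl hcD⟩
    simp only [h1] at hYx
    exact hx0 (neg_eq_zero.mp (tendsto_nhds_unique hYx tendsto_const_nhds))
  · obtain ⟨Y', -, -, hY'1, -, hY'3⟩ := h.exists_residues hu ha hd (-c)
    have hYy := hY'3 y hy
    obtain ⟨f, hf⟩ := h.nondeg y hy0
    have hy'0 : ∀ᶠ n in atTop, Y' n y ≠ 0 := hYy.eventually_ne (neg_ne_zero.mpr hy0)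
    -- The sum of the two sides' vectors lies in the kernel at c and is orthogonal to Y'_n y,
    -- because B(Y_n f, ·) = -B(f, ·) on the kernel at -c. Nondegeneracy makes it zero. As B(Y_n x,
    -- Y'_n y) → B(x, y) = 0, the limit reads B(f, y) x = 0.
    have h1 : ∀ᶠ n in atTop, B f (Y' n y) • Y n x = -(B (Y n x) (Y' n y) • Y n f) := by
      filter_upwards [hy'0] with n hn
      have h2 := hY2 n f _ (hY'1 n y)
      rw [eq_neg_iff_add_eq_zero]
      by_contra h0
      refine hd n c ⟨_, h0, ?_, Or.inr ⟨_, hn, hY'1 n y, ?_⟩⟩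
      · rw [map_add, map_smul, map_smul, hY1, hY1, smul_zero, smul_zero, add_zero]
      · simp only [map_add, map_smul, add_apply, smul_apply, smul_eq_mul, h2]
        ring
    have h3 : Tendsto (fun n => B f (Y' n y) • Y n x) atTop (𝓝 (B f (-y) • -x)) :=
      (((B f).continuous.tendsto _).comp hYy).smul hYx
    have h4 : Tendsto (fun n => B (Y n x) (Y' n y)) atTop (𝓝 0) := by
      have h5 : Tendsto (fun n => B (Y n x) (Y' n y)) atTop (𝓝 (B (-x) (-y))) :=
        (B.isBoundedBilinearMap.continuous.tendsto (-x, -y)).comp (hYx.prodMk_nhds hYy)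
      rwa [map_neg, map_neg, neg_apply, hB, neg_zero, neg_zero] at h5
    have h6 : Tendsto (fun n => -(B (Y n x) (Y' n y) • Y n f)) atTop (𝓝 0) := by
      rw [← neg_zero]
      refine (h4.zero_smul_isBoundedUnder_le ⟨M * ‖f‖, ?_⟩).neg
      rw [eventually_map]
      filter_upwards [hM] with n hn
      exact (Y n).le_of_opNorm_le hn f
    have h7 := tendsto_nhds_unique (h3.congr' h1) h6
    rw [map_neg, smul_neg, neg_smul, neg_neg] at h7
    exact (smul_eq_zero.mp h7).elim hf hx0

/-- In a the pencil factors as its value at a = 0 times 1 + aC with C compact. Countability is what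
makes the good parameters connected. -/
theorem countable_not_isUnit (h : SkewPencil S V D B) {k₀ : ℂ} (hk₀ : k₀ ∉ D) :
    {a | ¬ IsUnit (pencil S V a k₀)}.Countable := by
  have hu : IsUnit (pencil S V 0 k₀) := h.isUnit_of_not_degenerate hk₀ (h.zero k₀)
  let C := pencilResolvent S V 0 k₀ * V
  have hC : IsCompactOperator C := (h.compact.clm_comp _).comp_clm V
  refine (ChiralTBG.countable_not_isUnit hC).mono ?_
  rintro a ha hu'
  refine ha ?_
  have h1 : pencil S V a k₀ = pencil S V 0 k₀ * (1 + a • C) := by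
    have h2 : pencil S V 0 k₀ * C = S * V := by
      ext f
      exact pencil_pencilResolvent hu (V f)
    rw [mul_add, mul_smul_comm, h2, mul_one]
    simp only [pencil, mul_sub, mul_smul_comm, mul_one]
    module
  rw [h1]
  exact hu.mul hu'

/-- If one point is not an eigenvalue, then the eigenvalues are the points of `D`, and they are
nondegenerate. -/
theorem not_degenerate (h : SkewPencil S V D B) {a k₀ : ℂ} (hu : IsUnit (pencil S V a k₀))
    (k : ℂ) : ¬ Degenerate S V D B a k := by
  have hk₀ : k₀ ∉ D := by
    intro hk₀
    obtain ⟨x, hx0, hx⟩ := h.eigenvalue k₀ hk₀ a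
    exact hx0 (eq_zero_of_isUnit hu hx)
  let U : Set ℂ := {a | ¬ IsUnit (pencil S V a k₀)}ᶜ
  have hU : IsPreconnected U :=
    ((h.countable_not_isUnit hk₀).isConnected_compl_of_one_lt_rank (by simp)).isPreconnected
  let G : Set ℂ := {a | ∃ k, Degenerate S V D B a k}ᶜ
  have hG : IsOpen G := h.isClosed_degenerate.isOpen_compl
  have hU0 : (0 : ℂ) ∈ U := not_not_intro (h.isUnit_of_not_degenerate hk₀ (h.zero k₀))
  have hG0 : (0 : ℂ) ∈ G := fun ⟨k, hk⟩ => h.zero k hk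
  -- The open set G meets the connected set U at 0, and the closure of G within U stays in G, so G
  -- contains U.
  have hsub : U ⊆ G := by
    refine hU.subset_of_closure_inter_subset hG ⟨0, hU0, hG0⟩ ?_
    rintro b ⟨hb, hbU⟩
    obtain ⟨bn, hbn, hlim⟩ := mem_closure_iff_seq_limit.mp hb
    rintro ⟨k, hk⟩
    exact h.not_degenerate_of_tendsto (not_not.mp hbU) hlim
      (fun n k hnk => hbn n ⟨k, hnk⟩) k hk
  exact fun hk => hsub (not_not_intro hu : a ∈ U) ⟨k, hk⟩

end SkewPencil

end Rigidity
/-! ### Diagonal operators and permutations on `ℓ²` -/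

section SequenceSpace

open Filter Topology

variable {ι : Type*}

/-- The Hilbert space `ℓ²(ι)`. -/
abbrev Seq (ι : Type*) : Type _ := lp (fun _ : ι => ℂ) 2

theorem memlp_two_iff {f : ι → ℂ} : Memℓp f 2 ↔ Summable fun i => ‖f i‖ ^ 2 := by
  rw [memℓp_gen_iff (by norm_num)]
  simp

theorem Seq.norm_sq (x : Seq ι) : ‖x‖ ^ 2 = ∑' i, ‖x i‖ ^ 2 := by
  have h := lp.norm_rpow_eq_tsum (p := 2) (by norm_num) x
  simpa using h

theorem Seq.summable_sq (x : Seq ι) : Summable fun i => ‖x i‖ ^ 2 :=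
  memlp_two_iff.mp (lp.memℓp x)

theorem memlp_mul {c : ι → ℂ} {C : ℝ} (hc : ∀ i, ‖c i‖ ≤ C) (x : Seq ι) :
    Memℓp (fun i => c i * x i) 2 := by
  refine memlp_two_iff.mpr (Summable.of_nonneg_of_le (fun _ => by positivity) (fun i => ?_)
    (x.summable_sq.mul_left (C ^ 2)))
  rw [norm_mul, mul_pow]
  have := hc i
  gcongr

theorem norm_le_mul_norm {x y : Seq ι} {C : ℝ} (hC : 0 ≤ C) (h : ∀ i, ‖x i‖ ≤ C * ‖y i‖) :
    ‖x‖ ≤ C * ‖y‖ := by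
  refine (sq_le_sq₀ (norm_nonneg _) (by positivity)).mp ?_
  rw [mul_pow, Seq.norm_sq, Seq.norm_sq, ← tsum_mul_left]
  refine x.summable_sq.tsum_le_tsum (fun i => ?_) (y.summable_sq.mul_left _)
  rw [← mul_pow]
  exact pow_le_pow_left₀ (norm_nonneg _) (h i) 2

/-- The diagonal operator with bounded entries `c`. -/
def diag (c : ι → ℂ) (hc : ∃ C : ℝ, ∀ i, ‖c i‖ ≤ C) : Seq ι →L[ℂ] Seq ι :=
  LinearMap.mkContinuousOfExistsBound
    { toFun := fun x => ⟨fun i => c i * x i, memlp_mul hc.choose_spec x⟩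
      map_add' := fun x y => by ext i; exact mul_add _ _ _
      map_smul' := fun a x => by ext i; exact mul_left_comm _ _ _ }
    ⟨max hc.choose 0, fun x => norm_le_mul_norm (le_max_right _ _) fun i => by
      change ‖c i * x i‖ ≤ _
      rw [norm_mul]
      exact mul_le_mul_of_nonneg_right ((hc.choose_spec i).trans (le_max_left _ _))
        (norm_nonneg _)⟩

@[simp]
theorem diag_apply (c : ι → ℂ) (hc : ∃ C : ℝ, ∀ i, ‖c i‖ ≤ C) (x : Seq ι) (i : ι) :
    diag c hc x i = c i * x i := rfl

theorem Seq.hasSum_single [DecidableEq ι] (x : Seq ι) :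
    HasSum (fun i => lp.single 2 i (x i)) x :=
  lp.hasSum_single (by simp) x

/-- Truncation to the finitely many entries of modulus at least ε gives finite-rank operators
converging in norm. -/
theorem isCompactOperator_diag {c : ι → ℂ} (hc : ∃ C : ℝ, ∀ i, ‖c i‖ ≤ C)
    (h : ∀ ε : ℝ, 0 < ε → {i | ε ≤ ‖c i‖}.Finite) : IsCompactOperator (diag c hc) := by
  classical
  have hfin : ∀ ε : ℝ, 0 < ε → ∃ A : Seq ι →L[ℂ] Seq ι, IsCompactOperator A ∧
      ‖diag c hc - A‖ ≤ ε := by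
    intro ε hε
    let F := (h ε hε).toFinset
    let A : Seq ι →L[ℂ] Seq ι := ∑ i ∈ F,
      c i • (lp.singleContinuousLinearMap ℂ (fun _ : ι => ℂ) 2 i).comp
        (lp.evalCLM ℂ (fun _ : ι => ℂ) 2 i)
    have hA : ∀ x j, A x j = if j ∈ F then c j * x j else 0 := by
      intro x j
      simp only [A, sum_apply, lp.coeFn_sum, Finset.sum_apply]
      rw [← Finset.sum_ite_eq' F j fun i => c i * x i]
      refine Finset.sum_congr rfl fun i _ => ?_
      change c i * (lp.single 2 i (x i) : Seq ι) j = _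
      rw [lp.single_apply]
      by_cases hij : i = j
      · subst hij; simp
      · simp [hij, Ne.symm hij]
    refine ⟨A, ?_, ?_⟩
    · refine Submodule.sum_mem (compactOperator (RingHom.id ℂ) (Seq ι) (Seq ι)) fun i _ => ?_
      let e := lp.singleContinuousLinearMap ℂ (fun _ : ι => ℂ) 2 i
      have he : IsCompactOperator e := by
        refine ⟨_, (isCompact_closedBall (0 : ℂ) 1).image e.continuous, ?_⟩
        exact Filter.mem_of_superset (Metric.closedBall_mem_nhds 0 one_pos)
          (Set.subset_preimage_image _ _)
      exact (he.comp_clm (lp.evalCLM ℂ (fun _ : ι => ℂ) 2 i)).smul (c i)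
    · refine ContinuousLinearMap.opNorm_le_bound _ hε.le fun x =>
        norm_le_mul_norm hε.le fun j => ?_
      rw [sub_apply, lp.coeFn_sub, Pi.sub_apply, hA, diag_apply]
      by_cases hj : j ∈ F
      · rw [if_pos hj, sub_self, norm_zero]; positivity
      · rw [if_neg hj, sub_zero, norm_mul]
        have : ‖c j‖ ≤ ε := by
          by_contra! h'
          exact hj ((h ε hε).mem_toFinset.mpr h'.le)
        gcongr
  choose A hA1 hA2 using fun n : ℕ => hfin (1 / ((n : ℝ) + 1)) Nat.one_div_pos_of_nat
  refine isCompactOperator_of_tendsto (F := A) (l := atTop) ?_ (Eventually.of_forall hA1)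
  rw [tendsto_iff_norm_sub_tendsto_zero]
  refine squeeze_zero (fun _ => norm_nonneg _) (fun n => ?_)
    (tendsto_one_div_add_atTop_nhds_zero_nat (𝕜 := ℝ))
  rw [norm_sub_rev]
  exact hA2 n

theorem memlp_comp (σ : Equiv.Perm ι) (x : Seq ι) : Memℓp (fun i => x (σ i)) 2 :=
  memlp_two_iff.mpr ((σ.summable_iff (f := fun i => ‖x i‖ ^ 2)).mpr x.summable_sq)

/-- The operator `(x_i) ↦ (x_{σ i})`. -/
def permOp (σ : Equiv.Perm ι) : Seq ι →L[ℂ] Seq ι :=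
  LinearMap.mkContinuous
    { toFun := fun x => ⟨fun i => x (σ i), memlp_comp σ x⟩
      map_add' := fun _ _ => rfl
      map_smul' := fun _ _ => rfl } 1 fun x => by
    refine (sq_le_sq₀ (norm_nonneg _) (by positivity)).mp (le_of_eq ?_)
    rw [one_mul, Seq.norm_sq, Seq.norm_sq]
    exact σ.tsum_eq (fun i => ‖x i‖ ^ 2)

@[simp]
theorem permOp_apply (σ : Equiv.Perm ι) (x : Seq ι) (i : ι) : permOp σ x i = x (σ i) := rfl

theorem Seq.hasSum_mul (x y : Seq ι) : HasSum (fun i => x i * y i) (inner ℂ (star x) y) := by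
  refine (lp.hasSum_inner (star x) y).congr_fun fun i => ?_
  simp [mul_comm]

/-- The bilinear form `∑ xᵢ yᵢ`. -/
def dot : Seq ι →L[ℂ] Seq ι →L[ℂ] ℂ :=
  LinearMap.mkContinuous₂
    (LinearMap.mk₂ ℂ (fun x y => inner ℂ (star x) y)
      (fun x x' y => by rw [star_add, inner_add_left])
      (fun c x y => by rw [star_smul, inner_smul_left]; simp)
      (fun x y y' => inner_add_right _ _ _) (fun c x y => inner_smul_right _ _ _)) 1
    fun x y => by
      rw [one_mul]
      exact (norm_inner_le_norm (𝕜 := ℂ) (star x) y).trans_eq (by rw [norm_star x])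

theorem hasSum_dot (x y : Seq ι) : HasSum (fun i => x i * y i) (dot x y) := x.hasSum_mul y

/-- The matrix entries of an operator on `ℓ²`. -/
def entry [DecidableEq ι] (W : Seq ι →L[ℂ] Seq ι) (i j : ι) : ℂ := W (lp.single 2 j 1) i

theorem Seq.ext_single [DecidableEq ι] {F : Type*} [AddCommMonoid F] [Module ℂ F]
    [TopologicalSpace F] [T2Space F] {f g : Seq ι →L[ℂ] F}
    (h : ∀ i, f (lp.single 2 i 1) = g (lp.single 2 i 1)) : f = g := by
  refine lp.ext_continuousLinearMap (by simp) fun i => ?_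
  ext
  exact h i

theorem ext_entry [DecidableEq ι] {f g : Seq ι →L[ℂ] Seq ι}
    (h : ∀ i j, entry f i j = entry g i j) : f = g :=
  Seq.ext_single fun j => lp.ext (funext fun i => h i j)

theorem single_one_apply [DecidableEq ι] (i j : ι) :
    (lp.single 2 i (1 : ℂ) : Seq ι) j = if i = j then 1 else 0 := by
  rw [lp.single_apply]
  by_cases h : i = j
  · subst h; simp
  · simp [h, Ne.symm h]

theorem permOp_single [DecidableEq ι] (σ : Equiv.Perm ι) (i : ι) :
    permOp σ (lp.single 2 i (1 : ℂ)) = lp.single 2 (σ.symm i) 1 := by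
  ext j
  rw [permOp_apply, single_one_apply, single_one_apply]
  simp only [Equiv.symm_apply_eq]

theorem permOp_comm [DecidableEq ι] {σ : Equiv.Perm ι} {W : Seq ι →L[ℂ] Seq ι} {c : ℂ}
    (h : ∀ i j, entry W (σ i) (σ j) = c * entry W i j) (x : Seq ι) :
    permOp σ (W x) = c • W (permOp σ x) := by
  have h1 : (permOp σ).comp W = c • W.comp (permOp σ) := by
    refine Seq.ext_single fun j => ?_
    ext i
    have h2 := h i (σ.symm j)
    rw [Equiv.apply_symm_apply] at h2
    simpa [permOp_single, entry] using h2
  exact DFunLike.congr_fun h1 x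

end SequenceSpace
/-! ### Arithmetic of the Dirac points -/

theorem ofReal_sqrt_three_mul_I : ((√3 : ℝ) : ℂ) * I = 2 * omega + 1 := by
  apply Complex.ext
  · simp [omega_re]
  · simp only [mul_im, ofReal_re, I_im, mul_one, ofReal_im, I_re, mul_zero, add_zero, add_im,
      re_ofNat, im_ofNat, zero_mul, one_im, omega_im]
    ring

theorem ofReal_sqrt_three_sq : ((√3 : ℝ) : ℂ) * ((√3 : ℝ) : ℂ) = 3 := by
  rw [← ofReal_mul, Real.mul_self_sqrt (by norm_num)]
  norm_num

theorem omega_sq : omega * omega = -omega - 1 := by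
  have h : (2 * omega + 1) * (2 * omega + 1) = -3 := by
    rw [← ofReal_sqrt_three_mul_I]
    linear_combination (I * I) * ofReal_sqrt_three_sq + 3 * I_mul_I
  linear_combination h / 4

theorem omega_cube : omega * (omega * omega) = 1 := by
  rw [omega_sq]
  linear_combination -omega_sq

/-- The factor `4πi/√3`. -/
def dualScale : ℂ := 4 * π * I / (√3 : ℝ)

theorem dualScale_ne_zero : dualScale ≠ 0 := by
  have : ((√3 : ℝ) : ℂ) ≠ 0 := by norm_num
  simp [dualScale, Real.pi_ne_zero]

theorem mem_lattice_iff {z : ℂ} : z ∈ lattice ↔ ∃ m n : ℤ, z = m * omega + n := by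
  rw [PeriodPair.mem_lattice]
  simp [periods, eq_comm]

theorem mem_dualLattice {q : ℂ} :
    q ∈ dualLattice ↔ ∃ m n : ℤ, q = dualScale * (m * omega + n) := by
  constructor
  · rintro ⟨γ, hγ, rfl⟩
    obtain ⟨m, n, rfl⟩ := mem_lattice_iff.mp hγ
    exact ⟨m, n, rfl⟩
  · rintro ⟨m, n, rfl⟩
    exact ⟨_, mem_lattice_iff.mpr ⟨m, n, rfl⟩, rfl⟩

theorem K_eq : K = dualScale * (-(2 * omega + 1) / 3) := by
  have h : ((√3 : ℝ) : ℂ) ≠ 0 := by norm_num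
  rw [← ofReal_sqrt_three_mul_I, dualScale, K]
  field_simp
  rw [I_sq]
  ring

theorem dualLattice_add {p q : ℂ} (hp : p ∈ dualLattice) (hq : q ∈ dualLattice) :
    p + q ∈ dualLattice := by
  obtain ⟨γ, hγ, rfl⟩ := hp
  obtain ⟨δ, hδ, rfl⟩ := hq
  exact ⟨_, add_mem hγ hδ, by ring⟩

theorem dualLattice_neg {p : ℂ} (hp : p ∈ dualLattice) : -p ∈ dualLattice := by
  obtain ⟨γ, hγ, rfl⟩ := hp
  exact ⟨_, neg_mem hγ, by ring⟩

theorem dualLattice_sub {p q : ℂ} (hp : p ∈ dualLattice) (hq : q ∈ dualLattice) :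
    p - q ∈ dualLattice := by
  rw [sub_eq_add_neg]
  exact dualLattice_add hp (dualLattice_neg hq)

theorem dualLattice_omega_sub_one {p : ℂ} (hp : p ∈ dualLattice) :
    (omega - 1) * p ∈ dualLattice := by
  obtain ⟨m, n, rfl⟩ := mem_dualLattice.mp hp
  refine mem_dualLattice.mpr ⟨n - 2 * m, -m - n, ?_⟩
  push_cast
  linear_combination (dualScale * m) * omega_sq

/-- Rotation by ω fixes the class of K modulo Λ*. Rotations about Dirac points therefore permute 𝒦₀
and preserve its two classes. -/
theorem omega_sub_one_mul_K : (omega - 1) * K ∈ dualLattice := by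
  refine mem_dualLattice.mpr ⟨1, 1, ?_⟩
  rw [K_eq]
  push_cast
  linear_combination (-(2 / 3) * dualScale) * omega_sq

/-- The coefficient of ω in 2K is -4/3 in units of `dualScale`. So the classes of K and -K are
disjoint, and neither contains 0. -/
theorem two_mul_K_notMem : K + K ∉ dualLattice := by
  intro h
  obtain ⟨m, n, h⟩ := mem_dualLattice.mp h
  rw [K_eq, ← mul_add] at h
  have h1 := congrArg Complex.im (mul_left_cancel₀ dualScale_ne_zero h)
  have h3 : √3 ≠ 0 := by norm_num
  simp [omega_im] at h1
  have h2 : (-4 : ℝ) = 3 * m := by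
    field_simp at h1
    linarith
  have h4 : (-4 : ℤ) = 3 * m := by exact_mod_cast h2
  omega

/-- The Dirac points as an index set. -/
abbrev Dirac : Type := diracPoints

namespace Dirac

open Classical in
/-- The component of `ℂ²` on which the plane wave with frequency `j` lives. -/
def comp (j : Dirac) : Fin 2 := if j.1 + K ∈ dualLattice then 0 else 1

theorem comp_eq_zero {j : Dirac} : comp j = 0 ↔ j.1 + K ∈ dualLattice := by
  unfold comp
  split_ifs with h <;> simp [h]

theorem comp_eq_one {j : Dirac} : comp j = 1 ↔ j.1 - K ∈ dualLattice := by
  have h1 : ¬ (j.1 + K ∈ dualLattice ∧ j.1 - K ∈ dualLattice) := by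
    rintro ⟨h, h'⟩
    exact two_mul_K_notMem (by simpa using dualLattice_sub h h')
  have h2 : comp j = 1 ↔ ¬ comp j = 0 := by
    generalize comp j = i
    fin_cases i <;> simp
  rw [h2, comp_eq_zero]
  have := j.2
  constructor
  · intro h
    exact this.resolve_right h
  · intro h h'
    exact h1 ⟨h', h⟩

theorem ne_zero (j : Dirac) : j.1 ≠ 0 := by
  intro h
  rcases j.2 with h1 | h1
  · rw [h, zero_sub] at h1
    have := dualLattice_neg h1
    rw [neg_neg] at this
    exact two_mul_K_notMem (dualLattice_add this this)
  · rw [h, zero_add] at h1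
    exact two_mul_K_notMem (dualLattice_add h1 h1)

theorem add_mem (j : Dirac) {q : ℂ} (hq : q ∈ dualLattice) : j.1 + q ∈ diracPoints := by
  rcases j.2 with h | h
  · exact Or.inl (by convert dualLattice_add h hq using 1; ring)
  · exact Or.inr (by convert dualLattice_add h hq using 1; ring)

theorem comp_add {j j' : Dirac} {q : ℂ} (hq : q ∈ dualLattice) (h : j'.1 = j.1 + q) :
    comp j' = comp j := by
  have h1 : ∀ i : Fin 2, i = 0 ∨ i = 1 := by decide
  rcases h1 (comp j) with h2 | h2 <;> rw [h2]
  · rw [comp_eq_zero] at h2 ⊢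
    rw [h]
    convert dualLattice_add h2 hq using 1; ring
  · rw [comp_eq_one] at h2 ⊢
    rw [h]
    convert dualLattice_add h2 hq using 1; ring

theorem neg_mem (j : Dirac) : -j.1 ∈ diracPoints := by
  rcases j.2 with h | h
  · exact Or.inr (by convert dualLattice_neg h using 1; ring)
  · exact Or.inl (by convert dualLattice_neg h using 1; ring)

/-- `j ↦ -j`. -/
def negPerm : Equiv.Perm Dirac where
  toFun j := ⟨-j.1, neg_mem j⟩
  invFun j := ⟨-j.1, neg_mem j⟩
  left_inv _ := Subtype.ext (neg_neg _)
  right_inv _ := Subtype.ext (neg_neg _)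

@[simp]
theorem negPerm_val (j : Dirac) : (negPerm j).1 = -j.1 := rfl

@[simp]
theorem negPerm_negPerm (j : Dirac) : negPerm (negPerm j) = j := Subtype.ext (neg_neg _)

theorem comp_negPerm (j : Dirac) : comp (negPerm j) = 1 - comp j := by
  have h1 : ∀ i : Fin 2, i = 0 ∨ i = 1 := by decide
  rcases h1 (comp j) with h2 | h2 <;> rw [h2]
  · rw [sub_zero]
    rw [comp_eq_zero] at h2
    rw [comp_eq_one, negPerm_val]
    convert dualLattice_neg h2 using 1; ring
  · rw [sub_self]
    rw [comp_eq_one] at h2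
    rw [comp_eq_zero, negPerm_val]
    convert dualLattice_neg h2 using 1; ring

/-- `j ↦ j + q` for `q ∈ Λ*`. -/
def shiftPerm (q : ℂ) (hq : q ∈ dualLattice) : Equiv.Perm Dirac where
  toFun j := ⟨j.1 + q, add_mem j hq⟩
  invFun j := ⟨j.1 + -q, add_mem j (dualLattice_neg hq)⟩
  left_inv j := Subtype.ext (by simp)
  right_inv j := Subtype.ext (by simp)

@[simp]
theorem shiftPerm_val (q : ℂ) (hq : q ∈ dualLattice) (j : Dirac) :
    (shiftPerm q hq j).1 = j.1 + q := rfl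

theorem omega_sub_one_mul (j : Dirac) : (omega - 1) * j.1 ∈ dualLattice := by
  rcases j.2 with h | h
  · convert dualLattice_add (dualLattice_omega_sub_one h) omega_sub_one_mul_K using 1; ring
  · convert dualLattice_sub (dualLattice_omega_sub_one h) omega_sub_one_mul_K using 1; ring

theorem omega_sub_one_mul_sub (j₀ j : Dirac) : (omega - 1) * (j.1 - j₀.1) ∈ dualLattice := by
  rw [mul_sub]
  exact dualLattice_sub (omega_sub_one_mul j) (omega_sub_one_mul j₀)

/-- The rotation `j ↦ j₀ + ω (j - j₀)`. -/
def rotPerm (j₀ : Dirac) : Equiv.Perm Dirac :=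
  let f : Dirac → Dirac := fun j => ⟨j.1 + (omega - 1) * (j.1 - j₀.1),
    add_mem j (omega_sub_one_mul_sub j₀ j)⟩
  have hf : ∀ j, f (f (f j)) = j := fun j => Subtype.ext (by
    change j.1 + (omega - 1) * (j.1 - j₀.1) + (omega - 1) *
      (j.1 + (omega - 1) * (j.1 - j₀.1) - j₀.1) + (omega - 1) *
      (j.1 + (omega - 1) * (j.1 - j₀.1) + (omega - 1) *
      (j.1 + (omega - 1) * (j.1 - j₀.1) - j₀.1) - j₀.1) = j.1
    linear_combination (j.1 - j₀.1) * omega_cube)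
  { toFun := f
    invFun := fun j => f (f j)
    left_inv := hf
    right_inv := hf }

theorem rotPerm_val (j₀ j : Dirac) :
    (rotPerm j₀ j).1 = j.1 + (omega - 1) * (j.1 - j₀.1) := rfl

theorem rotPerm_sub (j₀ j : Dirac) : (rotPerm j₀ j).1 - j₀.1 = omega * (j.1 - j₀.1) := by
  rw [rotPerm_val]; ring

@[simp]
theorem rotPerm_self (j₀ : Dirac) : rotPerm j₀ j₀ = j₀ := Subtype.ext (by simp [rotPerm_val])

theorem finite_norm_le (R : ℝ) : {j : Dirac | ‖j.1‖ ≤ R}.Finite := by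
  have hfin : ∀ a : ℂ, {j : ℂ | j + a ∈ dualLattice ∧ ‖j‖ ≤ R}.Finite := by
    intro a
    have h1 := ZSpan.setFinite_inter periods.basis
      (s := (fun γ : ℂ => dualScale * γ - a) ⁻¹' Metric.closedBall 0 R) (by
        have h2 : (fun γ : ℂ => dualScale * γ - a) ⁻¹' Metric.closedBall 0 R ⊆
            (fun z => dualScale⁻¹ * (z + a)) '' Metric.closedBall 0 R := by
          intro γ hγ
          refine ⟨_, hγ, ?_⟩
          simp [dualScale_ne_zero]
        exact ((isCompact_closedBall (0 : ℂ) R).image (by fun_prop)).isBounded.subset h2)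
    refine (h1.image fun γ => dualScale * γ - a).subset ?_
    rintro j ⟨⟨γ, hγ, h⟩, hR⟩
    have hj : j = dualScale * γ - a := by
      rw [dualScale, ← h]; ring
    refine ⟨γ, ⟨?_, ?_⟩, hj.symm⟩
    · change dualScale * γ - a ∈ Metric.closedBall (0 : ℂ) R
      rw [← hj]
      simpa using hR
    · rw [lattice, PeriodPair.lattice_eq_span_range_basis] at hγ
      exact hγ
  refine Set.Finite.preimage Subtype.val_injective.injOn
    (s := {j : ℂ | j ∈ diracPoints ∧ ‖j‖ ≤ R}) (((hfin (-K)).union (hfin K)).subset ?_) |>.subset ?_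
  · rintro j ⟨h | h, hR⟩
    · exact Or.inl ⟨h, hR⟩
    · exact Or.inr ⟨h, hR⟩
  · exact fun j hj => ⟨j.2, hj⟩

theorem exists_sub_norm_le : ∃ R : ℝ, ∀ k : ℂ, ∃ q ∈ dualLattice, ‖k - q‖ ≤ R := by
  refine ⟨‖dualScale‖ * ∑ i, ‖periods.basis i‖, fun k => ?_⟩
  let γ := ZSpan.floor periods.basis (dualScale⁻¹ * k)
  refine ⟨dualScale * γ.1, ⟨γ.1, ?_, rfl⟩, ?_⟩
  · rw [lattice, PeriodPair.lattice_eq_span_range_basis]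
    exact γ.2
  · have h1 : k - dualScale * γ.1 = dualScale * ZSpan.fract periods.basis (dualScale⁻¹ * k) := by
      rw [ZSpan.fract_apply, mul_sub, mul_inv_cancel_left₀ dualScale_ne_zero]
    rw [h1, norm_mul]
    exact mul_le_mul_of_nonneg_left (ZSpan.norm_fract_le _ _) (norm_nonneg _)

theorem finite_le_inv (ε : ℝ) (hε : 0 < ε) (k : ℂ) :
    {j : Dirac | ε ≤ ‖(j.1 - k)⁻¹‖}.Finite := by
  refine (finite_norm_le (ε⁻¹ + ‖k‖)).subset fun j hj => ?_
  have hj' : ε ≤ ‖j.1 - k‖⁻¹ := by rw [← norm_inv]; exact hj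
  have h1 : ‖j.1 - k‖ ≤ ε⁻¹ := by
    rcases (norm_nonneg (j.1 - k)).eq_or_lt with h | h
    · rw [← h]; positivity
    · exact (le_inv_comm₀ hε h).mp hj'
  have h2 := norm_sub_norm_le j.1 k
  change ‖j.1‖ ≤ _
  linarith

/-- No condition on k is needed: at j = k the entry is 0⁻¹ = 0. This is why `diagInv` is a partial
inverse even at a Dirac point. -/
theorem exists_bound_inv (k : ℂ) : ∃ C : ℝ, ∀ j : Dirac, ‖(j.1 - k)⁻¹‖ ≤ C := by
  obtain ⟨C, hC⟩ := ((finite_le_inv 1 one_pos k).image fun j => ‖(j.1 - k)⁻¹‖).bddAbove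
  refine ⟨max C 1, fun j => ?_⟩
  by_cases h : 1 ≤ ‖(j.1 - k)⁻¹‖
  · exact (hC ⟨j, h, rfl⟩).trans (le_max_left _ _)
  · exact (not_le.mp h).le.trans (le_max_right _ _)

end Dirac

/-! ### The model operator on `ℓ²(𝒦₀)` -/

section Model

open Filter Topology

open scoped Classical in
/-- The matrix symmetries of the potential in the Fourier basis. -/
structure IsPotentialMatrix (W : Seq Dirac →L[ℂ] Seq Dirac) : Prop where
  shift : ∀ q hq i j, entry W (Dirac.shiftPerm q hq i) (Dirac.shiftPerm q hq j) = entry W i j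
  rot : ∀ j₀ i j, entry W (Dirac.rotPerm j₀ i) (Dirac.rotPerm j₀ j) = omega * entry W i j
  neg : ∀ i j, entry W (Dirac.negPerm i) (Dirac.negPerm j) = entry W j i
  off_diag : ∀ i j, i.comp = j.comp → entry W i j = 0

/-- `diag (1, -1)` in the Fourier basis. -/
def Dirac.sign (j : Dirac) : ℂ := if j.comp = 0 then 1 else -1

theorem Dirac.norm_sign_le (j : Dirac) : ‖j.sign‖ ≤ 1 := by
  unfold Dirac.sign
  split_ifs <;> simp

theorem Dirac.sign_ne_zero (j : Dirac) : j.sign ≠ 0 := by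
  unfold Dirac.sign
  split_ifs <;> simp

theorem Dirac.sign_negPerm (j : Dirac) : (negPerm j).sign = -j.sign := by
  have h1 : ∀ i : Fin 2, i = 0 ∨ i = 1 := by decide
  unfold Dirac.sign
  rw [Dirac.comp_negPerm]
  rcases h1 j.comp with h | h <;> simp [h]

theorem Dirac.sign_eq_neg {i j : Dirac} (h : i.comp ≠ j.comp) : i.sign = -j.sign := by
  have h1 : ∀ i : Fin 2, i = 0 ∨ i = 1 := by decide
  unfold Dirac.sign
  rcases h1 i.comp with h2 | h2 <;> rcases h1 j.comp with h3 | h3 <;> simp_all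

/-- `diag (1, -1)`. -/
def signOp : Seq Dirac →L[ℂ] Seq Dirac := diag Dirac.sign ⟨1, Dirac.norm_sign_le⟩

/-- `(A - k)⁻¹`, with `0` on the kernel. -/
def diagInv (k : ℂ) : Seq Dirac →L[ℂ] Seq Dirac :=
  diag (fun j => (j.1 - k)⁻¹) (Dirac.exists_bound_inv k)

theorem diagInv_apply (k : ℂ) (x : Seq Dirac) (j : Dirac) :
    diagInv k x j = (j.1 - k)⁻¹ * x j := rfl

theorem isCompactOperator_diagInv (k : ℂ) : IsCompactOperator (diagInv k) :=
  isCompactOperator_diag _ fun ε hε => Dirac.finite_le_inv ε hε k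

/-- The bilinear form `∫ det (u, v)` in the Fourier basis. -/
def skewForm : Seq Dirac →L[ℂ] Seq Dirac →L[ℂ] ℂ :=
  (dot.comp signOp).flip.comp (permOp Dirac.negPerm) |>.flip

theorem hasSum_skewForm (x y : Seq Dirac) :
    HasSum (fun j => j.sign * x j * y (Dirac.negPerm j)) (skewForm x y) :=
  hasSum_dot (signOp x) (permOp Dirac.negPerm y)

/-- Coordinate j of the pencil is j⁻¹ times that of (A + aW - k)x, and no Dirac point is zero. The
unbounded equation is thus handled coordinatewise, with no domain in sight. -/
theorem pencil_diagInv_eq_iff {W : Seq Dirac →L[ℂ] Seq Dirac} {a k : ℂ} {x f : Seq Dirac} :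
    pencil (diagInv 0) W a k x = diagInv 0 f ↔
      ∀ j, j.1 * x j + a * W x j - k * x j = f j := by
  have h1 : ∀ j : Dirac, (pencil (diagInv 0) W a k x) j =
      (j.1)⁻¹ * (j.1 * x j + a * W x j - k * x j) := by
    intro j
    have := j.ne_zero
    rw [pencil_apply, lp.coeFn_add, Pi.add_apply, diagInv_apply, lp.coeFn_sub, Pi.sub_apply,
      lp.coeFn_smul, lp.coeFn_smul, Pi.smul_apply, Pi.smul_apply, smul_eq_mul, smul_eq_mul,
      sub_zero]
    field_simp
    ring
  constructor
  · intro h j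
    have h2 := h1 j
    rw [h, diagInv_apply, sub_zero] at h2
    exact (mul_left_cancel₀ (inv_ne_zero j.ne_zero) h2).symm
  · intro h
    ext j
    rw [h1, h, diagInv_apply, sub_zero]

theorem pencil_diagInv_eq_zero_iff {W : Seq Dirac →L[ℂ] Seq Dirac} {a k : ℂ} {x : Seq Dirac} :
    pencil (diagInv 0) W a k x = 0 ↔ ∀ j, j.1 * x j + a * W x j = k * x j := by
  have h := pencil_diagInv_eq_iff (W := W) (a := a) (k := k) (x := x) (f := 0)
  rw [map_zero] at h
  rw [h]
  exact forall_congr' fun j => sub_eq_zero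

variable {W : Seq Dirac →L[ℂ] Seq Dirac}

theorem skewForm_single_left [DecidableEq Dirac] (i : Dirac) (y : Seq Dirac) :
    skewForm (lp.single 2 i 1) y = i.sign * y (Dirac.negPerm i) := by
  refine (hasSum_skewForm _ y).unique ?_
  convert hasSum_ite_eq i (i.sign * y (Dirac.negPerm i)) using 2 with j
  rw [single_one_apply]
  by_cases h : j = i
  · subst h; simp
  · simp [h, Ne.symm h]

theorem skewForm_single_right [DecidableEq Dirac] (x : Seq Dirac) (i : Dirac) :
    skewForm x (lp.single 2 i 1) = -(i.sign * x (Dirac.negPerm i)) := by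
  refine (hasSum_skewForm x _).unique ?_
  convert hasSum_ite_eq (Dirac.negPerm i) (-(i.sign * x (Dirac.negPerm i))) using 2 with j
  rw [single_one_apply]
  by_cases h : j = Dirac.negPerm i
  · subst h; simp [Dirac.sign_negPerm]
  · have h2 : i ≠ Dirac.negPerm j := by
      rintro rfl
      simp at h
    simp [h, h2]

namespace IsPotentialMatrix

/-- On basis vectors both sides involve the same entry, by the symmetry under j ↦ -j. That entry
vanishes unless i and j have the same component, in which case the signs agree. -/
theorem skewForm_apply (hW : IsPotentialMatrix W) (x y : Seq Dirac) :
    skewForm (W x) y = -skewForm x (W y) := by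
  classical
  have h1 : skewForm.comp W = -(skewForm.flip.comp W).flip := by
    refine Seq.ext_single fun i => Seq.ext_single fun j => ?_
    change skewForm (W (lp.single 2 i 1)) (lp.single 2 j 1) =
      -skewForm (lp.single 2 i 1) (W (lp.single 2 j 1))
    rw [skewForm_single_left, skewForm_single_right]
    have h2 : entry W (Dirac.negPerm j) i = entry W (Dirac.negPerm i) j := by
      have := hW.neg j (Dirac.negPerm i)
      rw [Dirac.negPerm_negPerm] at this
      convert this using 1
    change -(j.sign * entry W (Dirac.negPerm j) i) = -(i.sign * entry W (Dirac.negPerm i) j)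
    rw [h2]
    by_cases h3 : (Dirac.negPerm i).comp = j.comp
    · have h4 : entry W (Dirac.negPerm i) j = 0 := by
        convert hW.off_diag _ _ h3 using 1
      rw [h4, mul_zero, mul_zero]
    · have h4 := Dirac.sign_eq_neg h3
      rw [Dirac.sign_negPerm, neg_inj] at h4
      rw [h4]
  exact DFunLike.congr_fun (DFunLike.congr_fun h1 x) y

/-- W exchanges the two components. Conjugation by diag(1, -1) therefore turns a into -a in the
pencil, which absorbs the sign between T_k and D_V(α). -/
theorem signOp_apply (hW : IsPotentialMatrix W) (x : Seq Dirac) :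
    W (signOp x) = -signOp (W x) := by
  classical
  have h1 : W.comp signOp = -signOp.comp W := by
    refine Seq.ext_single fun j => ?_
    ext i
    have h2 : signOp (lp.single 2 j 1) = j.sign • lp.single 2 j (1 : ℂ) := by
      ext l
      change l.sign * (lp.single 2 j (1 : ℂ) : Seq Dirac) l =
        j.sign * (lp.single 2 j (1 : ℂ) : Seq Dirac) l
      rw [single_one_apply]
      by_cases h : j = l
      · subst h; rfl
      · simp [h]
    change W (signOp (lp.single 2 j 1)) i = -(i.sign * entry W i j)
    rw [h2, map_smul]
    change j.sign * entry W i j = _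
    by_cases h3 : i.comp = j.comp
    · have h4 : entry W i j = 0 := by
        convert hW.off_diag _ _ h3 using 1
      rw [h4]; simp
    · rw [Dirac.sign_eq_neg h3]; ring
  exact DFunLike.congr_fun h1 x

theorem exists_kernel_neg (hW : IsPotentialMatrix W) {a k : ℂ}
    (h : ∃ x, x ≠ 0 ∧ pencil (diagInv 0) W a k x = 0) :
    ∃ x, x ≠ 0 ∧ pencil (diagInv 0) W (-a) k x = 0 := by
  obtain ⟨x, hx0, hx⟩ := h
  refine ⟨signOp x, fun h0 => hx0 ?_, ?_⟩
  · ext j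
    have h1 : j.sign * x j = 0 := congrFun (congrArg Subtype.val h0) j
    exact (mul_eq_zero.mp h1).resolve_left j.sign_ne_zero
  · rw [pencil_diagInv_eq_zero_iff] at hx ⊢
    intro j
    rw [hW.signOp_apply]
    change j.1 * (j.sign * x j) + -a * -(j.sign * W x j) = k * (j.sign * x j)
    linear_combination j.sign * hx j

theorem isUnit_pencil_neg_iff (hW : IsPotentialMatrix W) {a k : ℂ} :
    IsUnit (pencil (diagInv 0) W (-a) k) ↔ IsUnit (pencil (diagInv 0) W a k) := by
  rw [← not_iff_not, not_isUnit_pencil (isCompactOperator_diagInv 0),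
    not_isUnit_pencil (isCompactOperator_diagInv 0)]
  constructor
  · intro h
    have := hW.exists_kernel_neg h
    rwa [neg_neg] at this
  · exact hW.exists_kernel_neg

/-- The form pairs frequency j with -j, so A is skew as well as W. Only the spectral parameters
survive, and they add up. -/
theorem skewForm_pencil (hW : IsPotentialMatrix W) (a k k' : ℂ) (w f y : Seq Dirac)
    (hw : pencil (diagInv 0) W a k w = diagInv 0 f) (hy : pencil (diagInv 0) W a k' y = 0) :
    skewForm f y = -((k + k') * skewForm w y) := by
  rw [pencil_diagInv_eq_iff] at hw
  rw [pencil_diagInv_eq_zero_iff] at hy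
  have h1 := ((hasSum_skewForm (W w) y).mul_left a).add ((hasSum_skewForm w (W y)).mul_left a)
  have h2 := h1.sub ((hasSum_skewForm w y).mul_left (k + k'))
  rw [hW.skewForm_apply] at h2
  have h3 : a * -skewForm w (W y) + a * skewForm w (W y) - (k + k') * skewForm w y =
      -((k + k') * skewForm w y) := by ring
  rw [h3] at h2
  refine (hasSum_skewForm f y).unique (h2.congr_fun fun j => ?_)
  have h4 := hy (Dirac.negPerm j)
  rw [Dirac.negPerm_val] at h4
  rw [← hw j]
  linear_combination -(j.sign * w j) * h4

/-- The protected states: every Dirac point is an eigenvalue. -/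
theorem exists_protected (hW : IsPotentialMatrix W) (j₀ : Dirac) (a : ℂ) :
    ∃ x, x ≠ 0 ∧ pencil (diagInv 0) W a j₀.1 x = 0 := by
  classical
  let ρ := Dirac.rotPerm j₀
  -- Both A - j₀ and W map rotation-invariant vectors into F, the eigenspace of the rotation for ω.
  -- Between these spaces A - j₀ is onto with kernel spanned by the basis vector at j₀, so it has
  -- index one, and adding aW cannot remove the kernel. `diagInv` is its right inverse on F.
  let F : Submodule ℂ (Seq Dirac) :=
    ((permOp ρ - omega • (1 : Seq Dirac →L[ℂ] Seq Dirac)) : Seq Dirac →L[ℂ] Seq Dirac).ker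
  have hF : ∀ x, x ∈ F ↔ permOp ρ x = omega • x := by
    intro x
    change permOp ρ x - omega • x = 0 ↔ _
    rw [sub_eq_zero]
  have hFj : ∀ x ∈ F, x j₀ = 0 := by
    intro x hx
    have h1 : x (ρ j₀) = omega * x j₀ := congrFun (congrArg Subtype.val ((hF x).mp hx)) j₀
    rw [show ρ j₀ = j₀ from Dirac.rotPerm_self j₀] at h1
    have h2 : (omega - 1) * x j₀ = 0 := by linear_combination -h1
    refine (mul_eq_zero.mp h2).resolve_left fun h3 => ?_
    have h4 := congrArg Complex.re h3
    rw [sub_re, omega_re] at h4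
    norm_num at h4
  have hWρ : ∀ x, permOp ρ (W x) = omega • W (permOp ρ x) := permOp_comm fun i j => by
    convert hW.rot j₀ i j using 1
  have hS : ∀ x ∈ F, permOp ρ (diagInv j₀.1 x) = diagInv j₀.1 x := by
    intro x hx
    ext j
    have h1 : x (ρ j) = omega * x j := congrFun (congrArg Subtype.val ((hF x).mp hx)) j
    change ((ρ j).1 - j₀.1)⁻¹ * x (ρ j) = (j.1 - j₀.1)⁻¹ * x j
    have h3 : omega ≠ 0 := exp_ne_zero _
    rw [h1, Dirac.rotPerm_sub, mul_inv]
    field_simp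
  have hAS : ∀ x ∈ F, ∀ j : Dirac, (j.1 - j₀.1) * diagInv j₀.1 x j = x j := by
    intro x hx j
    rw [diagInv_apply]
    by_cases h : j.1 - j₀.1 = 0
    · rw [h, zero_mul, show j = j₀ from Subtype.ext (sub_eq_zero.mp h), hFj x hx]
    · rw [mul_inv_cancel_left₀ h]
  have hfix : ∀ x, permOp ρ x = x → W x ∈ F := by
    intro x hx
    rw [hF, hWρ, hx]
  let C : Seq Dirac →L[ℂ] Seq Dirac := a • W * diagInv j₀.1
  have hC : ∀ x, C x = a • W (diagInv j₀.1 x) := fun x => rfl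
  have hCF : ∀ x ∈ F, C x ∈ F := fun x hx => F.smul_mem a (hfix _ (hS x hx))
  have hcomp : IsCompactOperator C := (isCompactOperator_diagInv j₀.1).clm_comp (a • W)
  have hcl : IsClosed (F : Set (Seq Dirac)) := ContinuousLinearMap.isClosed_ker _
  have : CompleteSpace F := hcl.completeSpace_coe
  let C' : F →L[ℂ] F := C.restrict hCF
  have hC' : IsCompactOperator C' := hcomp.restrict' hCF
  -- With S the right inverse, if 1 + aWS is injective on F it is also surjective. Then f + aWSf =
  -- aWe is solvable and e - Sf is a null vector with coordinate 1 at j₀. Otherwise Sf is a null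
  -- vector for any nonzero f with f + aWSf = 0.
  by_cases hinj : ∀ x : F, x + C' x = 0 → x = 0
  · have hu := isUnit_one_add_of_injective hC' hinj
    let e : Seq Dirac := lp.single 2 j₀ 1
    have he : permOp ρ e = e := by
      rw [permOp_single, (Equiv.symm_apply_eq ρ).mpr (Dirac.rotPerm_self j₀).symm]
    obtain ⟨f, hf⟩ := (ContinuousLinearMap.isUnit_iff_bijective.mp hu).2
      ⟨a • W e, F.smul_mem a (hfix e he)⟩
    have hf' : f.1 + a • W (diagInv j₀.1 f.1) = a • W e := congrArg Subtype.val hf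
    refine ⟨e - diagInv j₀.1 f.1, fun h0 => ?_, ?_⟩
    · have h1 : e j₀ - (j₀.1 - j₀.1)⁻¹ * f.1 j₀ = 0 := congrFun (congrArg Subtype.val h0) j₀
      rw [hFj _ f.2, mul_zero, sub_zero, single_one_apply, if_pos rfl] at h1
      exact one_ne_zero h1
    · rw [pencil_diagInv_eq_zero_iff]
      intro j
      have h1 := hAS _ f.2 j
      have h2 : f.1 j + a * W (diagInv j₀.1 f.1) j = a * W e j :=
        congrFun (congrArg Subtype.val hf') j
      have h3 : (j.1 - j₀.1) * e j = 0 := by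
        rw [single_one_apply]
        split_ifs with h
        · rw [h, sub_self, zero_mul]
        · rw [mul_zero]
      rw [map_sub]
      change j.1 * (e j - diagInv j₀.1 f.1 j) + a * (W e j - W (diagInv j₀.1 f.1) j) =
        j₀.1 * (e j - diagInv j₀.1 f.1 j)
      linear_combination h3 - h1 - h2
  · push Not at hinj
    obtain ⟨f, hf, hf0⟩ := hinj
    have hf' : f.1 + a • W (diagInv j₀.1 f.1) = 0 := congrArg Subtype.val hf
    refine ⟨diagInv j₀.1 f.1, fun h0 => hf0 ?_, ?_⟩
    · rw [h0, map_zero, smul_zero, add_zero] at hf'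
      exact Subtype.ext hf'
    · rw [pencil_diagInv_eq_zero_iff]
      intro j
      have h1 := hAS _ f.2 j
      have h2 : f.1 j + a * W (diagInv j₀.1 f.1) j = 0 := congrFun (congrArg Subtype.val hf') j
      linear_combination h1 + h2

theorem shift_kernel (hW : IsPotentialMatrix W) {q : ℂ} (hq : q ∈ dualLattice) {a k : ℂ}
    {x : Seq Dirac} (hx : pencil (diagInv 0) W a k x = 0) :
    pencil (diagInv 0) W a (k - q) (permOp (Dirac.shiftPerm q hq) x) = 0 := by
  classical
  rw [pencil_diagInv_eq_zero_iff] at hx ⊢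
  intro j
  have h1 := permOp_comm (σ := Dirac.shiftPerm q hq) (W := W) (c := 1) (fun i j => by
    rw [one_mul]
    convert hW.shift q hq i j using 1) x
  rw [one_smul] at h1
  rw [← h1]
  have h2 := hx (Dirac.shiftPerm q hq j)
  rw [Dirac.shiftPerm_val] at h2
  change j.1 * x (Dirac.shiftPerm q hq j) + a * W x (Dirac.shiftPerm q hq j) =
    (k - q) * x (Dirac.shiftPerm q hq j)
  linear_combination h2

/-- Opposite shifts keep the pairing of j with -j, and shifts by Λ* do not change the component.
Degeneracy is therefore periodic in k. -/
theorem skewForm_shift {q : ℂ} (hq : q ∈ dualLattice) (hq' : -q ∈ dualLattice)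
    (x y : Seq Dirac) :
    skewForm (permOp (Dirac.shiftPerm q hq) x) (permOp (Dirac.shiftPerm (-q) hq') y) =
      skewForm x y := by
  refine (hasSum_skewForm _ _).unique ?_
  refine ((Dirac.shiftPerm q hq).hasSum_iff.mpr (hasSum_skewForm x y)).congr_fun fun j => ?_
  have h1 : (Dirac.shiftPerm q hq j).sign = j.sign := by
    unfold Dirac.sign
    rw [Dirac.comp_add hq (Dirac.shiftPerm_val q hq j)]
  have h2 : Dirac.negPerm (Dirac.shiftPerm q hq j) = Dirac.shiftPerm (-q) hq' (Dirac.negPerm j) :=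
    Subtype.ext (by simp [add_comm])
  simp only [Function.comp_apply, permOp_apply, h1, h2]

theorem permOp_ne_zero {σ : Equiv.Perm Dirac} {x : Seq Dirac} (hx : x ≠ 0) : permOp σ x ≠ 0 := by
  intro h
  refine hx ?_
  ext j
  have h1 : x (σ (σ.symm j)) = 0 := congrFun (congrArg Subtype.val h) (σ.symm j)
  rwa [Equiv.apply_symm_apply] at h1

theorem skewPencil (hW : IsPotentialMatrix W) :
    SkewPencil (diagInv 0) W diracPoints skewForm where
  compact := isCompactOperator_diagInv 0
  skew := hW.skewForm_pencil
  nondeg y hy := by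
    classical
    by_contra! h
    refine hy ?_
    ext j
    have h1 := h (lp.single 2 (Dirac.negPerm j) 1)
    rw [skewForm_single_left, Dirac.negPerm_negPerm] at h1
    exact (mul_eq_zero.mp h1).resolve_left (Dirac.sign_ne_zero _)
  eigenvalue k hk a := hW.exists_protected ⟨k, hk⟩ a
  neg_mem k hk := Dirac.neg_mem ⟨k, hk⟩
  periodic := by
    obtain ⟨R, hR⟩ := Dirac.exists_sub_norm_le
    refine ⟨R, fun k => ?_⟩
    obtain ⟨q, hq, hk⟩ := hR k
    have hq' := dualLattice_neg hq
    refine ⟨k - q, hk, fun a => ?_⟩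
    rintro ⟨x, hx0, hx, hor⟩
    refine ⟨_, permOp_ne_zero hx0, hW.shift_kernel hq hx, ?_⟩
    rcases hor with hD | ⟨y, hy0, hy, hB⟩
    · refine Or.inl fun hD' => hD ?_
      have := Dirac.add_mem ⟨k - q, hD'⟩ hq
      rwa [sub_add_cancel] at this
    · refine Or.inr ⟨permOp (Dirac.shiftPerm (-q) hq') y, permOp_ne_zero hy0, ?_, ?_⟩
      · rw [show -(k - q) = -k - -q by ring]
        exact hW.shift_kernel hq' hy
      · rw [skewForm_shift, hB]
  zero := by
    classical
    rintro k ⟨x, hx0, hx, hor⟩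
    -- At a = 0 the operator is diagonal with distinct entries, so eigenvectors are multiples of
    -- basis vectors. Those at j and -j pair nontrivially.
    have hsupp : ∀ {k : ℂ} {x : Seq Dirac}, pencil (diagInv 0) W 0 k x = 0 → x ≠ 0 →
        ∃ j : Dirac, j.1 = k ∧ x j ≠ 0 ∧ ∀ i, i ≠ j → x i = 0 := by
      intro k x hx hx0
      rw [pencil_diagInv_eq_zero_iff] at hx
      have h1 : ∃ j, x j ≠ 0 := by
        by_contra! h
        exact hx0 (lp.ext (funext h))
      obtain ⟨j, hj⟩ := h1
      have h2 : ∀ i : Dirac, (i.1 - k) * x i = 0 := fun i => by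
        have := hx i
        rw [zero_mul, add_zero] at this
        linear_combination this
      have hjk : j.1 = k := sub_eq_zero.mp ((mul_eq_zero.mp (h2 j)).resolve_right hj)
      refine ⟨j, hjk, hj, fun i hi => (mul_eq_zero.mp (h2 i)).resolve_left fun h3 => hi ?_⟩
      exact Subtype.ext ((sub_eq_zero.mp h3).trans hjk.symm)
    obtain ⟨j, hjk, hj, hj'⟩ := hsupp hx hx0
    rcases hor with hD | ⟨y, hy0, hy, hB⟩
    · exact hD (hjk ▸ j.2)
    · obtain ⟨l, hlk, hl, -⟩ := hsupp hy hy0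
      have hlj : l = Dirac.negPerm j := Subtype.ext (by rw [hlk, Dirac.negPerm_val, hjk])
      have h1 : skewForm x y = j.sign * x j * y (Dirac.negPerm j) := by
        refine (hasSum_skewForm x y).unique (hasSum_single j fun i hi => ?_)
        rw [hj' i hi]; ring
      rw [h1, ← hlj] at hB
      exact mul_ne_zero (mul_ne_zero j.sign_ne_zero hj) hl hB

end IsPotentialMatrix

end Model

/-! ### The fundamental cell and periodic functions -/

theorem mem_lattice_iff_span {γ : ℂ} :
    γ ∈ lattice ↔ γ ∈ Submodule.span ℤ (Set.range periods.basis) := by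
  rw [lattice, PeriodPair.lattice_eq_span_range_basis]

theorem measurableSet_cell : MeasurableSet cell :=
  ZSpan.fundamentalDomain_measurableSet periods.basis

theorem isBounded_cell : Bornology.IsBounded cell :=
  ZSpan.fundamentalDomain_isBounded periods.basis

instance : IsFiniteMeasure (volume.restrict cell) :=
  ⟨by rw [Measure.restrict_apply_univ]; exact isBounded_cell.measure_lt_top⟩

theorem isAddFundamentalDomain_cell :
    IsAddFundamentalDomain (Submodule.span ℤ (Set.range periods.basis)) cell
      (volume : Measure ℂ) :=
  ZSpan.isAddFundamentalDomain periods.basis volume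

/-- The area of the fundamental cell. -/
def cellArea : ℝ := volume.real cell

theorem cellArea_pos : 0 < cellArea :=
  ENNReal.toReal_pos (ZSpan.measure_fundamentalDomain_ne_zero periods.basis)
    isBounded_cell.measure_lt_top.ne

/-- Integrals of periodic functions over the cell are invariant under measure preserving maps
that normalize the lattice. -/
theorem setIntegral_cell_comp {σ : ℂ ≃ᵐ ℂ} (hσ : MeasurePreserving σ)
    (e : Equiv.Perm (Submodule.span ℤ (Set.range periods.basis)))
    (he : ∀ g z, σ ((e g : ℂ) + z) = g + σ z) {F : ℂ → ℂ}
    (hF : ∀ γ ∈ lattice, ∀ z, F (z + γ) = F z) :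
    ∫ z in cell, F (σ z) = ∫ z in cell, F z := by
  have h1 : IsAddFundamentalDomain (Submodule.span ℤ (Set.range periods.basis)) (σ ⁻¹' cell)
      (volume : Measure ℂ) :=
    isAddFundamentalDomain_cell.preimage_of_equiv hσ.quasiMeasurePreserving e.bijective he
  have : VAddInvariantMeasure (Submodule.span ℤ (Set.range periods.basis)) ℂ volume :=
    ⟨fun c s _ => measure_preimage_add volume (c : ℂ) s⟩
  rw [isAddFundamentalDomain_cell.setIntegral_eq h1,
    hσ.setIntegral_preimage_emb σ.measurableEmbedding]
  intro g z
  change F (σ (g + z)) = F (σ z)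
  have h2 := he (e.symm g) z
  rw [e.apply_symm_apply] at h2
  rw [h2, add_comm, hF _ (mem_lattice_iff_span.mpr (e.symm g).2)]

theorem setIntegral_cell_add (w : ℂ) {F : ℂ → ℂ} (hF : ∀ γ ∈ lattice, ∀ z, F (z + γ) = F z) :
    ∫ z in cell, F (z + w) = ∫ z in cell, F z :=
  setIntegral_cell_comp (σ := MeasurableEquiv.addRight w) (measurePreserving_add_right volume w)
    (Equiv.refl _) (fun _ _ => add_assoc _ _ _) hF

theorem omega_norm : ‖omega‖ = 1 := by
  have : (2 * π * I / 3 : ℂ) = ((2 * π / 3 : ℝ) : ℂ) * I := by push_cast; ring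
  rw [omega, this, norm_exp_ofReal_mul_I]

theorem omega_mul_mem_lattice {γ : ℂ} (hγ : γ ∈ lattice) : omega * γ ∈ lattice := by
  obtain ⟨m, n, rfl⟩ := mem_lattice_iff.mp hγ
  refine mem_lattice_iff.mpr ⟨n - m, -m, ?_⟩
  push_cast
  linear_combination m * omega_sq

/-- Multiplication by `ω` as a permutation of the lattice. -/
def rotLattice : Equiv.Perm (Submodule.span ℤ (Set.range periods.basis)) where
  toFun g := ⟨omega * g, mem_lattice_iff_span.mp
    (omega_mul_mem_lattice (mem_lattice_iff_span.mpr g.2))⟩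
  invFun g := ⟨omega * (omega * g), mem_lattice_iff_span.mp (omega_mul_mem_lattice
    (omega_mul_mem_lattice (mem_lattice_iff_span.mpr g.2)))⟩
  left_inv g := Subtype.ext (by
    change omega * (omega * (omega * (g : ℂ))) = g
    linear_combination (g : ℂ) * omega_cube)
  right_inv g := Subtype.ext (by
    change omega * (omega * (omega * (g : ℂ))) = g
    linear_combination (g : ℂ) * omega_cube)

/-- Multiplication by `ω` on the plane. -/
def rotPlane : ℂ ≃ₗᵢ[ℝ] ℂ := rotation ⟨omega, by simp [Submonoid.unitSphere, omega_norm]⟩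

theorem setIntegral_cell_omega_mul {F : ℂ → ℂ} (hF : ∀ γ ∈ lattice, ∀ z, F (z + γ) = F z) :
    ∫ z in cell, F (omega * z) = ∫ z in cell, F z := by
  refine setIntegral_cell_comp (σ := rotPlane.toMeasurableEquiv) rotPlane.measurePreserving
    rotLattice.symm (fun g z => ?_) hF
  have h : omega * ((rotLattice.symm g : _) : ℂ) = g :=
    congrArg Subtype.val (rotLattice.apply_symm_apply g)
  change omega * (_ + z) = g + omega * z
  rw [mul_add, h]

/-- A bounded set meets finitely many translates of the cell. -/
theorem exists_finset_cover {S : Set ℂ} (hS : Bornology.IsBounded S) :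
    ∃ F : Finset ℂ, (∀ γ ∈ F, γ ∈ lattice) ∧ S ⊆ ⋃ γ ∈ F, (fun z => z - γ) ⁻¹' cell := by
  have h1 := ZSpan.setFinite_inter periods.basis (hS.sub isBounded_cell)
  refine ⟨h1.toFinset, fun γ hγ => mem_lattice_iff_span.mpr (h1.mem_toFinset.mp hγ).2, ?_⟩
  intro z hz
  obtain ⟨γ, hγ, -⟩ := ZSpan.exist_unique_vadd_mem_fundamentalDomain periods.basis z
  have hγ' : (γ : ℂ) + z ∈ cell := hγ
  refine Set.mem_biUnion (x := -(γ : ℂ)) ?_ ?_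
  · refine h1.mem_toFinset.mpr ⟨?_, neg_mem γ.2⟩
    exact ⟨z, hz, _, hγ', by ring⟩
  · simpa [add_comm] using hγ'

/-- The integral of a periodic function over a bounded set is controlled by the integral over
the cell. -/
theorem exists_lintegral_le_cell {S : Set ℂ} (hS : Bornology.IsBounded S) :
    ∃ N : ℕ, ∀ h : ℂ → ENNReal, (∀ γ ∈ lattice, ∀ᵐ z, h (z + γ) = h z) →
      ∫⁻ z in S, h z ≤ N * ∫⁻ z in cell, h z := by
  obtain ⟨F, hF, hSF⟩ := exists_finset_cover hS
  refine ⟨F.card, fun h hper => ?_⟩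
  calc ∫⁻ z in S, h z ≤ ∫⁻ z in ⋃ γ ∈ F, (fun z => z - γ) ⁻¹' cell, h z :=
        lintegral_mono_set hSF
    _ ≤ ∑ γ ∈ F, ∫⁻ z in (fun z => z - γ) ⁻¹' cell, h z := by
        classical
        induction F using Finset.induction_on with
        | empty => simp
        | insert a s ha ih =>
          rw [Finset.set_biUnion_insert, Finset.sum_insert ha]
          refine (lintegral_union_le _ _ _).trans (add_le_add_right ?_ _)
          clear ih hSF hF
          induction s using Finset.induction_on with
          | empty => simp
          | insert b t hb ih =>
            rw [Finset.set_biUnion_insert, Finset.sum_insert hb]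
            refine (lintegral_union_le _ _ _).trans (add_le_add_right (ih ?_) _)
            exact fun h => ha (Finset.mem_insert_of_mem h)
    _ = ∑ γ ∈ F, ∫⁻ z in cell, h z := by
        refine Finset.sum_congr rfl fun γ hγ => ?_
        have h1 : ∫⁻ z in (fun z => z - γ) ⁻¹' cell, h z =
            ∫⁻ z in (fun z => z - γ) ⁻¹' cell, (fun w => h (w + γ)) (z - γ) := by simp
        rw [h1, (measurePreserving_sub_right volume γ).setLIntegral_comp_preimage_emb
          (MeasurableEquiv.subRight γ).measurableEmbedding (fun w => h (w + γ))]
        exact lintegral_congr_ae (ae_restrict_of_ae (hper γ (hF γ hγ)))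
    _ = _ := by simp

/-! ### Uniqueness of Fourier coefficients -/

section Torus

/-- The normalized Haar measure of the circle. -/
local instance : MeasureSpace UnitAddCircle := ⟨AddCircle.haarAddCircle⟩

local instance : Measure.IsAddHaarMeasure (volume : Measure UnitAddCircle) :=
  inferInstanceAs (Measure.IsAddHaarMeasure AddCircle.haarAddCircle)

local instance : IsProbabilityMeasure (volume : Measure UnitAddCircle) :=
  inferInstanceAs (IsProbabilityMeasure AddCircle.haarAddCircle)

/-- Transfer of completeness of the exponentials from the torus to its half-open fundamental box. -/
theorem ae_eq_zero_of_integral_unit_box {d : Type*} [Fintype d] {g : (d → ℝ) → ℂ}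
    (hg : MemLp g 2 (volume.restrict {x : d → ℝ | ∀ i, x i ∈ Set.Ioc (0 : ℝ) (0 + 1)}))
    (h : ∀ n : d → ℤ, ∫ x in {x : d → ℝ | ∀ i, x i ∈ Set.Ioc (0 : ℝ) (0 + 1)},
      (∏ i, exp (2 * π * I * n i * x i)) * g x = 0) :
    g =ᵐ[volume.restrict {x : d → ℝ | ∀ i, x i ∈ Set.Ioc (0 : ℝ) (0 + 1)}] 0 := by
  have hB : MeasurableSet {x : d → ℝ | ∀ i, x i ∈ Set.Ioc (0 : ℝ) (0 + 1)} :=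
    MeasurableSet.univ_pi' fun i => measurableSet_Ioc
  let ψ : UnitAddTorus d → (d → ℝ) := fun t => (UnitAddTorus.measurableEquivPiIoc (fun _ => 0) t).1
  have hψe : MeasurableEmbedding ψ :=
    (MeasurableEmbedding.subtype_coe hB).comp
      (UnitAddTorus.measurableEquivPiIoc fun _ => 0).measurableEmbedding
  have hψ : MeasurePreserving ψ volume
      (volume.restrict {x : d → ℝ | ∀ i, x i ∈ Set.Ioc (0 : ℝ) (0 + 1)}) :=
    (measurePreserving_subtype_coe hB).comp
      (UnitAddTorus.measurePreserving_equivPiIoc fun _ => 0)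
  have hψt : ∀ t : UnitAddTorus d, (fun i => ((ψ t i : ℝ) : UnitAddCircle)) = t := fun t =>
    (UnitAddTorus.measurableEquivPiIoc fun _ => 0).symm_apply_apply t
  have hG : MemLp (g ∘ ψ) 2 volume := hg.comp_measurePreserving hψ
  have hcoef : ∀ n, UnitAddTorus.mFourierCoeff (g ∘ ψ) n = 0 := by
    intro n
    rw [UnitAddTorus.mFourierCoeff, ← h (-n), ← hψ.integral_comp hψe]
    refine integral_congr_ae (Filter.Eventually.of_forall fun t => ?_)
    change UnitAddTorus.mFourier (-n) t * g (ψ t) = _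
    congr 1
    conv_lhs => rw [← hψt t]
    simp only [UnitAddTorus.mFourier, ContinuousMap.coe_mk, fourier_coe_apply]
    refine Finset.prod_congr rfl fun i _ => ?_
    simp
  have hz : hG.toLp (g ∘ ψ) = 0 := by
    rw [← UnitAddTorus.mFourierBasis.repr.map_eq_zero_iff]
    ext n
    rw [UnitAddTorus.mFourierBasis_repr]
    have h1 : UnitAddTorus.mFourierCoeff (hG.toLp (g ∘ ψ)) n =
        UnitAddTorus.mFourierCoeff (g ∘ ψ) n := by
      refine integral_congr_ae ?_
      filter_upwards [hG.coeFn_toLp] with t ht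
      rw [ht]
    rw [h1, hcoef]
    rfl
  have h0 : ∀ᵐ t, g (ψ t) = 0 := by
    have := hG.coeFn_toLp
    rw [hz] at this
    filter_upwards [this, Lp.coeFn_zero ℂ 2 (volume : Measure (UnitAddTorus d))] with t h1 h2
    rw [h2] at h1
    exact h1.symm
  rw [Filter.EventuallyEq, ← hψ.map_eq, hψe.ae_map_iff]
  exact h0

end Torus

/-- The coordinates of the plane in the basis of periods. -/
def cellCoord : (Fin 2 → ℝ) ≃L[ℝ] ℂ := periods.basis.equivFun.symm.toContinuousLinearEquiv

theorem cellCoord_apply (s : Fin 2 → ℝ) : cellCoord s = s 0 * omega + s 1 := by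
  change periods.basis.equivFun.symm s = _
  rw [Module.Basis.equivFun_symm_apply, Fin.sum_univ_two]
  simp [periods]

theorem cellCoord_mem_cell {s : Fin 2 → ℝ} :
    cellCoord s ∈ cell ↔ s ∈ Set.univ.pi fun _ => Set.Ico (0 : ℝ) 1 := by
  change (∀ i, periods.basis.repr (periods.basis.equivFun.symm s) i ∈ _) ↔ _
  have : ∀ i, periods.basis.repr (periods.basis.equivFun.symm s) i = s i := fun i =>
    congrFun (periods.basis.equivFun.apply_symm_apply s) i
  simp only [this, Set.mem_pi, Set.mem_univ, true_imp_iff]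

theorem box_ae_eq : ({x : Fin 2 → ℝ | ∀ i, x i ∈ Set.Ioc (0 : ℝ) (0 + 1)} : Set (Fin 2 → ℝ))
    =ᵐ[volume] cellCoord ⁻¹' cell := by
  have h1 : cellCoord ⁻¹' cell = Set.univ.pi fun _ => Set.Ico (0 : ℝ) 1 :=
    Set.ext fun s => cellCoord_mem_cell
  have h2 : {x : Fin 2 → ℝ | ∀ i, x i ∈ Set.Ioc (0 : ℝ) (0 + 1)} =
      Set.univ.pi fun _ => Set.Ioc (0 : ℝ) 1 := by ext; simp
  rw [h1, h2]
  exact (Measure.univ_pi_Ioc_ae_eq_Icc (μ := fun _ : Fin 2 => (volume : Measure ℝ))).trans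
    (Measure.univ_pi_Ico_ae_eq_Icc (μ := fun _ : Fin 2 => (volume : Measure ℝ))).symm

/-- Uniqueness of Haar measure makes the linear coordinates scale area by a constant. Its value is
irrelevant for null sets and vanishing integrals. -/
theorem exists_map_cellCoord : ∃ c : ENNReal, c ≠ 0 ∧ c ≠ ⊤ ∧
    Measure.map cellCoord (volume.restrict
      {x : Fin 2 → ℝ | ∀ i, x i ∈ Set.Ioc (0 : ℝ) (0 + 1)}) = c • volume.restrict cell := by
  have h1 : (Measure.map cellCoord (volume : Measure (Fin 2 → ℝ))).IsAddHaarMeasure :=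
    cellCoord.isAddHaarMeasure_map volume
  have hc := Measure.isAddLeftInvariant_eq_smul
    (Measure.map cellCoord (volume : Measure (Fin 2 → ℝ))) (volume : Measure ℂ)
  have h0 := Measure.addHaarScalarFactor_pos_of_isAddHaarMeasure
    (Measure.map cellCoord (volume : Measure (Fin 2 → ℝ))) (volume : Measure ℂ)
  generalize Measure.addHaarScalarFactor
    (Measure.map cellCoord (volume : Measure (Fin 2 → ℝ))) (volume : Measure ℂ) = c at hc h0
  refine ⟨c, ENNReal.coe_ne_zero.mpr h0.ne', ENNReal.coe_ne_top, ?_⟩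
  change _ = c • volume.restrict cell
  rw [Measure.restrict_congr_set box_ae_eq, ← Measure.restrict_smul, ← hc,
    Measure.restrict_map cellCoord.continuous.measurable measurableSet_cell]

theorem pairing_dual (m n : ℤ) (s : Fin 2 → ℝ) :
    pairing (dualScale * (m * omega + n)) (cellCoord s) = 2 * π * (n * s 0 - m * s 1) := by
  rw [cellCoord_apply, pairing, dualScale]
  have h3 : √3 ≠ 0 := by norm_num
  have h4 : √3 * √3 = 3 := Real.mul_self_sqrt (by norm_num)
  have h5 : (4 * π * I / ((√3 : ℝ) : ℂ)) = ((4 * π / √3 : ℝ) : ℂ) * I := by push_cast; ring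
  rw [h5]
  simp [omega_re, omega_im]
  field_simp
  ring

theorem ae_eq_zero_of_integral_cell {f : ℂ → ℂ} (hf : MemLp f 2 (volume.restrict cell))
    (h : ∀ q ∈ dualLattice, ∫ z in cell, exp (I * pairing q z) * f z = 0) :
    f =ᵐ[volume.restrict cell] 0 := by
  obtain ⟨c, h0, ht, hc⟩ := exists_map_cellCoord
  have hme : MeasurableEmbedding cellCoord :=
    cellCoord.toHomeomorph.measurableEmbedding
  have h1 := ae_eq_zero_of_integral_unit_box (g := f ∘ cellCoord) ?_ ?_
  · have h2 : ∀ᵐ z ∂(c • volume.restrict cell), f z = 0 := by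
      rw [← hc, hme.ae_map_iff]
      exact h1
    rwa [Measure.ae_ennreal_smul_measure_iff h0] at h2
  · rw [← hme.memLp_map_measure_iff, hc]
    exact hf.smul_measure ht
  · intro n
    -- By `pairing_dual` this dual vector pairs with s to 2π(n₀s₀ + n₁s₁), the phase of the n-th
    -- torus exponential.
    have h2 := h (dualScale * ((-n 1 : ℤ) * omega + (n 0 : ℤ)))
      (mem_dualLattice.mpr ⟨_, _, rfl⟩)
    have h3 : ∫ z, exp (I * pairing (dualScale * ((-n 1 : ℤ) * omega + (n 0 : ℤ))) z) * f z
        ∂(c • volume.restrict cell) = 0 := by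
      rw [integral_smul_measure, h2, smul_zero]
    rw [← hc, hme.integral_map] at h3
    rw [← h3]
    refine integral_congr_ae (Filter.Eventually.of_forall fun s => ?_)
    change _ * f (cellCoord s) = _ * f (cellCoord s)
    rw [pairing_dual, Fin.prod_univ_two, ← exp_add]
    congr 2
    push_cast
    ring

/-! ### `L²_p` as a space of functions on the cell -/

theorem pairing_add_left (a b z : ℂ) : pairing (a + b) z = pairing a z + pairing b z := by
  simp [pairing]; ring

theorem pairing_add_right (a z w : ℂ) : pairing a (z + w) = pairing a z + pairing a w := by
  simp [pairing]; ring

theorem pairing_neg_left (a z : ℂ) : pairing (-a) z = -pairing a z := by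
  simp [pairing]

theorem pairing_zero_right (a : ℂ) : pairing a 0 = 0 := by simp [pairing]

theorem pairing_comm (a z : ℂ) : pairing a z = pairing z a := by
  simp [pairing]; ring

theorem continuous_pairing (a : ℂ) : Continuous (pairing a) := by
  unfold pairing; fun_prop

theorem norm_exp_I_mul_ofReal (t : ℝ) : ‖exp (I * t)‖ = 1 := by
  rw [mul_comm, norm_exp_ofReal_mul_I]

/-- Elements of the dual lattice pair with the lattice in `2πℤ`. -/
theorem exp_pairing_dual {q γ : ℂ} (hq : q ∈ dualLattice) (hγ : γ ∈ lattice) :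
    exp (I * pairing q γ) = 1 := by
  obtain ⟨m, n, rfl⟩ := mem_dualLattice.mp hq
  obtain ⟨k, l, rfl⟩ := mem_lattice_iff.mp hγ
  have h := pairing_dual m n ![k, l]
  rw [cellCoord_apply] at h
  simp only [Matrix.cons_val_zero, Matrix.cons_val_one, ofReal_intCast] at h
  rw [h, exp_eq_one_iff]
  exact ⟨n * k - m * l, by push_cast; ring⟩

theorem act_twist_apply (γ : ℂ) (x : C2) :
    act (twist γ) x = !₂[exp (I * pairing γ K) * x 0, exp (-(I * pairing γ K)) * x 1] := by
  ext i
  fin_cases i <;> simp [twist, Matrix.mulVec, dotProduct, Fin.sum_univ_two]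

theorem norm_act_twist (γ : ℂ) (x : C2) : ‖act (twist γ) x‖ = ‖x‖ := by
  have h := norm_exp_I_mul_ofReal (-pairing γ K)
  rw [ofReal_neg, mul_neg] at h
  rw [act_twist_apply, EuclideanSpace.norm_eq, EuclideanSpace.norm_eq]
  simp [Fin.sum_univ_two, h]

theorem act_twist_twist (γ δ : ℂ) (x : C2) :
    act (twist γ) (act (twist δ) x) = act (twist (γ + δ)) x := by
  simp only [act_twist_apply, pairing_add_left]
  ext i
  fin_cases i
  · simp [mul_add, exp_add]; ring
  · simp [mul_add, exp_add]; ring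

theorem act_twist_zero (x : C2) : act (twist 0) x = x := by
  rw [act_twist_apply]
  ext i
  fin_cases i <;> simp [pairing]

theorem continuous_twist : Continuous twist := by
  unfold twist pairing
  refine continuous_matrix fun i j => ?_
  fin_cases i <;> fin_cases j <;> simp <;> fun_prop

theorem QuasiPeriodic.enorm_periodic {p : ℂ} {f : ℂ → C2} (hf : QuasiPeriodic p f) {γ : ℂ}
    (hγ : γ ∈ lattice) : ∀ᵐ z, ‖f (z + γ)‖ₑ = ‖f z‖ₑ := by
  filter_upwards [hf γ hγ] with z hz
  have h := congrArg (fun x => ‖x‖) hz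
  simp only [translate, norm_act_twist, norm_smul, norm_exp_I_mul_ofReal, one_mul] at h
  rw [← ofReal_norm, h, ofReal_norm]

theorem QuasiPeriodic.locL2 {p : ℂ} {f : ℂ → C2} (hf : QuasiPeriodic p f)
    (hm : AEStronglyMeasurable f) (hc : MemLp f 2 (volume.restrict cell)) : LocL2 f := by
  intro S hS
  obtain ⟨N, hN⟩ := exists_lintegral_le_cell hS.isBounded
  refine ⟨hm.restrict, ?_⟩
  have h1 := hc.2
  rw [eLpNorm_lt_top_iff_lintegral_rpow_enorm_lt_top (by norm_num) (by norm_num)] at h1 ⊢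
  refine (hN _ fun γ hγ => ?_).trans_lt (ENNReal.mul_lt_top (ENNReal.natCast_lt_top N) h1)
  filter_upwards [hf.enorm_periodic hγ] with z hz
  rw [hz]

/-- The lattice part of a point of the plane. -/
def cellFloor (z : ℂ) : ℂ := ZSpan.floor periods.basis z

theorem sub_cellFloor (z : ℂ) : z - cellFloor z = ZSpan.fract periods.basis z := rfl

theorem cellFloor_add {γ : ℂ} (hγ : γ ∈ lattice) (z : ℂ) : cellFloor (z + γ) = cellFloor z + γ := by
  have h := ZSpan.fract_add_ZSpan periods.basis z (mem_lattice_iff_span.mp hγ)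
  rw [← sub_cellFloor, ← sub_cellFloor] at h
  linear_combination -h

theorem cellFloor_of_mem {z : ℂ} (hz : z ∈ cell) : cellFloor z = 0 := by
  have h := (ZSpan.fract_eq_self (b := periods.basis)).mpr hz
  rw [← sub_cellFloor] at h
  linear_combination -h

theorem measurable_cellFloor : Measurable cellFloor := by
  have h : cellFloor = fun z => ∑ i, ((⌊periods.basis.repr z i⌋ : ℤ) : ℂ) * periods.basis i := by
    ext z
    simp [cellFloor, ZSpan.floor]
  rw [h]
  refine Finset.measurable_sum _ fun i _ => ?_
  have h1 : Measurable fun z => periods.basis.repr z i :=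
    (LinearMap.continuous_of_finiteDimensional (periods.basis.coord i)).measurable
  have h2 : Measurable fun n : ℤ => (n : ℂ) := measurable_from_top
  exact (h2.comp h1.floor).mul_const _

/-- The quasi-periodic extension of a function on the cell. -/
def extend (p : ℂ) (f : ℂ → C2) (z : ℂ) : C2 :=
  exp (I * pairing p (cellFloor z)) • act (twist (-cellFloor z)) (f (z - cellFloor z))

theorem extend_of_mem (p : ℂ) (f : ℂ → C2) {z : ℂ} (hz : z ∈ cell) : extend p f z = f z := by
  simp [extend, cellFloor_of_mem hz, pairing_zero_right, act_twist_zero]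

theorem quasiPeriodic_extend (p : ℂ) (f : ℂ → C2) : QuasiPeriodic p (extend p f) := by
  intro γ hγ
  refine Filter.Eventually.of_forall fun z => ?_
  simp only [translate, extend, cellFloor_add hγ, map_smul, act_twist_twist, pairing_add_right,
    ofReal_add, mul_add, exp_add, smul_smul]
  rw [mul_comm, show γ + -(cellFloor z + γ) = -cellFloor z by ring,
    show z + γ - (cellFloor z + γ) = z - cellFloor z by ring]

theorem stronglyMeasurable_extend (p : ℂ) {f : ℂ → C2} (hf : StronglyMeasurable f) :
    StronglyMeasurable (extend p f) := by
  have h1 : StronglyMeasurable fun z => f (z - cellFloor z) :=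
    hf.comp_measurable (measurable_id.sub measurable_cellFloor)
  have h2 : StronglyMeasurable fun z => act (twist (-cellFloor z)) :=
    (continuous_act (continuous_twist.comp continuous_neg)).stronglyMeasurable.comp_measurable
      measurable_cellFloor
  have h3 : StronglyMeasurable fun z => exp (I * pairing p (cellFloor z)) := by
    have h : Continuous fun w => exp (I * pairing p w) := by
      have := continuous_pairing p
      fun_prop
    exact h.stronglyMeasurable.comp_measurable measurable_cellFloor
  exact h3.smul (isBoundedBilinearMap_apply.continuous.comp_stronglyMeasurable (h2.prodMk h1))

/-- Any L² function on the cell extends quasi-periodically. Thus L²_p is isometric to an L² space,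
which makes it complete. -/
theorem restrictCell_surjective (p : ℂ) : Function.Surjective (restrictCell p) := by
  intro f
  have hae : extend p f =ᵐ[volume.restrict cell] f := by
    filter_upwards [ae_restrict_mem measurableSet_cell] with z hz
    exact extend_of_mem p f hz
  have hq := quasiPeriodic_extend p f
  have hl : LocL2 (extend p f) := hq.locL2
    (stronglyMeasurable_extend p (Lp.stronglyMeasurable f)).aestronglyMeasurable
    ((memLp_congr_ae hae).mpr (Lp.memLp f))
  refine ⟨L2.mk _ hl hq, ?_⟩
  apply Lp.ext
  refine (L2.mk _ hl hq).2.1.memLp_cell.coeFn_toLp.trans ?_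
  exact Filter.EventuallyEq.trans (ae_restrict_of_ae (L2.coeFn_mk _ hl hq)) hae

/-- Restriction to the cell as an isometric isomorphism. -/
def restrictCellEquiv (p : ℂ) : L2 p ≃ₗᵢ[ℂ] Lp C2 2 (volume.restrict cell) where
  toLinearEquiv := LinearEquiv.ofBijective (restrictCell p)
    ⟨restrictCell_injective p, restrictCell_surjective p⟩
  norm_map' _ := rfl

theorem coeFn_restrictCellEquiv (p : ℂ) (u : L2 p) :
    restrictCellEquiv p u =ᵐ[volume.restrict cell] u.1 :=
  u.2.1.memLp_cell.coeFn_toLp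

instance (p : ℂ) : CompleteSpace (L2 p) :=
  (restrictCellEquiv p).toIsometryEquiv.completeSpace

/-! ### Plane waves -/

/-- The normalized plane wave of frequency `j + p`. -/
def wave (p : ℂ) (j : Dirac) (z : ℂ) : C2 :=
  (((√cellArea)⁻¹ : ℝ) * exp (I * pairing (j.1 + p) z)) • EuclideanSpace.single j.comp 1

theorem contDiff_wave (p : ℂ) (j : Dirac) : ContDiff ℝ ∞ (wave p j) := by
  have h : ContDiff ℝ ∞ fun z => pairing (j.1 + p) z := by
    have : (fun z => pairing (j.1 + p) z) = fun z => reCLM ((j.1 + p) * conjCLE z) := rfl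
    rw [this]
    fun_prop
  have h2 : ContDiff ℝ ∞ fun z => (pairing (j.1 + p) z : ℂ) := ofRealCLM.contDiff.comp h
  have h3 : ContDiff ℝ ∞ fun z => exp (I * pairing (j.1 + p) z) := (contDiff_const.mul h2).cexp
  exact (contDiff_const.mul h3).smul contDiff_const

theorem continuous_wave (p : ℂ) (j : Dirac) : Continuous (wave p j) := (contDiff_wave p j).continuous

theorem wave_add (p : ℂ) (j : Dirac) (z w : ℂ) :
    wave p j (z + w) = exp (I * pairing (j.1 + p) w) • wave p j z := by
  rw [wave, wave, pairing_add_right, ofReal_add, mul_add, exp_add, smul_smul]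
  congr 1
  ring

theorem LocL2.of_continuous {f : ℂ → C2} (hf : Continuous f) : LocL2 f := by
  intro S hS
  have : IsFiniteMeasure (volume.restrict S) :=
    ⟨by rw [Measure.restrict_apply_univ]; exact hS.measure_lt_top⟩
  obtain ⟨C, hC⟩ := hS.exists_bound_of_continuousOn hf.continuousOn
  exact MemLp.of_bound hf.aestronglyMeasurable C
    ((ae_restrict_mem hS.measurableSet).mono fun z hz => hC z hz)

/-- This dictates the index set: frequencies in -K + Λ* live in the first component and those in K +
Λ* in the second. The twist then cancels the phase of the wave up to e^{i⟨p,γ⟩}. -/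
theorem act_twist_single (j : Dirac) {γ : ℂ} (hγ : γ ∈ lattice) :
    act (twist γ) (EuclideanSpace.single j.comp 1) =
      exp (-(I * pairing j.1 γ)) • EuclideanSpace.single j.comp (1 : ℂ) := by
  have h1 : ∀ i : Fin 2, i = 0 ∨ i = 1 := by decide
  rw [act_twist_apply]
  rcases h1 j.comp with h | h <;> rw [h]
  · have h2 := exp_pairing_dual (Dirac.comp_eq_zero.mp h) hγ
    rw [pairing_add_left, pairing_comm K, ofReal_add, mul_add, exp_add] at h2
    have h3 : exp (I * pairing γ K) = exp (-(I * pairing j.1 γ)) := by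
      rw [exp_neg]
      exact eq_inv_of_mul_eq_one_right h2
    ext i
    fin_cases i <;> simp [h3]
  · have h2 := exp_pairing_dual (Dirac.comp_eq_one.mp h) hγ
    rw [sub_eq_add_neg, pairing_add_left, pairing_neg_left, pairing_comm K, ofReal_add, mul_add,
      exp_add, ofReal_neg, mul_neg] at h2
    have h3 : exp (-(I * pairing γ K)) = exp (-(I * pairing j.1 γ)) := by
      rw [exp_neg (I * pairing j.1 γ)]
      exact eq_inv_of_mul_eq_one_right h2
    ext i
    fin_cases i <;> simp [h3]

theorem quasiPeriodic_wave (p : ℂ) (j : Dirac) : QuasiPeriodic p (wave p j) := by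
  intro γ hγ
  refine Filter.Eventually.of_forall fun z => ?_
  simp only [translate]
  rw [wave_add, map_smul, wave, map_smul, act_twist_single j hγ, smul_smul, smul_smul, smul_smul]
  congr 1
  rw [pairing_add_left, ofReal_add, mul_add, exp_add, exp_neg]
  have := exp_ne_zero (I * pairing j.1 γ)
  field_simp

/-- The normalized plane waves as elements of `L²_p`. -/
def waveL2 (p : ℂ) (j : Dirac) : L2 p :=
  L2.mk (wave p j) (LocL2.of_continuous (continuous_wave p j)) (quasiPeriodic_wave p j)

theorem coeFn_waveL2 (p : ℂ) (j : Dirac) : (waveL2 p j).1 =ᵐ[volume] wave p j := L2.coeFn_mk _ _ _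

/-- The normalized plane waves on the cell. -/
def waveCell (p : ℂ) (j : Dirac) : Lp C2 2 (volume.restrict cell) := restrictCellEquiv p (waveL2 p j)

theorem coeFn_waveCell (p : ℂ) (j : Dirac) : waveCell p j =ᵐ[volume.restrict cell] wave p j :=
  (coeFn_restrictCellEquiv p _).trans (ae_restrict_of_ae (coeFn_waveL2 p j))

theorem inner_wave (p : ℂ) (j : Dirac) (z : ℂ) (x : C2) : inner ℂ (wave p j z) x =
    (((√cellArea)⁻¹ : ℝ) * exp (-(I * pairing (j.1 + p) z))) * x j.comp := by
  rw [wave, inner_smul_left, EuclideanSpace.inner_single_left, map_mul, conj_ofReal, ← exp_conj]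
  simp

theorem inner_waveCell (p : ℂ) (j : Dirac) (f : Lp C2 2 (volume.restrict cell)) :
    inner ℂ (waveCell p j) f = ((√cellArea)⁻¹ : ℝ) *
      ∫ z in cell, exp (-(I * pairing (j.1 + p) z)) * f z j.comp := by
  rw [L2.inner_def, ← integral_const_mul]
  refine integral_congr_ae ?_
  filter_upwards [coeFn_waveCell p j] with z hz
  rw [hz, inner_wave, mul_assoc]

theorem exists_exp_pairing_ne_one {q : ℂ} (hq : q ≠ 0) : ∃ w, exp (I * pairing q w) ≠ 1 := by
  have h0 : (q * conj q).re ≠ 0 := by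
    rw [mul_conj]
    simpa using hq
  refine ⟨((π / (q * conj q).re : ℝ) : ℂ) * q, ?_⟩
  have h : pairing q (((π / (q * conj q).re : ℝ) : ℂ) * q) = π := by
    rw [pairing, map_mul, conj_ofReal, mul_left_comm, re_ofReal_mul, div_mul_cancel₀ _ h0]
  rw [h, mul_comm, exp_pi_mul_I]
  norm_num

theorem integral_exp_dual {q : ℂ} (hq : q ∈ dualLattice) :
    ∫ z in cell, exp (I * pairing q z) = if q = 0 then (cellArea : ℂ) else 0 := by
  split_ifs with h
  · simp [h, pairing, cellArea]
  · obtain ⟨w, hw⟩ := exists_exp_pairing_ne_one h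
    -- Translation by w preserves the integral but multiplies it by a phase different from 1, so it
    -- vanishes.
    have h1 := setIntegral_cell_add w (F := fun z => exp (I * pairing q z)) (fun γ hγ z => by
      rw [pairing_add_right, ofReal_add, mul_add, exp_add, exp_pairing_dual hq hγ, mul_one])
    simp only [pairing_add_right, ofReal_add, mul_add, exp_add] at h1
    rw [integral_mul_const] at h1
    have h2 : (∫ z in cell, exp (I * pairing q z)) * (exp (I * pairing q w) - 1) = 0 := by
      linear_combination h1
    exact (mul_eq_zero.mp h2).resolve_right (sub_ne_zero.mpr hw)

theorem Dirac.sub_mem_dualLattice {i j : Dirac} (h : i.comp = j.comp) :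
    i.1 - j.1 ∈ dualLattice := by
  have h1 : ∀ i : Fin 2, i = 0 ∨ i = 1 := by decide
  rcases h1 j.comp with h2 | h2
  · have := dualLattice_sub (comp_eq_zero.mp (h.trans h2)) (comp_eq_zero.mp h2)
    convert this using 1; ring
  · have := dualLattice_sub (comp_eq_one.mp (h.trans h2)) (comp_eq_one.mp h2)
    convert this using 1; ring

theorem ofReal_inv_sqrt_cellArea_mul :
    (((√cellArea)⁻¹ : ℝ) : ℂ) * (((√cellArea)⁻¹ : ℝ) : ℂ) * cellArea = 1 := by
  rw [← ofReal_mul, ← ofReal_mul, ← mul_inv, Real.mul_self_sqrt cellArea_pos.le,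
    inv_mul_cancel₀ cellArea_pos.ne', ofReal_one]

theorem orthonormal_waveCell (p : ℂ) : Orthonormal ℂ (waveCell p) := by
  classical
  rw [orthonormal_iff_ite]
  intro i j
  rw [inner_waveCell]
  have h1 : ∫ z in cell, exp (-(I * pairing (i.1 + p) z)) * waveCell p j z i.comp =
      ∫ z in cell, (if i.comp = j.comp then 1 else 0) * ((((√cellArea)⁻¹ : ℝ) : ℂ) *
        exp (I * pairing (j.1 - i.1) z)) := by
    refine integral_congr_ae ?_
    filter_upwards [coeFn_waveCell p j] with z hz
    rw [hz, wave]
    have h2 : exp (I * pairing (j.1 - i.1) z) =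
        exp (-(I * pairing (i.1 + p) z)) * exp (I * pairing (j.1 + p) z) := by
      rw [← exp_add]
      congr 1
      simp only [sub_eq_add_neg, pairing_add_left, pairing_neg_left]
      push_cast
      ring
    rw [h2]
    by_cases h : i.comp = j.comp
    · simp [h]; ring
    · simp [h]
  rw [h1, integral_const_mul, integral_const_mul]
  by_cases h : i.comp = j.comp
  · rw [if_pos h, integral_exp_dual (Dirac.sub_mem_dualLattice h.symm)]
    by_cases hij : i = j
    · rw [if_pos hij, if_pos (by rw [hij, sub_self])]
      linear_combination ofReal_inv_sqrt_cellArea_mul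
    · rw [if_neg hij, if_neg fun h => hij (Subtype.ext (sub_eq_zero.mp h).symm)]
      ring
  · rw [if_neg h, if_neg fun hij => h (by rw [hij])]
    ring

/-- A Dirac point in each of the two classes. -/
theorem Dirac.exists_comp_eq (i : Fin 2) : ∃ j : Dirac, j.comp = i := by
  have h1 : i = 0 ∨ i = 1 := by revert i; decide
  have h0 : (0 : ℂ) ∈ dualLattice := mem_dualLattice.mpr ⟨0, 0, by simp⟩
  rcases h1 with rfl | rfl
  · refine ⟨⟨-K, Or.inr (by simpa using h0)⟩, comp_eq_zero.mpr (by simpa using h0)⟩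
  · refine ⟨⟨K, Or.inl (by simpa using h0)⟩, comp_eq_one.mpr (by simpa using h0)⟩

/-- In each component, multiplying by one wave shifts the admissible frequencies to Λ*. Completeness
of the periodic exponentials then applies. -/
theorem orthogonal_waveCell (p : ℂ) :
    (Submodule.span ℂ (Set.range (waveCell p)))ᗮ = ⊥ := by
  rw [eq_bot_iff]
  intro f hf
  rw [Submodule.mem_orthogonal] at hf
  have h1 : ∀ i : Fin 2, (fun z => f z i) =ᵐ[volume.restrict cell] 0 := by
    intro i
    obtain ⟨j₀, hj₀⟩ := Dirac.exists_comp_eq i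
    have hmem : MemLp (fun z => f z i) 2 (volume.restrict cell) :=
      (EuclideanSpace.proj (𝕜 := ℂ) i).comp_memLp' (Lp.memLp f)
    have hcont : Continuous fun z => exp (-(I * pairing (j₀.1 + p) z)) := by
      have := continuous_pairing (j₀.1 + p)
      fun_prop
    have hmem2 : MemLp (fun z => exp (-(I * pairing (j₀.1 + p) z)) * f z i) 2
        (volume.restrict cell) := by
      refine hmem.of_le (hcont.aestronglyMeasurable.mul hmem.1)
        (Filter.Eventually.of_forall fun z => le_of_eq ?_)
      rw [norm_mul, show -(I * (pairing (j₀.1 + p) z : ℂ)) = I * ((-pairing (j₀.1 + p) z : ℝ) : ℂ) by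
        push_cast; ring, norm_exp_I_mul_ofReal, one_mul]
    have h2 := ae_eq_zero_of_integral_cell hmem2 (fun q hq => by
      let j := Dirac.shiftPerm (-q) (dualLattice_neg hq) j₀
      have hj : j.comp = i := (Dirac.comp_add (dualLattice_neg hq) rfl).trans hj₀
      have h3 := hf _ (Submodule.subset_span ⟨j, rfl⟩)
      rw [inner_waveCell, hj] at h3
      have h4 : (((√cellArea)⁻¹ : ℝ) : ℂ) ≠ 0 := by
        have := cellArea_pos
        exact_mod_cast (inv_pos.mpr (Real.sqrt_pos.mpr this)).ne'
      rw [← (mul_eq_zero.mp h3).resolve_left h4]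
      congr 1
      ext z
      rw [← mul_assoc, ← exp_add]
      congr 2
      change _ = -(I * (pairing (j₀.1 + -q + p) z : ℂ))
      simp only [pairing_add_left, pairing_neg_left]
      push_cast
      ring)
    filter_upwards [h2] with z hz
    exact (mul_eq_zero.mp hz).resolve_left (exp_ne_zero _)
  refine Lp.ext ?_
  filter_upwards [h1 0, h1 1, Lp.coeFn_zero C2 2 (volume.restrict cell)] with z h2 h3 h4
  rw [h4]
  ext i
  fin_cases i
  · exact h2
  · exact h3

/-- The Hilbert basis of normalized plane waves. -/
def waveBasis (p : ℂ) : HilbertBasis Dirac ℂ (Lp C2 2 (volume.restrict cell)) :=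
  HilbertBasis.mkOfOrthogonalEqBot (orthonormal_waveCell p) (orthogonal_waveCell p)

theorem waveBasis_apply (p : ℂ) (j : Dirac) : waveBasis p j = waveCell p j :=
  congrFun (HilbertBasis.coe_mkOfOrthogonalEqBot _ _) j

/-- The Fourier transform `L²_p ≃ ℓ²(𝒦₀)`. -/
def fourierL2 (p : ℂ) : L2 p ≃ₗᵢ[ℂ] Seq Dirac := (restrictCellEquiv p).trans (waveBasis p).repr

theorem fourierL2_apply (p : ℂ) (u : L2 p) (j : Dirac) : fourierL2 p u j =
    ((√cellArea)⁻¹ : ℝ) * ∫ z in cell, exp (-(I * pairing (j.1 + p) z)) * u.1 z j.comp := by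
  change (waveBasis p).repr (restrictCellEquiv p u) j = _
  rw [HilbertBasis.repr_apply_apply, waveBasis_apply, inner_waveCell]
  congr 1
  refine integral_congr_ae ?_
  filter_upwards [coeFn_restrictCellEquiv p u] with z hz
  rw [hz]

theorem fourierL2_symm_single [DecidableEq Dirac] (p : ℂ) (j : Dirac) :
    (fourierL2 p).symm (lp.single 2 j 1) = waveL2 p j := by
  change (restrictCellEquiv p).symm ((waveBasis p).repr.symm (lp.single 2 j 1)) = _
  rw [HilbertBasis.repr_symm_single, waveBasis_apply]
  exact (restrictCellEquiv p).symm_apply_apply _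

/-! ### Weak derivatives in Fourier variables -/

/-- The support of φ meets finitely many cells, and L² controls L¹ on a cell. Continuity of these
functionals allows Fourier series to be tested term by term. -/
theorem norm_integral_test_le {φ : ℂ → ℝ} (h1 : Continuous φ) (h2 : HasCompactSupport φ) :
    ∃ C : ℝ, ∀ (p : ℂ) (u : L2 p), ‖∫ z, φ z • u.1 z‖ ≤ C * ‖u‖ := by
  obtain ⟨M, hM⟩ := h1.bounded_above_of_compact_support h2
  have hM0 : 0 ≤ M := (norm_nonneg _).trans (hM 0)
  obtain ⟨N, hN⟩ := exists_lintegral_le_cell (S := tsupport φ) h2.isCompact.isBounded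
  have hfin : (volume.restrict cell) Set.univ ^ (1 / (1 : ENNReal).toReal - 1 / (2 : ENNReal).toReal) ≠ ⊤ :=
    ENNReal.rpow_ne_top_of_nonneg (by norm_num) (measure_ne_top _ _)
  refine ⟨(ENNReal.ofReal M * (N * (volume.restrict cell) Set.univ ^
    (1 / (1 : ENNReal).toReal - 1 / (2 : ENNReal).toReal))).toReal, fun p u => ?_⟩
  have hmem := u.2.1.memLp_cell
  have h3 : ‖∫ z, φ z • u.1 z‖ₑ ≤ ENNReal.ofReal M * (N * (volume.restrict cell) Set.univ ^
      (1 / (1 : ENNReal).toReal - 1 / (2 : ENNReal).toReal)) *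
      eLpNorm u.1 2 (volume.restrict cell) := by
    have h4 : ∫ z, φ z • u.1 z = ∫ z in tsupport φ, φ z • u.1 z :=
      (setIntegral_eq_integral_of_forall_compl_eq_zero fun z hz => by
        rw [image_eq_zero_of_notMem_tsupport hz, zero_smul]).symm
    rw [h4]
    calc ‖∫ z in tsupport φ, φ z • u.1 z‖ₑ ≤ ∫⁻ z in tsupport φ, ‖φ z • u.1 z‖ₑ :=
          enorm_integral_le_lintegral_enorm _
      _ ≤ ∫⁻ z in tsupport φ, ENNReal.ofReal M * ‖u.1 z‖ₑ := by
          refine lintegral_mono fun z => ?_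
          rw [enorm_smul]
          gcongr
          rw [← ofReal_norm]
          exact ENNReal.ofReal_le_ofReal (hM z)
      _ = ENNReal.ofReal M * ∫⁻ z in tsupport φ, ‖u.1 z‖ₑ :=
          lintegral_const_mul' _ _ ENNReal.ofReal_ne_top
      _ ≤ ENNReal.ofReal M * (N * ∫⁻ z in cell, ‖u.1 z‖ₑ) := by
          gcongr
          exact hN _ fun γ hγ => u.2.2.enorm_periodic hγ
      _ ≤ ENNReal.ofReal M * (N * (eLpNorm u.1 2 (volume.restrict cell) *
            (volume.restrict cell) Set.univ ^
            (1 / (1 : ENNReal).toReal - 1 / (2 : ENNReal).toReal))) := by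
          gcongr
          rw [← eLpNorm_one_eq_lintegral_enorm]
          exact eLpNorm_le_eLpNorm_mul_rpow_measure_univ (by norm_num) hmem.1
      _ = _ := by ring
  rw [norm_def, ← ENNReal.toReal_mul, ← toReal_enorm]
  refine ENNReal.toReal_mono (ENNReal.mul_ne_top (ENNReal.mul_ne_top ENNReal.ofReal_ne_top
    (ENNReal.mul_ne_top (ENNReal.natCast_ne_top N) hfin)) hmem.2.ne) h3

/-- The pairing `u ↦ ∫ φ u` with a test function. -/
def testOp (p : ℂ) {φ : ℂ → ℝ} (h1 : Continuous φ) (h2 : HasCompactSupport φ) : L2 p →L[ℂ] C2 :=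
  LinearMap.mkContinuousOfExistsBound
    { toFun := fun u => ∫ z, φ z • u.1 z
      map_add' := fun u v => by
        rw [← integral_add (integrable_test h1 h2 u.2.1) (integrable_test h1 h2 v.2.1)]
        refine integral_congr_ae ?_
        filter_upwards [AEEqFun.coeFn_add u.1 v.1] with z hz
        rw [Submodule.coe_add, hz, Pi.add_apply, smul_add]
      map_smul' := fun c u => by
        rw [RingHom.id_apply, ← integral_smul]
        refine integral_congr_ae ?_
        filter_upwards [AEEqFun.coeFn_smul c u.1] with z hz
        rw [Submodule.coe_smul, hz, Pi.smul_apply, smul_comm] }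
    (by
      obtain ⟨C, hC⟩ := norm_integral_test_le h1 h2
      exact ⟨C, hC p⟩)

theorem testOp_apply (p : ℂ) {φ : ℂ → ℝ} (h1 : Continuous φ) (h2 : HasCompactSupport φ)
    (u : L2 p) : testOp p h1 h2 u = ∫ z, φ z • u.1 z := rfl

/-- The Fourier coefficients of a test function. -/
def testCoeff (p : ℂ) (φ : ℂ → ℝ) (j : Dirac) : ℂ :=
  ((√cellArea)⁻¹ : ℝ) * ∫ z, φ z • exp (I * pairing (j.1 + p) z)

theorem integral_smul_wave (p : ℂ) (φ : ℂ → ℝ) (j : Dirac) :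
    ∫ z, φ z • wave p j z = testCoeff p φ j • EuclideanSpace.single j.comp 1 := by
  rw [testCoeff, ← integral_const_mul, ← integral_smul_const]
  congr 1
  ext1 z
  rw [wave, ← smul_assoc, mul_smul_comm]

theorem testOp_waveL2 (p : ℂ) {φ : ℂ → ℝ} (h1 : Continuous φ) (h2 : HasCompactSupport φ)
    (j : Dirac) :
    testOp p h1 h2 (waveL2 p j) = testCoeff p φ j • EuclideanSpace.single j.comp 1 := by
  rw [testOp_apply, ← integral_smul_wave]
  refine integral_congr_ae ?_
  filter_upwards [coeFn_waveL2 p j] with z hz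
  rw [hz]

theorem hasSum_testOp (p : ℂ) {φ : ℂ → ℝ} (h1 : Continuous φ) (h2 : HasCompactSupport φ)
    (u : L2 p) :
    HasSum (fun j : Dirac => (fourierL2 p u j * testCoeff p φ j) •
      (EuclideanSpace.single j.comp 1 : C2)) (∫ z, φ z • u.1 z) := by
  classical
  have h3 := (Seq.hasSum_single (fourierL2 p u)).mapL
    ((testOp p h1 h2).comp (fourierL2 p).symm.toContinuousLinearEquiv.toContinuousLinearMap)
  have h4 : ((testOp p h1 h2).comp
      (fourierL2 p).symm.toContinuousLinearEquiv.toContinuousLinearMap) (fourierL2 p u) =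
      ∫ z, φ z • u.1 z := by
    change testOp p h1 h2 ((fourierL2 p).symm (fourierL2 p u)) = _
    rw [LinearIsometryEquiv.symm_apply_apply, testOp_apply]
  rw [h4] at h3
  refine h3.congr_fun fun j => ?_
  have h5 : lp.single 2 j (fourierL2 p u j) = fourierL2 p u j • (lp.single 2 j 1 : Seq Dirac) := by
    rw [← lp.single_smul, smul_eq_mul, mul_one]
  change _ = testOp p h1 h2 ((fourierL2 p).symm (lp.single 2 j (fourierL2 p u j)))
  rw [h5, map_smul, map_smul, fourierL2_symm_single, testOp_waveL2, smul_smul]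

theorem fderiv_wave (p : ℂ) (j : Dirac) (z v : ℂ) :
    fderiv ℝ (wave p j) z v = (I * pairing (j.1 + p) v) • wave p j z := by
  have h1 : HasLineDerivAt ℝ (wave p j) (fderiv ℝ (wave p j) z v) z v :=
    ((contDiff_wave p j).differentiable (by simp) z).hasFDerivAt.hasLineDerivAt v
  refine h1.unique ?_
  have h2 : HasDerivAt (fun t : ℝ => exp (I * pairing (j.1 + p) v * t)) (I * pairing (j.1 + p) v)
      0 := by
    have h3 : HasDerivAt (fun t : ℝ => I * pairing (j.1 + p) v * (t : ℂ))
        (I * pairing (j.1 + p) v) 0 := by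
      simpa using (HasDerivAt.ofReal_comp (hasDerivAt_id (0 : ℝ))).const_mul
        (I * (pairing (j.1 + p) v : ℂ))
    simpa using h3.cexp
  have h4 := h2.smul_const (wave p j z)
  refine h4.congr_of_eventuallyEq (Filter.Eventually.of_forall fun t => ?_)
  change wave p j (z + t • v) = _
  rw [wave_add]
  congr 2
  have h5 : pairing (j.1 + p) (t • v) = t * pairing (j.1 + p) v := by
    simp [pairing]; ring
  rw [h5]
  push_cast
  ring

theorem testCoeff_fderiv (p : ℂ) {φ : ℂ → ℝ} (h1 : ContDiff ℝ ∞ φ) (h2 : HasCompactSupport φ)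
    (v : ℂ) (j : Dirac) : testCoeff p (fun z => fderiv ℝ φ z v) j =
      -(I * pairing (j.1 + p) v) * testCoeff p φ j := by
  have hl := LocL2.of_continuous (continuous_wave p j)
  have h3 := integral_smul_fderiv_eq_neg_fderiv_smul_of_integrable (μ := volume) (f := φ)
    (g := wave p j) (v := v) (integrable_test_fderiv h1 h2 v hl) (by
      simp only [fderiv_wave]
      exact integrable_test h1.continuous h2 (hl.const_smul _))
    (integrable_test h1.continuous h2 hl) (fun z _ => h1.differentiable (by simp) z)
    (fun z _ => (contDiff_wave p j).differentiable (by simp) z)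
  simp only [fderiv_wave, smul_comm (φ _) (I * (pairing (j.1 + p) v : ℂ))] at h3
  rw [integral_smul, integral_smul_wave, integral_smul_wave] at h3
  have h4 := congrArg (fun x : C2 => x j.comp) h3
  simp at h4
  linear_combination h4

theorem testCoeff_translate (p : ℂ) (φ : ℂ → ℝ) (w : ℂ) (j : Dirac) :
    testCoeff p (fun z => φ (z - w)) j = exp (I * pairing (j.1 + p) w) * testCoeff p φ j := by
  rw [testCoeff, testCoeff, mul_left_comm, ← integral_const_mul (exp _),
    ← integral_add_right_eq_self (fun z => φ (z - w) • exp (I * pairing (j.1 + p) z)) w]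
  congr 2
  ext1 z
  rw [add_sub_cancel_right, pairing_add_right, ofReal_add, mul_add, exp_add, mul_smul_comm,
    mul_comm (exp _)]

theorem exists_testCoeff_ne_zero (p : ℂ) (j : Dirac) :
    ∃ φ : ℂ → ℝ, ContDiff ℝ ∞ φ ∧ HasCompactSupport φ ∧ testCoeff p φ j ≠ 0 := by
  by_contra! h
  have h1 := ae_eq_zero_of_integral_contDiff_smul_eq_zero (μ := volume) (f := wave p j)
    (LocL2.of_continuous (continuous_wave p j)).locallyIntegrable (fun φ h1 h2 => by
      rw [integral_smul_wave, h φ h1 h2, zero_smul])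
  obtain ⟨z, hz⟩ := h1.exists
  have h2 := congrArg (fun x : C2 => x j.comp) hz
  have h3 : √cellArea ≠ 0 := (Real.sqrt_pos.mpr cellArea_pos).ne'
  simp [wave, h3, exp_ne_zero] at h2

instance : Countable Dirac := by
  have h : (Set.univ : Set Dirac) = ⋃ n : ℕ, {j : Dirac | ‖j.1‖ ≤ n} := by
    refine (Set.eq_univ_of_forall fun j => ?_).symm
    obtain ⟨n, hn⟩ := exists_nat_ge ‖j.1‖
    exact Set.mem_iUnion.mpr ⟨n, hn⟩
  rw [← Set.countable_univ_iff, h]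
  exact Set.countable_iUnion fun n => (Dirac.finite_norm_le n).countable

/-- Uniqueness of the coefficients of absolutely convergent exponential series. -/
theorem eq_zero_of_hasSum_exp {c : Dirac → ℂ}
    (h : ∀ w, HasSum (fun j : Dirac => (exp (I * pairing j.1 w) * c j) •
      (EuclideanSpace.single j.comp 1 : C2)) 0) (j₀ : Dirac) : c j₀ = 0 := by
  have h1 : ∀ w, HasSum (fun j : Dirac => if j.comp = j₀.comp then
      exp (I * pairing (j.1 - j₀.1) w) * c j else 0) 0 := by
    intro w
    have h2 := ((h w).mapL (EuclideanSpace.proj (𝕜 := ℂ) j₀.comp)).mul_left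
      (exp (-(I * pairing j₀.1 w)))
    rw [map_zero, mul_zero] at h2
    refine h2.congr_fun fun j => ?_
    change _ = exp (-(I * pairing j₀.1 w)) * (((exp (I * pairing j.1 w) * c j) •
      (EuclideanSpace.single j.comp 1 : C2)) j₀.comp)
    by_cases hj : j.comp = j₀.comp
    · rw [if_pos hj, PiLp.smul_apply, hj, PiLp.single_apply, if_pos rfl, sub_eq_add_neg,
        pairing_add_left, pairing_neg_left, ofReal_add, mul_add, exp_add, ofReal_neg, mul_neg,
        smul_eq_mul]
      ring
    · rw [if_neg hj, PiLp.smul_apply, PiLp.single_apply, if_neg (Ne.symm hj), smul_zero,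
        mul_zero]
  let F : Dirac → ℂ → ℂ := fun j w => if j.comp = j₀.comp then
      exp (I * pairing (j.1 - j₀.1) w) * c j else 0
  have hF : ∀ j, Continuous (F j) := by
    intro j
    have := continuous_pairing (j.1 - j₀.1)
    by_cases hj : j.comp = j₀.comp
    · simp only [F, if_pos hj]; fun_prop
    · simp only [F, if_neg hj]; fun_prop
  have hn : ∀ j w, ‖F j w‖ = ‖F j 0‖ := by
    intro j w
    by_cases hj : j.comp = j₀.comp
    · simp only [F, if_pos hj, norm_mul, norm_exp_I_mul_ofReal]
    · simp only [F, if_neg hj]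
  -- The norm of each term does not depend on w, so convergence at w = 0 justifies integrating over
  -- the cell, where only the term j₀ survives.
  have hs := hasSum_integral_of_summable_integral_norm (μ := volume.restrict cell) (F := F)
    (fun j => Integrable.of_bound (hF j).aestronglyMeasurable ‖F j 0‖
      (Filter.Eventually.of_forall fun w => (hn j w).le)) (by
      simp only [hn, integral_const]
      exact (h1 0).summable.norm.mul_left _)
  have h2 : (fun w => ∑' j, F j w) = fun _ => 0 := funext fun w => (h1 w).tsum_eq
  rw [h2, integral_zero] at hs
  have h3 : HasSum (fun j => ∫ w in cell, F j w) (cellArea * c j₀) := by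
    have h4 : ∫ w in cell, F j₀ w = cellArea * c j₀ := by
      simp only [F, if_true]
      rw [integral_mul_const, integral_exp_dual (Dirac.sub_mem_dualLattice rfl), if_pos (sub_self _)]
    rw [← h4]
    refine hasSum_single j₀ fun j hj => ?_
    by_cases hc : j.comp = j₀.comp
    · simp only [F, if_pos hc]
      rw [integral_mul_const, integral_exp_dual (Dirac.sub_mem_dualLattice hc), if_neg
        fun h => hj (Subtype.ext (sub_eq_zero.mp h)), zero_mul]
    · simp only [F, if_neg hc]
      rw [integral_zero]
  have h5 := h3.unique hs
  exact (mul_eq_zero.mp h5).resolve_left (by exact_mod_cast cellArea_pos.ne')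

/-- Testing against all translates of one φ turns the weak identity into an exponential series
vanishing identically, hence with zero coefficients. Choosing φ with nonzero coefficient at j₀
isolates that frequency. -/
theorem hasWeakDeriv_iff {p v : ℂ} {u g : L2 p} : HasWeakDeriv v u.1 g.1 ↔
    ∀ j : Dirac, fourierL2 p g j = I * pairing (j.1 + p) v * fourierL2 p u j := by
  have hsum : ∀ (φ : ℂ → ℝ) (_ : ContDiff ℝ ∞ φ) (_ : HasCompactSupport φ),
      HasSum (fun j : Dirac => ((fourierL2 p g j - I * pairing (j.1 + p) v * fourierL2 p u j) *
        testCoeff p φ j) • (EuclideanSpace.single j.comp 1 : C2))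
        ((∫ z, fderiv ℝ φ z v • u.1 z) + ∫ z, φ z • g.1 z) := by
    intro φ h1 h2
    have h3 := hasSum_testOp p ((h1.continuous_fderiv (by simp)).clm_apply continuous_const)
      (h2.fderiv_apply (𝕜 := ℝ) v) u
    refine (h3.add (hasSum_testOp p h1.continuous h2 g)).congr_fun fun j => ?_
    rw [testCoeff_fderiv p h1 h2, ← add_smul]
    congr 1
    ring
  constructor
  · intro h j₀
    obtain ⟨φ, h1, h2, h3⟩ := exists_testCoeff_ne_zero p j₀
    have h4 := eq_zero_of_hasSum_exp (c := fun j =>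
      (fourierL2 p g j - I * pairing (j.1 + p) v * fourierL2 p u j) * testCoeff p φ j)
      (fun w => by
        have h1w : ContDiff ℝ ∞ fun z => φ (z - w) := h1.comp (contDiff_id.sub contDiff_const)
        have h2w : HasCompactSupport fun z => φ (z - w) :=
          h2.comp_homeomorph (Homeomorph.subRight w)
        have h5 := (hsum _ h1w h2w).const_smul (exp (-(I * pairing p w)))
        rw [h _ h1w h2w, neg_add_cancel, smul_zero] at h5
        refine h5.congr_fun fun j => ?_
        rw [testCoeff_translate, smul_smul]
        congr 1
        have h6 : exp (I * pairing j.1 w) =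
            exp (-(I * pairing p w)) * exp (I * pairing (j.1 + p) w) := by
          rw [← exp_add, pairing_add_left]
          congr 1
          push_cast
          ring
        rw [h6]
        ring) j₀
    exact sub_eq_zero.mp ((mul_eq_zero.mp h4).resolve_right h3)
  · intro h φ h1 h2
    have h3 := hsum φ h1 h2
    have h4 : (fun j : Dirac => ((fourierL2 p g j - I * pairing (j.1 + p) v * fourierL2 p u j) *
        testCoeff p φ j) • (EuclideanSpace.single j.comp 1 : C2)) = fun _ => 0 := by
      ext1 j
      rw [h j, sub_self, zero_mul, zero_smul]
    rw [h4] at h3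
    exact eq_neg_of_add_eq_zero_left (h3.unique hasSum_zero)

theorem fourierL2_weakDeriv {p : ℂ} (v : ℂ) (u : H1 p) (j : Dirac) :
    fourierL2 p (weakDeriv p v u) j = I * pairing (j.1 + p) v * fourierL2 p u.1 j :=
  hasWeakDeriv_iff.mp (hasWeakDeriv_weakDeriv v u) j

theorem fourierL2_dbarMap {p : ℂ} (u : H1 p) (j : Dirac) :
    fourierL2 p (dbarMap p u) j = (j.1 + p) * fourierL2 p u.1 j := by
  change fourierL2 p ((-I) • (weakDeriv p 1 u + I • weakDeriv p I u)) j = _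
  simp only [map_smul, map_add]
  change (-I) * (fourierL2 p (weakDeriv p 1 u) j + I * fourierL2 p (weakDeriv p I u) j) = _
  rw [fourierL2_weakDeriv, fourierL2_weakDeriv]
  have h : ((pairing (j.1 + p) 1 : ℝ) : ℂ) + I * (pairing (j.1 + p) I : ℝ) = j.1 + p := by
    apply Complex.ext <;> simp [pairing]
  linear_combination (fourierL2 p u.1 j) * h - (fourierL2 p u.1 j) *
    (((pairing (j.1 + p) 1 : ℝ) : ℂ) + I * (pairing (j.1 + p) I : ℝ)) * I_sq

theorem fourierL2_dMap {p : ℂ} (u : H1 p) (j : Dirac) :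
    fourierL2 p (dMap p u) j = conj (j.1 + p) * fourierL2 p u.1 j := by
  change fourierL2 p ((-I) • (weakDeriv p 1 u - I • weakDeriv p I u)) j = _
  simp only [map_smul, map_sub]
  change (-I) * (fourierL2 p (weakDeriv p 1 u) j - I * fourierL2 p (weakDeriv p I u) j) = _
  rw [fourierL2_weakDeriv, fourierL2_weakDeriv]
  have h : ((pairing (j.1 + p) 1 : ℝ) : ℂ) - I * (pairing (j.1 + p) I : ℝ) = conj (j.1 + p) := by
    apply Complex.ext <;> simp [pairing, add_comm]
  linear_combination (fourierL2 p u.1 j) * h - (fourierL2 p u.1 j) *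
    (((pairing (j.1 + p) 1 : ℝ) : ℂ) - I * (pairing (j.1 + p) I : ℝ)) * I_sq

theorem abs_pairing_le (a v : ℂ) : |pairing a v| ≤ ‖a‖ * ‖v‖ := by
  refine (abs_re_le_norm _).trans ?_
  rw [norm_mul, norm_conj]

/-- The bound makes the candidate coefficients of every directional derivative square summable.
Elliptic regularity for 2D_z̄ is contained here, since |j + p| controls both partial derivatives. -/
theorem mem_H1_of_norm_eq {p : ℂ} {u : L2 p} {y : Seq Dirac}
    (h : ∀ j : Dirac, ‖j.1 + p‖ * ‖fourierL2 p u j‖ ≤ ‖y j‖) : u ∈ H1 p := by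
  intro v
  have hm : Memℓp (fun j : Dirac => I * pairing (j.1 + p) v * fourierL2 p u j) 2 := by
    refine memlp_two_iff.mpr (Summable.of_nonneg_of_le (fun _ => by positivity) (fun j => ?_)
      (y.summable_sq.mul_left (‖v‖ ^ 2)))
    rw [← mul_pow]
    refine pow_le_pow_left₀ (norm_nonneg _) ?_ 2
    rw [norm_mul, norm_mul, norm_I, one_mul, norm_real, Real.norm_eq_abs]
    calc |pairing (j.1 + p) v| * ‖fourierL2 p u j‖
        ≤ ‖j.1 + p‖ * ‖v‖ * ‖fourierL2 p u j‖ := by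
          gcongr; exact abs_pairing_le _ _
      _ = ‖v‖ * (‖j.1 + p‖ * ‖fourierL2 p u j‖) := by ring
      _ ≤ _ := by gcongr; exact h j
  let g : L2 p := (fourierL2 p).symm ⟨_, hm⟩
  refine ⟨g.1, g.2.1, hasWeakDeriv_iff.mpr fun j => ?_⟩
  change fourierL2 p ((fourierL2 p).symm _) j = _
  rw [LinearIsometryEquiv.apply_symm_apply]

/-! ### Potentials in Fourier variables -/

theorem act_single_apply (M : Matrix (Fin 2) (Fin 2) ℂ) (i k : Fin 2) :
    act M (EuclideanSpace.single i 1) k = M k i := by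
  fin_cases i <;> fin_cases k <;> simp [Matrix.mulVec, dotProduct]

/-- The matrix entries of a multiplication operator in the basis of plane waves. -/
def matCoeff (M : ℂ → Matrix (Fin 2) (Fin 2) ℂ) (i j : Dirac) : ℂ :=
  ((√cellArea)⁻¹ : ℝ) * ((√cellArea)⁻¹ : ℝ) *
    ∫ z in cell, exp (I * pairing (j.1 - i.1) z) * M z i.comp j.comp

theorem fourierL2_mulOp_waveL2 (p : ℂ) (M : ℂ → Matrix (Fin 2) (Fin 2) ℂ) (hM : Continuous M)
    (hMγ : ∀ γ ∈ lattice, ∀ z, twist γ * M (z + γ) = M z * twist γ) (i j : Dirac) :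
    fourierL2 p (mulOp p M hM hMγ (waveL2 p j)) i = matCoeff M i j := by
  rw [fourierL2_apply, matCoeff, mul_assoc, ← integral_const_mul (((√cellArea)⁻¹ : ℝ) : ℂ)
    (fun z => exp (I * pairing (j.1 - i.1) z) * M z i.comp j.comp)]
  congr 1
  refine integral_congr_ae (ae_restrict_of_ae ?_)
  have h := L2.coeFn_mk _ ((waveL2 p j).2.1.act hM) ((waveL2 p j).2.2.act hMγ)
  filter_upwards [h, coeFn_waveL2 p j] with z h1 h2
  have h3 : (mulOp p M hM hMγ (waveL2 p j)).1 z = act (M z) (wave p j z) := by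
    rw [← h2]
    exact h1
  have h4 : exp (I * pairing (j.1 - i.1) z) =
      exp (-(I * pairing (i.1 + p) z)) * exp (I * pairing (j.1 + p) z) := by
    rw [← exp_add]
    congr 1
    simp only [sub_eq_add_neg, pairing_add_left, pairing_neg_left]
    push_cast
    ring
  rw [h3, wave, map_smul, PiLp.smul_apply, act_single_apply, smul_eq_mul, h4]
  ring

/-- A multiplication operator in Fourier variables. -/
def modelOp (M : ℂ → Matrix (Fin 2) (Fin 2) ℂ) (hM : Continuous M)
    (hMγ : ∀ γ ∈ lattice, ∀ z, twist γ * M (z + γ) = M z * twist γ) : Seq Dirac →L[ℂ] Seq Dirac :=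
  ((fourierL2 0).toContinuousLinearEquiv.toContinuousLinearMap.comp (mulOp 0 M hM hMγ)).comp
    (fourierL2 0).symm.toContinuousLinearEquiv.toContinuousLinearMap

theorem entry_modelOp [DecidableEq Dirac] (M : ℂ → Matrix (Fin 2) (Fin 2) ℂ) (hM : Continuous M)
    (hMγ : ∀ γ ∈ lattice, ∀ z, twist γ * M (z + γ) = M z * twist γ) (i j : Dirac) :
    entry (modelOp M hM hMγ) i j = matCoeff M i j := by
  change fourierL2 0 (mulOp 0 M hM hMγ ((fourierL2 0).symm (lp.single 2 j 1))) i = _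
  rw [fourierL2_symm_single, fourierL2_mulOp_waveL2]

/-- Matrix entries involve only differences of frequencies, so p cancels. This is the source of
independence of p. -/
theorem fourierL2_mulOp (p : ℂ) (M : ℂ → Matrix (Fin 2) (Fin 2) ℂ) (hM : Continuous M)
    (hMγ : ∀ γ ∈ lattice, ∀ z, twist γ * M (z + γ) = M z * twist γ) (u : L2 p) :
    fourierL2 p (mulOp p M hM hMγ u) = modelOp M hM hMγ (fourierL2 p u) := by
  classical
  have h : ((fourierL2 p).toContinuousLinearEquiv.toContinuousLinearMap.comp
      (mulOp p M hM hMγ)).comp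
      (fourierL2 p).symm.toContinuousLinearEquiv.toContinuousLinearMap = modelOp M hM hMγ := by
    refine ext_entry fun i j => ?_
    rw [entry_modelOp, ← fourierL2_mulOp_waveL2 p M hM hMγ, ← fourierL2_symm_single]
    rfl
  rw [← h]
  change _ = fourierL2 p (mulOp p M hM hMγ ((fourierL2 p).symm (fourierL2 p u)))
  rw [LinearIsometryEquiv.symm_apply_apply]

theorem twist_mul_apply (γ : ℂ) (M : Matrix (Fin 2) (Fin 2) ℂ) (i j : Fin 2) :
    (twist γ * M) i j = twist γ i i * M i j := by
  fin_cases i <;> fin_cases j <;> simp [twist, Matrix.mul_apply, Fin.sum_univ_two]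

theorem mul_twist_apply (γ : ℂ) (M : Matrix (Fin 2) (Fin 2) ℂ) (i j : Fin 2) :
    (M * twist γ) i j = M i j * twist γ j j := by
  fin_cases i <;> fin_cases j <;> simp [twist, Matrix.mul_apply, Fin.sum_univ_two]

theorem twist_comp (j : Dirac) {γ : ℂ} (hγ : γ ∈ lattice) :
    twist γ j.comp j.comp = exp (-(I * pairing j.1 γ)) := by
  have h := congrArg (fun x : C2 => x j.comp) (act_twist_single j hγ)
  simpa [act_single_apply] using h

theorem periodic_matCoeff {M : ℂ → Matrix (Fin 2) (Fin 2) ℂ}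
    (hMγ : ∀ γ ∈ lattice, ∀ z, twist γ * M (z + γ) = M z * twist γ) (i j : Dirac) {γ : ℂ}
    (hγ : γ ∈ lattice) (z : ℂ) :
    exp (I * pairing (j.1 - i.1) (z + γ)) * M (z + γ) i.comp j.comp =
      exp (I * pairing (j.1 - i.1) z) * M z i.comp j.comp := by
  have h := congrArg (fun A : Matrix (Fin 2) (Fin 2) ℂ => A i.comp j.comp) (hMγ γ hγ z)
  simp only [twist_mul_apply, mul_twist_apply, twist_comp i hγ, twist_comp j hγ] at h
  have h2 : exp (I * pairing (j.1 - i.1) (z + γ)) = exp (I * pairing (j.1 - i.1) z) *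
      (exp (I * pairing j.1 γ) * exp (-(I * pairing i.1 γ))) := by
    rw [← exp_add, ← exp_add]
    congr 1
    simp only [sub_eq_add_neg, pairing_add_left, pairing_add_right, pairing_neg_left]
    push_cast
    ring
  have h3 : exp (I * pairing j.1 γ) * exp (-(I * pairing j.1 γ)) = 1 := by
    rw [← exp_add, add_neg_cancel, exp_zero]
  rw [h2]
  linear_combination exp (I * pairing (j.1 - i.1) z) * exp (I * pairing j.1 γ) * h +
    exp (I * pairing (j.1 - i.1) z) * M z i.comp j.comp * h3

theorem Dirac.comp_rotPerm (j₀ j : Dirac) : (rotPerm j₀ j).comp = j.comp :=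
  comp_add (omega_sub_one_mul_sub j₀ j) (rotPerm_val j₀ j)

theorem pairing_omega_mul (q z : ℂ) : pairing (omega * q) (omega * z) = pairing q z := by
  have h : omega * conj omega = 1 := by
    rw [mul_conj, normSq_eq_norm_sq, omega_norm]
    simp
  have h2 : omega * q * conj (omega * z) = q * conj z := by
    rw [map_mul]
    linear_combination q * conj z * h
  rw [pairing, pairing, h2]

namespace Potential

variable (V : Potential)

/-- Multiplication by `V` in Fourier variables. -/
def model : Seq Dirac →L[ℂ] Seq Dirac := modelOp V.mat V.continuous_mat V.mat_translate

theorem fourierL2_mul (p : ℂ) (u : L2 p) : fourierL2 p (V.mul p u) = V.model (fourierL2 p u) :=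
  fourierL2_mulOp p V.mat V.continuous_mat V.mat_translate u

theorem matCoeff_conjTranspose (i j : Dirac) :
    matCoeff (fun z => (V.mat z).conjTranspose) i j = conj (matCoeff V.mat j i) := by
  rw [matCoeff, matCoeff, map_mul, map_mul, conj_ofReal, ← integral_conj]
  congr 2
  ext1 z
  rw [map_mul, ← exp_conj, map_mul, conj_ofReal, conj_I, Matrix.conjTranspose_apply,
    ← neg_sub i.1 j.1, pairing_neg_left]
  congr 2
  push_cast
  ring

theorem modelOp_conjTranspose :
    modelOp (fun z => (V.mat z).conjTranspose) V.continuous_mat.matrix_conjTranspose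
      V.mat_conjTranspose_translate = ContinuousLinearMap.adjoint V.model := by
  classical
  refine ext_entry fun i j => ?_
  rw [entry_modelOp, V.matCoeff_conjTranspose, ← entry_modelOp V.mat V.continuous_mat
    V.mat_translate]
  have h1 : entry (ContinuousLinearMap.adjoint V.model) i j =
      inner ℂ (lp.single 2 i (1 : ℂ)) (ContinuousLinearMap.adjoint V.model (lp.single 2 j 1)) := by
    rw [lp.inner_single_left]
    simp [entry]
  rw [h1, ContinuousLinearMap.adjoint_inner_right, lp.inner_single_right]
  simp [entry, model]

theorem fourierL2_mulStar (p : ℂ) (u : L2 p) :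
    fourierL2 p (V.mulStar p u) = ContinuousLinearMap.adjoint V.model (fourierL2 p u) := by
  rw [← V.modelOp_conjTranspose]
  exact fourierL2_mulOp p _ V.continuous_mat.matrix_conjTranspose V.mat_conjTranspose_translate u

theorem mat_omega_mul (z : ℂ) : V.mat (omega * z) = omega • V.mat z := by
  ext i j
  fin_cases i <;> fin_cases j <;> simp [mat, V.rot_plus, V.rot_minus]

theorem mat_diag (z : ℂ) (i : Fin 2) : V.mat z i i = 0 := by
  fin_cases i <;> rfl

/-- Entries depend on j - i and on the two components, which gives shift invariance and, as j ↦ -j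
swaps the components, the symmetry under negation. The rotation rule is the substitution z ↦ ωz in
the periodic integrand, where V(ωz) = ωV(z) supplies the factor. -/
theorem isPotentialMatrix_model : IsPotentialMatrix V.model := by
  classical
  have he : ∀ i j, entry V.model i j = matCoeff V.mat i j :=
    entry_modelOp V.mat V.continuous_mat V.mat_translate
  have hoff : ∀ i j : Dirac, i.comp = j.comp → matCoeff V.mat i j = 0 := by
    intro i j h
    rw [matCoeff, h]
    simp [V.mat_diag]
  refine ⟨fun q hq i j => ?_, fun j₀ i j => ?_, fun i j => ?_, fun i j h => ?_⟩
  · convert (he _ _).trans (Eq.trans ?_ (he i j).symm) using 1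
    rw [matCoeff, matCoeff, Dirac.comp_add hq (Dirac.shiftPerm_val q hq i),
      Dirac.comp_add hq (Dirac.shiftPerm_val q hq j), Dirac.shiftPerm_val, Dirac.shiftPerm_val,
      add_sub_add_right_eq_sub]
  · convert (he _ _).trans (Eq.trans ?_ (congrArg (omega * ·) (he i j).symm)) using 1
    have h1 := setIntegral_cell_omega_mul (F := fun z =>
      exp (I * pairing ((Dirac.rotPerm j₀ j).1 - (Dirac.rotPerm j₀ i).1) z) *
        V.mat z (Dirac.rotPerm j₀ i).comp (Dirac.rotPerm j₀ j).comp) (fun γ hγ z => periodic_matCoeff V.mat_translate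
      (Dirac.rotPerm j₀ i) (Dirac.rotPerm j₀ j) hγ z)
    rw [matCoeff, matCoeff, ← h1, mul_left_comm omega, ← integral_const_mul omega]
    congr 2
    ext1 z
    have h2 : (Dirac.rotPerm j₀ j).1 - (Dirac.rotPerm j₀ i).1 = omega * (j.1 - i.1) := by
      rw [Dirac.rotPerm_val, Dirac.rotPerm_val]; ring
    rw [h2, pairing_omega_mul, V.mat_omega_mul, Matrix.smul_apply, smul_eq_mul,
      Dirac.comp_rotPerm, Dirac.comp_rotPerm, mul_left_comm]
  · convert (he _ _).trans (Eq.trans ?_ (he j i).symm) using 1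
    by_cases h : i.comp = j.comp
    · rw [hoff j i h.symm, hoff _ _ (by rw [Dirac.comp_negPerm, Dirac.comp_negPerm, h])]
    · have h1 : ∀ a b : Fin 2, a ≠ b → 1 - a = b := by decide
      rw [matCoeff, matCoeff, Dirac.comp_negPerm, Dirac.comp_negPerm, h1 _ _ h,
        h1 _ _ (Ne.symm h), Dirac.negPerm_val, Dirac.negPerm_val, neg_sub_neg]
  · convert (he i j).trans (hoff i j h) using 1

end Potential

/-! ### The operator `D_V(α)` in Fourier variables -/

theorem IsResolventAt.eq {E : Type*} [NormedAddCommGroup E] [NormedSpace ℂ E] {A : E →ₗ.[ℂ] E}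
    {z : ℂ} {R R' : E →L[ℂ] E} (h : IsResolventAt A z R) (h' : IsResolventAt A z R') : R = R' := by
  ext f
  obtain ⟨h1, h2⟩ := h.1 f
  have h3 := h'.2 ⟨R f, h1⟩
  rw [h2] at h3
  exact h3.symm

theorem IsResolventAt.resolventOf_eq {E : Type*} [NormedAddCommGroup E] [NormedSpace ℂ E]
    {A : E →ₗ.[ℂ] E} {z : ℂ} {R : E →L[ℂ] E} (h : IsResolventAt A z R) : resolventOf A z = R := by
  have hz : z ∈ resolventSetOf A := ⟨R, h⟩
  rw [resolventOf, dif_pos hz]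
  exact IsResolventAt.eq hz.choose_spec h

namespace Potential

variable (V : Potential)

/-- The pencil of `D_V(α)` in Fourier variables. -/
def pencil (α k : ℂ) : Seq Dirac →L[ℂ] Seq Dirac := ChiralTBG.pencil (diagInv 0) V.model α k

/-- The resolvent of `D_V(α)` in Fourier variables. -/
def modelResolvent (α k : ℂ) : Seq Dirac →L[ℂ] Seq Dirac :=
  pencilResolvent (diagInv 0) V.model α k

theorem fourierL2_D {α p : ℂ} (u : H1 p) (j : Dirac) : fourierL2 p (D V α p u) j =
    (j.1 + p) * fourierL2 p u.1 j + α * V.model (fourierL2 p u.1) j := by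
  change fourierL2 p (dbarMap p u + α • V.mul p u.1) j = _
  rw [map_add, map_smul, V.fourierL2_mul, ← fourierL2_dbarMap]
  rfl

theorem fourierL2_Dstar {α p : ℂ} (u : H1 p) (j : Dirac) : fourierL2 p (Dstar V α p u) j =
    conj (j.1 + p) * fourierL2 p u.1 j +
      conj α * ContinuousLinearMap.adjoint V.model (fourierL2 p u.1) j := by
  change fourierL2 p (dMap p u + conj α • V.mulStar p u.1) j = _
  rw [map_add, map_smul, V.fourierL2_mulStar, ← fourierL2_dMap]
  rfl

theorem twoDbar_eq (p : ℂ) : twoDbar p = D V 0 p := by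
  have h : (0 : ℂ) • (V.mul p).toLinearMap.comp (H1 p).subtype = 0 := zero_smul _ _
  rw [twoDbar, D, h, add_zero]

theorem D_sub_smul_eq_iff {α p z : ℂ} {u : H1 p} {f : L2 p} :
    D V α p u - z • u.1 = f ↔
      V.pencil α (z - p) (fourierL2 p u.1) = diagInv 0 (fourierL2 p f) := by
  rw [pencil, pencil_diagInv_eq_iff, ← (fourierL2 p).injective.eq_iff]
  have h : ∀ j : Dirac, fourierL2 p (D V α p u - z • u.1) j =
      j.1 * fourierL2 p u.1 j + α * V.model (fourierL2 p u.1) j -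
        (z - p) * fourierL2 p u.1 j := by
    intro j
    rw [map_sub, map_smul]
    change fourierL2 p (D V α p u) j - z * fourierL2 p u.1 j = _
    rw [V.fourierL2_D]
    ring
  constructor
  · intro h1 j
    rw [← h j, h1]
  · intro h1
    refine lp.ext (funext fun j => ?_)
    rw [← h1 j, ← h j]

theorem mem_H1_of_pencil {α p z : ℂ} {u f : L2 p}
    (h : V.pencil α (z - p) (fourierL2 p u) = diagInv 0 (fourierL2 p f)) : u ∈ H1 p := by
  rw [pencil, pencil_diagInv_eq_iff] at h
  refine mem_H1_of_norm_eq (y := fourierL2 p f + z • fourierL2 p u -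
    α • V.model (fourierL2 p u)) fun j => le_of_eq ?_
  rw [← norm_mul]
  congr 1
  change _ = fourierL2 p f j + z * fourierL2 p u j - α * V.model (fourierL2 p u) j
  rw [← h j]
  ring

/-- The resolvent of `D_V(α)` on `L²_p`. -/
def resolventD (α p z : ℂ) : L2 p →L[ℂ] L2 p :=
  ((fourierL2 p).symm.toContinuousLinearEquiv.toContinuousLinearMap.comp
    (V.modelResolvent α (z - p))).comp (fourierL2 p).toContinuousLinearEquiv.toContinuousLinearMap

theorem fourierL2_resolventD (α p z : ℂ) (f : L2 p) :
    fourierL2 p (V.resolventD α p z f) = V.modelResolvent α (z - p) (fourierL2 p f) :=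
  (fourierL2 p).apply_symm_apply _

theorem isResolventAt_resolventD {α p z : ℂ} (h : IsUnit (V.pencil α (z - p))) :
    IsResolventAt (D V α p) z (V.resolventD α p z) := by
  have h1 : ∀ f : L2 p, V.pencil α (z - p) (fourierL2 p (V.resolventD α p z f)) =
      diagInv 0 (fourierL2 p f) := by
    intro f
    rw [fourierL2_resolventD]
    exact pencil_pencilResolvent h _
  refine ⟨fun f => ⟨V.mem_H1_of_pencil (h1 f), V.D_sub_smul_eq_iff.mpr (h1 f)⟩, fun u => ?_⟩
  have h2 := V.D_sub_smul_eq_iff.mp (rfl : D V α p u - z • u.1 = _)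
  apply (fourierL2 p).injective
  rw [fourierL2_resolventD]
  change Ring.inverse (V.pencil α (z - p)) (diagInv 0 _) = _
  rw [← h2]
  exact inverse_pencil_apply h _

theorem exists_kernel {α p z : ℂ} (h : ¬ IsUnit (V.pencil α (z - p))) :
    ∃ u : H1 p, u ≠ 0 ∧ D V α p u = z • u.1 := by
  obtain ⟨x, hx0, hx⟩ := (not_isUnit_pencil (isCompactOperator_diagInv 0)).mp h
  have h1 : V.pencil α (z - p) (fourierL2 p ((fourierL2 p).symm x)) =
      diagInv 0 (fourierL2 p 0) := by
    rw [LinearIsometryEquiv.apply_symm_apply, map_zero, map_zero]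
    exact hx
  refine ⟨⟨(fourierL2 p).symm x, V.mem_H1_of_pencil h1⟩, fun h2 => hx0 ?_, ?_⟩
  · exact (LinearIsometryEquiv.map_eq_zero_iff _).mp (congrArg Subtype.val h2)
  · exact sub_eq_zero.mp (V.D_sub_smul_eq_iff.mpr h1)

/-- A singular pencil has a null vector, which lies in H¹_p and obstructs any resolvent. An
invertible one gives the resolvent explicitly. -/
theorem mem_resolventSetOf_iff {α p z : ℂ} :
    z ∈ resolventSetOf (D V α p) ↔ IsUnit (V.pencil α (z - p)) := by
  refine ⟨fun ⟨R, hR⟩ => ?_, fun h => ⟨_, V.isResolventAt_resolventD h⟩⟩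
  by_contra h
  obtain ⟨u, hu0, hu⟩ := V.exists_kernel h
  have h1 := hR.2 u
  rw [hu, sub_self, map_zero] at h1
  exact hu0 (Subtype.ext h1.symm)

/-! ### The dichotomy -/

theorem skewPencil : SkewPencil (diagInv 0) V.model diracPoints skewForm :=
  V.isPotentialMatrix_model.skewPencil

theorem isUnit_pencil_zero {k : ℂ} (hk : k ∉ diracPoints) : IsUnit (V.pencil 0 k) :=
  V.skewPencil.isUnit_of_not_degenerate hk (V.skewPencil.zero k)

theorem isUnit_pencil_of_isUnit {α k k' : ℂ} (h : IsUnit (V.pencil α k)) (hk' : k' ∉ diracPoints) :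
    IsUnit (V.pencil α k') :=
  V.skewPencil.isUnit_of_not_degenerate hk' (V.skewPencil.not_degenerate h k')

theorem not_isUnit_pencil_dirac {α k : ℂ} (hk : k ∈ diracPoints) : ¬ IsUnit (V.pencil α k) :=
  (not_isUnit_pencil (isCompactOperator_diagInv 0)).mpr (V.skewPencil.eigenvalue k hk α)

/-! ### The operators `T_k` -/

theorem T_eq {p k : ℂ} (hk : k - p ∉ diracPoints) :
    T V p k = (V.resolventD 0 p k).comp (V.mul p) := by
  rw [T, V.twoDbar_eq, (V.isResolventAt_resolventD (V.isUnit_pencil_zero hk)).resolventOf_eq]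

theorem mem_resolventSetOf_twoDbar (V : Potential) {p k : ℂ} (hk : k - p ∉ diracPoints) :
    k ∈ resolventSetOf (twoDbar p) := by
  rw [V.twoDbar_eq, V.mem_resolventSetOf_iff]
  exact V.isUnit_pencil_zero hk

theorem isCompactOperator_modelResolvent (α k : ℂ) : IsCompactOperator (V.modelResolvent α k) :=
  (isCompactOperator_diagInv 0).clm_comp _

theorem isCompactOperator_resolventD (α p k : ℂ) : IsCompactOperator (V.resolventD α p k) :=
  ((V.isCompactOperator_modelResolvent α (k - p)).clm_comp
    (fourierL2 p).symm.toContinuousLinearEquiv.toContinuousLinearMap).comp_clm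
    (fourierL2 p).toContinuousLinearEquiv.toContinuousLinearMap

theorem isCompactOperator_T {p k : ℂ} (hk : k - p ∉ diracPoints) :
    IsCompactOperator (T V p k) := by
  rw [V.T_eq hk]
  exact (V.isCompactOperator_resolventD 0 p k).comp_clm _

/-- Applying 2D_z̄ - k to T_k u = zu gives (2D_z̄ - z⁻¹V - k)u = 0, hence the minus sign in the
parameter. -/
theorem T_eq_smul_iff {p k z : ℂ} (hk : k - p ∉ diracPoints) (hz : z ≠ 0) (u : L2 p) :
    T V p k u = z • u ↔ V.pencil (-z⁻¹) (k - p) (fourierL2 p u) = 0 := by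
  have hu := V.isUnit_pencil_zero hk
  have h1 : T V p k u = z • u ↔
      V.modelResolvent 0 (k - p) (V.model (fourierL2 p u)) = z • fourierL2 p u := by
    rw [V.T_eq hk, ← (fourierL2 p).injective.eq_iff, ContinuousLinearMap.comp_apply,
      fourierL2_resolventD, fourierL2_mul, map_smul]
  rw [h1]
  have h2 : ∀ x : Seq Dirac, V.pencil (-z⁻¹) (k - p) x =
      V.pencil 0 (k - p) x - z⁻¹ • diagInv 0 (V.model x) := by
    intro x
    rw [pencil, pencil, pencil_apply, pencil_apply, zero_smul, zero_sub, map_sub, map_smul,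
      map_neg]
    module
  rw [h2, sub_eq_zero]
  constructor
  · intro h
    have h3 := pencil_pencilResolvent hu (V.model (fourierL2 p u))
    rw [show pencilResolvent (diagInv 0) V.model 0 (k - p) (V.model (fourierL2 p u)) =
      z • fourierL2 p u from h, map_smul] at h3
    rw [← h3, smul_smul, inv_mul_cancel₀ hz, one_smul]
    rfl
  · intro h
    have h3 : diagInv 0 (V.model (fourierL2 p u)) = V.pencil 0 (k - p) (z • fourierL2 p u) := by
      rw [map_smul, h, smul_smul, mul_inv_cancel₀ hz, one_smul]
    change Ring.inverse (V.pencil 0 (k - p)) (diagInv 0 _) = _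
    rw [h3]
    exact inverse_pencil_apply hu _

theorem mem_spectrum_T_iff {p k z : ℂ} (hk : k - p ∉ diracPoints) (hz : z ≠ 0) :
    z ∈ spectrum ℂ (T V p k) ↔ ¬ IsUnit (V.pencil z⁻¹ (k - p)) := by
  rw [← (V.isCompactOperator_T hk).hasEigenvalue_iff_mem_spectrum hz,
    pencil, ← V.isPotentialMatrix_model.isUnit_pencil_neg_iff (a := z⁻¹),
    not_isUnit_pencil (isCompactOperator_diagInv 0)]
  constructor
  · intro h
    obtain ⟨u, hu⟩ := h.exists_hasEigenvector
    refine ⟨fourierL2 p u, fun h0 => hu.2 ((LinearIsometryEquiv.map_eq_zero_iff _).mp h0), ?_⟩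
    exact (V.T_eq_smul_iff hk hz u).mp hu.apply_eq_smul
  · rintro ⟨x, hx0, hx⟩
    refine Module.End.hasEigenvalue_of_hasEigenvector (x := (fourierL2 p).symm x) ⟨?_, ?_⟩
    · rw [Module.End.mem_eigenspace_iff]
      refine (V.T_eq_smul_iff hk hz _).mpr ?_
      rw [LinearIsometryEquiv.apply_symm_apply]
      exact hx
    · exact fun h0 => hx0 ((LinearIsometryEquiv.map_eq_zero_iff _).mp h0)

end Potential

instance : Infinite Dirac := by
  obtain ⟨j, -⟩ := Dirac.exists_comp_eq 0
  refine Infinite.of_injective (fun n : ℤ => Dirac.shiftPerm (dualScale * n)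
    (mem_dualLattice.mpr ⟨0, n, by simp⟩) j) fun m n h => ?_
  have h1 := congrArg Subtype.val h
  simpa [dualScale_ne_zero] using h1

theorem not_finiteDimensional_L2 (p : ℂ) : ¬ FiniteDimensional ℂ (L2 p) := by
  classical
  intro h
  have h1 : FiniteDimensional ℂ (Seq Dirac) :=
    (fourierL2 p).toLinearEquiv.finiteDimensional
  have h2 : LinearIndependent ℂ fun j : Dirac => (lp.single 2 j 1 : Seq Dirac) := by
    have h3 : Orthonormal ℂ fun j : Dirac => (lp.single 2 j 1 : Seq Dirac) := by
      rw [orthonormal_iff_ite]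
      intro i j
      rw [lp.inner_single_left, single_one_apply]
      by_cases h : i = j
      · simp [h]
      · simp [h, Ne.symm h]
    exact h3.linearIndependent
  exact not_finite_iff_infinite.mpr inferInstance h2.finite

/-- A compact operator on an infinite-dimensional space is not invertible. This settles the one
spectral value that the pencil does not see. -/
theorem Potential.zero_mem_spectrum_T (V : Potential) {p k : ℂ} (hk : k - p ∉ diracPoints) :
    (0 : ℂ) ∈ spectrum ℂ (T V p k) := by
  rw [spectrum.zero_mem_iff]
  rintro ⟨e, he⟩
  refine not_finiteDimensional_L2 p ?_
  have h1 := (V.isCompactOperator_T hk).clm_comp (e⁻¹ : (L2 p →L[ℂ] L2 p)ˣ).1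
  have h2 : ((e⁻¹ : (L2 p →L[ℂ] L2 p)ˣ).1 ∘ T V p k : L2 p → L2 p) = id := by
    ext u : 1
    have h3 := e.inv_mul
    rw [he] at h3
    exact DFunLike.congr_fun h3 u
  rw [h2] at h1
  exact FiniteDimensional.of_isCompactOperator_id h1

theorem Potential.spectrum_T_eq (V : Potential) {p k p' k' : ℂ} (hk : k - p ∉ diracPoints)
    (hk' : k' - p' ∉ diracPoints) : spectrum ℂ (T V p k) = spectrum ℂ (T V p' k') := by
  ext z
  by_cases hz : z = 0
  · rw [hz]
    exact iff_of_true (V.zero_mem_spectrum_T hk) (V.zero_mem_spectrum_T hk')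
  · rw [V.mem_spectrum_T_iff hk hz, V.mem_spectrum_T_iff hk' hz, not_iff_not]
    exact ⟨fun h => V.isUnit_pencil_of_isUnit h hk', fun h => V.isUnit_pencil_of_isUnit h hk⟩

/-! ### Simplicity of the protected eigenvalues -/

/-- With y a fixed eigenvector at -z, nondegeneracy says that x ↦ B(x, y) is injective on the kernel
at z, which is therefore a line. -/
theorem Potential.isSimpleEigenvalue (V : Potential) {α k z : ℂ} (h : IsUnit (V.pencil α k))
    (hz : z ∈ diracPoints) : IsSimpleEigenvalue (D V α 0) z := by
  have hnd := V.skewPencil.not_degenerate h z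
  obtain ⟨y, hy0, hy⟩ := V.skewPencil.eigenvalue (-z) (V.skewPencil.neg_mem z hz) α
  have hB : ∀ x, V.pencil α z x = 0 → skewForm x y = 0 → x = 0 := by
    intro x hx hxy
    by_contra hx0
    exact hnd ⟨x, hx0, hx, Or.inr ⟨y, hy0, hy, hxy⟩⟩
  obtain ⟨u, hu0, hu⟩ := V.exists_kernel (α := α) (p := 0) (z := z)
    (by rw [sub_zero]; exact V.not_isUnit_pencil_dirac hz)
  have hiff : ∀ (w : H1 0) (f : L2 0), D V α 0 w - z • w.1 = f ↔
      V.pencil α z (fourierL2 0 w.1) = diagInv 0 (fourierL2 0 f) := by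
    intro w f
    rw [V.D_sub_smul_eq_iff, sub_zero]
  have hker : ∀ w : H1 0, D V α 0 w - z • w.1 = 0 → V.pencil α z (fourierL2 0 w.1) = 0 := by
    intro w hw
    rw [(hiff w 0).mp hw, map_zero, map_zero]
  have hu' := hker u (sub_eq_zero.mpr hu)
  have hu0' : u.1 ≠ 0 := fun h => hu0 (Subtype.ext h)
  have hspan : ∀ w : H1 0, D V α 0 w - z • w.1 = 0 → w.1 ∈ Submodule.span ℂ {u.1} := by
    intro w hw
    have hc : skewForm (fourierL2 0 u.1) y ≠ 0 := fun hc =>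
      hu0' ((LinearIsometryEquiv.map_eq_zero_iff _).mp (hB _ hu' hc))
    have h1 := hB (fourierL2 0 w.1 -
      (skewForm (fourierL2 0 w.1) y / skewForm (fourierL2 0 u.1) y) • fourierL2 0 u.1)
      (by rw [map_sub, map_smul, hker w hw, hu', smul_zero, sub_zero])
      (by
        simp only [map_sub, map_smul, sub_apply,
          smul_apply, smul_eq_mul]
        rw [div_mul_cancel₀ _ hc, sub_self])
    rw [← map_smul, ← map_sub, LinearIsometryEquiv.map_eq_zero_iff] at h1
    exact Submodule.mem_span_singleton.mpr ⟨_, (sub_eq_zero.mp h1).symm⟩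
  have hle : ∀ n, genKer (D V α 0) z n ≤ Submodule.span ℂ {u.1} := by
    intro n
    induction n with
    | zero => exact bot_le
    | succ n ih =>
      rintro _ ⟨w, hw, rfl⟩
      refine hspan w ?_
      have h1 : D V α 0 w - z • w.1 ∈ genKer (D V α 0) z n := hw
      obtain ⟨c, hc⟩ := Submodule.mem_span_singleton.mp (ih h1)
      have h2 := (hiff w (c • u.1)).mp hc.symm
      -- No Jordan chain: if (D - z)w = cu, the skew identity at z and -z gives B(cu, y) = 0, so cu
      -- = 0 and w is itself an eigenvector.
      have h3 := V.skewPencil.skew α z (-z) _ _ y h2 hy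
      rw [add_neg_cancel, zero_mul, neg_zero] at h3
      have h4 := hB _ (by rw [map_smul, map_smul, hu', smul_zero]) h3
      rw [LinearIsometryEquiv.map_eq_zero_iff] at h4
      rw [← hc, h4]
  have hge : u.1 ∈ genKer (D V α 0) z 1 := by
    refine ⟨u, ?_, rfl⟩
    change D V α 0 u - z • u.1 ∈ (⊥ : Submodule ℂ (L2 0))
    rw [hu, sub_self]
    exact zero_mem _
  have heq : (⨆ n, genKer (D V α 0) z n) = Submodule.span ℂ {u.1} := by
    refine le_antisymm (iSup_le hle) ?_
    rw [Submodule.span_singleton_le_iff_mem]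
    exact Submodule.mem_iSup_of_mem 1 hge
  rw [IsSimpleEigenvalue, heq]
  exact finrank_span_singleton hu0'

namespace Potential

variable (V : Potential)

/-! ### The first band -/

/-- The formal adjoint relation between `D_V(α)` and `D_V(α)*` in Fourier variables. -/
theorem inner_model_eq {α k : ℂ} {u v f g : Seq Dirac}
    (hu : ∀ j : Dirac, (j.1 + k) * u j + α * V.model u j = f j)
    (hv : ∀ j : Dirac, conj (j.1 + k) * v j +
      conj α * ContinuousLinearMap.adjoint V.model v j = g j) :
    inner ℂ v f = inner ℂ g u := by
  have hs : ∀ x y : Seq Dirac, HasSum (fun j => inner ℂ (x j) (y j)) (inner ℂ x y) :=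
    fun x y => lp.hasSum_inner x y
  have h1 := (hs v f).sub (hs g u)
  have h2 := ((hs v (V.model u)).mul_left α).sub
    ((hs (ContinuousLinearMap.adjoint V.model v) u).mul_left α)
  rw [ContinuousLinearMap.adjoint_inner_left, sub_self] at h2
  refine sub_eq_zero.mp (h1.unique (h2.congr_fun fun j => ?_))
  rw [← hu j, ← hv j]
  simp only [RCLike.inner_apply, map_add, map_mul, conj_conj]
  ring

theorem pencil_neg_eq_iff {α k : ℂ} {x f : Seq Dirac} :
    V.pencil α (-k) x = diagInv 0 f ↔ ∀ j : Dirac, (j.1 + k) * x j + α * V.model x j = f j := by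
  rw [pencil, pencil_diagInv_eq_iff]
  refine forall_congr' fun j => ?_
  rw [show j.1 * x j + α * V.model x j - -k * x j = (j.1 + k) * x j + α * V.model x j by ring]

/-- The adjoint of the resolvent solves the adjoint equation. It suffices to test against basis
vectors, which lie in the domain of A. -/
theorem adjoint_modelResolvent {α k : ℂ} (h : IsUnit (V.pencil α (-k))) (u : Seq Dirac)
    (j : Dirac) : conj (j.1 + k) * ContinuousLinearMap.adjoint (V.modelResolvent α (-k)) u j +
      conj α * ContinuousLinearMap.adjoint V.model
        (ContinuousLinearMap.adjoint (V.modelResolvent α (-k)) u) j = u j := by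
  classical
  set g := ContinuousLinearMap.adjoint (V.modelResolvent α (-k)) u with hg
  let e : Seq Dirac := lp.single 2 j 1
  let f : Seq Dirac := (j.1 + k) • e + α • V.model e
  have h1 : V.modelResolvent α (-k) f = e := by
    have h2 : V.pencil α (-k) e = diagInv 0 f := by
      rw [V.pencil_neg_eq_iff]
      intro i
      change (i.1 + k) * e i + α * V.model e i = (j.1 + k) * e i + α * V.model e i
      rw [single_one_apply]
      split_ifs with hij
      · rw [hij]
      · ring
    change Ring.inverse (V.pencil α (-k)) (diagInv 0 f) = e
    rw [← h2]
    exact inverse_pencil_apply h e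
  have h3 : inner ℂ g f = inner ℂ u e := by
    rw [hg, ContinuousLinearMap.adjoint_inner_left, h1]
  have h4 : ∀ x : Seq Dirac, inner ℂ x e = conj (x j) := fun x => by
    rw [lp.inner_single_right]; simp
  rw [inner_add_right, inner_smul_right, inner_smul_right,
    ← ContinuousLinearMap.adjoint_inner_left, h4, h4, h4] at h3
  have h5 := congrArg conj h3
  simpa only [map_add, map_mul, conj_conj] using h5

/-- A nonzero compact operator has a singular value. -/
theorem exists_singular_value {E : Type*} [NormedAddCommGroup E] [InnerProductSpace ℂ E]
    [CompleteSpace E] {Q : E →L[ℂ] E} (hQ : IsCompactOperator Q) (h0 : Q ≠ 0) :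
    ∃ (t : ℝ) (u : E), 0 < t ∧ u ≠ 0 ∧
      Q (ContinuousLinearMap.adjoint Q u) = ((t ^ 2 : ℝ) : ℂ) • u := by
  let A : E →L[ℂ] E := Q.comp (ContinuousLinearMap.adjoint Q)
  have hA : IsCompactOperator A := hQ.comp_clm _
  have hsym : (A : E →ₗ[ℂ] E).IsSymmetric := by
    intro x y
    change inner ℂ (Q (ContinuousLinearMap.adjoint Q x)) y =
      inner ℂ x (Q (ContinuousLinearMap.adjoint Q y))
    exact (ContinuousLinearMap.adjoint_inner_right Q _ _).symm.trans
      (ContinuousLinearMap.adjoint_inner_left Q _ _)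
  have hA0 : A ≠ 0 := by
    intro hA0
    have h1 : ∀ x, ContinuousLinearMap.adjoint Q x = 0 := by
      intro x
      have h2 : inner ℂ x (A x) = 0 := by rw [hA0]; simp
      change inner ℂ x (Q (ContinuousLinearMap.adjoint Q x)) = 0 at h2
      rw [← ContinuousLinearMap.adjoint_inner_left] at h2
      exact inner_self_eq_zero.mp h2
    refine h0 ?_
    rw [← ContinuousLinearMap.adjoint_adjoint Q, show ContinuousLinearMap.adjoint Q = 0 from
      ContinuousLinearMap.ext h1, map_zero]
  have h1 := mt (ContinuousLinearMap.eq_zero_of_forall_hasEigenvalue_eq_zero hA hsym).mp hA0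
  push Not at h1
  obtain ⟨μ, hμ, hμ0⟩ := h1
  obtain ⟨u, hu⟩ := hμ.exists_hasEigenvector
  have hAu : Q (ContinuousLinearMap.adjoint Q u) = μ • u := hu.apply_eq_smul
  have h2 : inner ℂ u (Q (ContinuousLinearMap.adjoint Q u)) = μ * inner ℂ u u := by
    rw [hAu, inner_smul_right]
  rw [← ContinuousLinearMap.adjoint_inner_left, inner_self_eq_norm_sq_to_K,
    inner_self_eq_norm_sq_to_K] at h2
  have hun : (‖u‖ : ℂ) ≠ 0 := by exact_mod_cast norm_ne_zero_iff.mpr hu.2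
  have h3 : μ = (((‖ContinuousLinearMap.adjoint Q u‖ / ‖u‖) ^ 2 : ℝ) : ℂ) := by
    push_cast
    rw [div_pow, eq_div_iff (pow_ne_zero 2 hun)]
    exact h2.symm
  refine ⟨‖ContinuousLinearMap.adjoint Q u‖ / ‖u‖, u, ?_, hu.2, by rw [← h3]; exact hAu⟩
  refine (div_nonneg (norm_nonneg _) (norm_nonneg _)).lt_of_ne fun h4 => hμ0 ?_
  rw [h3, ← h4]
  simp

/-- The set of non-negative eigenvalues of `H(α)` on `L²_k`. -/
def energies (α k : ℂ) : Set ℝ := {E : ℝ | 0 ≤ E ∧ ∃ w : (H V α k).domain, w ≠ 0 ∧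
    H V α k w = (E : ℂ) • (w : L2 k × L2 k)}

theorem E1_eq_zero {α k : ℂ} (h : ¬ IsUnit (V.pencil α (-k))) : E1 V α k = 0 := by
  obtain ⟨u, hu0, hu⟩ := V.exists_kernel (α := α) (p := k) (z := 0) (by rwa [zero_sub])
  have h0 : IsLeast (V.energies α k) 0 := by
    refine ⟨⟨le_rfl, ⟨(u.1, 0), u.2, zero_mem _⟩, fun h1 => hu0 ?_, ?_⟩, fun E hE => hE.1⟩
    · exact Subtype.ext (congrArg (fun w : (H V α k).domain => w.1.1) h1)
    · refine Prod.ext ?_ ?_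
      · change Dstar V α k 0 = ((0 : ℝ) : ℂ) • u.1
        rw [LinearPMap.map_zero, ofReal_zero, zero_smul]
      · change D V α k u = ((0 : ℝ) : ℂ) • (0 : L2 k)
        rw [hu, zero_smul, smul_zero]
  exact h0.csInf_eq

/-- With Q = D⁻¹, the eigenvalue equations give u = EQv and, by duality, ‖v‖ ≤ E‖Q‖‖u‖. If E‖Q‖ < 1
both components vanish. -/
theorem one_le_mul_norm {α k : ℂ} (h : IsUnit (V.pencil α (-k))) {E : ℝ}
    (hE : E ∈ V.energies α k) : 1 ≤ E * ‖V.modelResolvent α (-k)‖ := by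
  obtain ⟨hE0, ⟨⟨u, v⟩, hu, hv⟩, hw0, hw⟩ := hE
  set Q := V.modelResolvent α (-k) with hQ
  have h1 : Dstar V α k ⟨v, hv⟩ = (E : ℂ) • u := congrArg Prod.fst hw
  have h2 : D V α k ⟨u, hu⟩ = (E : ℂ) • v := congrArg Prod.snd hw
  have hx : ∀ f : Seq Dirac, ∀ j : Dirac, (j.1 + k) * Q f j + α * V.model (Q f) j = f j :=
    fun f => V.pencil_neg_eq_iff.mp (pencil_pencilResolvent h f)
  have h3 : fourierL2 k u = (E : ℂ) • Q (fourierL2 k v) := by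
    have h4 : D V α k ⟨u, hu⟩ - (0 : ℂ) • u = (E : ℂ) • v := by rw [h2, zero_smul, sub_zero]
    have h5 := V.D_sub_smul_eq_iff.mp h4
    rw [zero_sub] at h5
    rw [← map_smul, ← map_smul (fourierL2 k)]
    change _ = Ring.inverse (V.pencil α (-k)) (diagInv 0 _)
    rw [← h5]
    exact (inverse_pencil_apply h _).symm
  have h4 : ‖u‖ ≤ E * ‖Q‖ * ‖v‖ := by
    rw [← (fourierL2 k).norm_map u, ← (fourierL2 k).norm_map v, h3, norm_smul, norm_real,
      Real.norm_of_nonneg hE0, mul_assoc]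
    exact mul_le_mul_of_nonneg_left (Q.le_opNorm _) hE0
  have h5 : ‖v‖ ≤ E * ‖Q‖ * ‖u‖ := by
    -- Writing v = D(Qv) gives ⟨v, v⟩ = ⟨D*v, Qv⟩ = ⟨Eu, Qv⟩.
    have h6 := V.inner_model_eq (hx (fourierL2 k v)) (g := (E : ℂ) • fourierL2 k u)
      (v := fourierL2 k v) (fun j => by
        rw [← map_smul (fourierL2 k), ← h1]
        exact (V.fourierL2_Dstar (⟨v, hv⟩ : H1 k) j).symm)
    have h7 : ‖v‖ * ‖v‖ ≤ E * ‖Q‖ * ‖u‖ * ‖v‖ := by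
      rw [← (fourierL2 k).norm_map u, ← (fourierL2 k).norm_map v]
      calc ‖fourierL2 k v‖ * ‖fourierL2 k v‖ = ‖inner ℂ (fourierL2 k v) (fourierL2 k v)‖ := by
            rw [inner_self_eq_norm_sq_to_K]; simp [sq]
        _ ≤ ‖(E : ℂ) • fourierL2 k u‖ * ‖Q (fourierL2 k v)‖ := by
            rw [h6]; exact norm_inner_le_norm _ _
        _ ≤ (E * ‖fourierL2 k u‖) * (‖Q‖ * ‖fourierL2 k v‖) := by
            rw [norm_smul, norm_real, Real.norm_of_nonneg hE0]
            gcongr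
            exact Q.le_opNorm _
        _ = _ := by ring
    by_cases hv0 : ‖v‖ = 0
    · rw [hv0]; positivity
    · exact le_of_mul_le_mul_right h7 ((norm_nonneg v).lt_of_ne (Ne.symm hv0))
  by_contra! hlt
  have hq : 0 ≤ E * ‖Q‖ := by positivity
  have hu0 : ‖u‖ = 0 := by
    have := norm_nonneg u
    have := norm_nonneg v
    nlinarith
  have hv0 : ‖v‖ = 0 := le_antisymm (by rw [hu0, mul_zero] at h5; exact h5) (norm_nonneg v)
  refine hw0 (Subtype.ext (Prod.ext ?_ ?_))
  · exact norm_eq_zero.mp hu0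
  · exact norm_eq_zero.mp hv0

/-- If QQ*u = t²u and g = Q*u, then Du = t⁻²g and D*g = u, so (u, t⁻¹g) has energy t⁻¹. Existence
matters because the infimum of the empty set of reals is 0 by convention, which would fake a flat
band. -/
theorem energies_nonempty {α k : ℂ} (h : IsUnit (V.pencil α (-k))) : (V.energies α k).Nonempty := by
  classical
  set Q := V.modelResolvent α (-k) with hQ
  have hx : ∀ f : Seq Dirac, V.pencil α (-k) (Q f) = diagInv 0 f :=
    fun f => pencil_pencilResolvent h f
  have hQ0 : Q ≠ 0 := by
    intro h0
    obtain ⟨j, -⟩ := Dirac.exists_comp_eq 0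
    have h1 := hx (lp.single 2 j 1)
    rw [h0, zero_apply, map_zero] at h1
    have h2 : (0 : ℂ) = (j.1 - 0)⁻¹ * (lp.single 2 j (1 : ℂ) : Seq Dirac) j :=
      congrFun (congrArg Subtype.val h1) j
    rw [single_one_apply, if_pos rfl, mul_one, sub_zero] at h2
    exact inv_ne_zero j.ne_zero h2.symm
  obtain ⟨t, u, ht, hu0, hu⟩ := exists_singular_value (V.isCompactOperator_modelResolvent α (-k)) hQ0
  set g := ContinuousLinearMap.adjoint Q u with hg
  have hadj := V.adjoint_modelResolvent h u
  rw [← hQ, ← hg] at hadj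
  have ht0 : (t : ℂ) ≠ 0 := by exact_mod_cast ht.ne'
  let U : L2 k := (fourierL2 k).symm u
  let G : L2 k := (fourierL2 k).symm g
  have hFU : fourierL2 k U = u := (fourierL2 k).apply_symm_apply u
  have hFG : fourierL2 k G = g := (fourierL2 k).apply_symm_apply g
  have hU : V.pencil α (0 - k) (fourierL2 k U) = diagInv 0 (fourierL2 k (((t ^ 2)⁻¹ : ℂ) • G)) := by
    have h1 := hx g
    rw [hu, map_smul] at h1
    rw [zero_sub, hFU, map_smul, map_smul, hFG, ← h1, smul_smul]
    push_cast
    rw [inv_mul_cancel₀ (pow_ne_zero 2 ht0), one_smul]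
  have hUm : U ∈ H1 k := V.mem_H1_of_pencil hU
  have hDU : D V α k ⟨U, hUm⟩ = ((t ^ 2)⁻¹ : ℂ) • G := by
    have h1 := V.D_sub_smul_eq_iff (u := ⟨U, hUm⟩).mpr hU
    rwa [zero_smul, sub_zero] at h1
  have hGm : G ∈ H1 k := by
    refine mem_H1_of_norm_eq (y := u - conj α • ContinuousLinearMap.adjoint V.model g)
      fun j => le_of_eq ?_
    rw [hFG, ← norm_conj (j.1 + k), ← norm_mul]
    congr 1
    change _ = u j - conj α * ContinuousLinearMap.adjoint V.model g j
    rw [← hadj j]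
    ring
  have hDG : Dstar V α k ⟨G, hGm⟩ = U := by
    apply (fourierL2 k).injective
    refine lp.ext (funext fun j => ?_)
    refine (V.fourierL2_Dstar (⟨G, hGm⟩ : H1 k) j).trans ?_
    rw [hFU, ← hadj j, hFG]
  refine ⟨t⁻¹, (inv_pos.mpr ht).le, ⟨(U, (t : ℂ)⁻¹ • G), hUm, (H1 k).smul_mem _ hGm⟩,
    fun h0 => hu0 ?_, Prod.ext ?_ ?_⟩
  · have h1 : U = 0 := congrArg (fun w : (H V α k).domain => w.1.1) h0
    rw [← hFU, h1, map_zero]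
  · change Dstar V α k ((t : ℂ)⁻¹ • ⟨G, hGm⟩) = ((t⁻¹ : ℝ) : ℂ) • U
    rw [LinearPMap.map_smul, hDG, ofReal_inv]
  · change D V α k ⟨U, hUm⟩ = ((t⁻¹ : ℝ) : ℂ) • (t : ℂ)⁻¹ • G
    rw [hDU, ofReal_inv, smul_smul, ← mul_inv, sq]

theorem E1_eq_zero_iff {α k : ℂ} : E1 V α k = 0 ↔ ¬ IsUnit (V.pencil α (-k)) := by
  refine ⟨fun h0 h => ?_, V.E1_eq_zero⟩
  have hne := V.energies_nonempty h
  obtain ⟨E₀, hE₀⟩ := hne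
  have hq : 0 < ‖V.modelResolvent α (-k)‖ := by
    have := V.one_le_mul_norm h hE₀
    refine (norm_nonneg _).lt_of_ne fun h0 => ?_
    rw [← h0, mul_zero] at this
    exact not_le.mpr one_pos this
  have h1 : ‖V.modelResolvent α (-k)‖⁻¹ ≤ sInf (V.energies α k) :=
    le_csInf ⟨E₀, hE₀⟩ fun E hE => (inv_le_iff_one_le_mul₀ hq).mpr (V.one_le_mul_norm h hE)
  have h2 : sInf (V.energies α k) = 0 := h0
  rw [h2] at h1
  exact not_le.mpr (inv_pos.mpr hq) h1

theorem mem_magicSet_iff {α : ℂ} : α ∈ magicSet V ↔ ∀ k, ¬ IsUnit (V.pencil α k) := by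
  constructor
  · intro h k
    have := V.E1_eq_zero_iff.mp (h (-k))
    rwa [neg_neg] at this
  · exact fun h k => V.E1_eq_zero_iff.mpr (h (-k))

end Potential

end ChiralTBG
end

/-! ### Spectral characterization of the magic set. -/

theorem proposition2p2 (V : ChiralTBG.Potential) :
    -- the operators `R(k)` and `T_k` are well defined, and `T_k` is compact
    (∀ p k : ℂ, k - p ∉ ChiralTBG.diracPoints →
      k ∈ ChiralTBG.resolventSetOf (ChiralTBG.twoDbar p) ∧
        IsCompactOperator (ChiralTBG.T V p k)) ∧
    -- the spectrum of `T_k` does not depend on `k` and `p`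
    (∀ p q k k' : ℂ, k - p ∉ ChiralTBG.diracPoints → k' - q ∉ ChiralTBG.diracPoints →
      spectrum ℂ (ChiralTBG.T V p k) = spectrum ℂ (ChiralTBG.T V q k')) ∧
    -- spectral characterization of the magic set
    (∀ p k : ℂ, k - p ∉ ChiralTBG.diracPoints →
      ChiralTBG.magicSet V = {α : ℂ | α ≠ 0 ∧ α⁻¹ ∈ spectrum ℂ (ChiralTBG.T V p k)}) ∧
    -- the spectrum of `D_V(α)` on `L²_0`
    (∀ α : ℂ, α ∉ ChiralTBG.magicSet V →
      ChiralTBG.Spec (ChiralTBG.D V α 0) = ChiralTBG.diracPoints ∧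
        ∀ z ∈ ChiralTBG.diracPoints, ChiralTBG.IsSimpleEigenvalue (ChiralTBG.D V α 0) z) ∧
    (∀ α : ℂ, α ∈ ChiralTBG.magicSet V →
      ChiralTBG.Spec (ChiralTBG.D V α 0) = Set.univ) := by
  have hspec : ∀ α z : ℂ, z ∈ ChiralTBG.Spec (ChiralTBG.D V α 0) ↔ ¬ IsUnit (V.pencil α z) := by
    intro α z
    rw [ChiralTBG.Spec, Set.mem_compl_iff, V.mem_resolventSetOf_iff, sub_zero]
  refine ⟨fun p k hk => ⟨V.mem_resolventSetOf_twoDbar hk, V.isCompactOperator_T hk⟩,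
    fun p q k k' hk hk' => V.spectrum_T_eq hk hk', fun p k hk => ?_, fun α hα => ?_,
    fun α hα => ?_⟩
  -- Magic means that the pencil is singular for every k. By rigidity this may be tested at the
  -- single point k - p outside 𝒦₀. At α = 0 the pencil is invertible there, so 0 is not magic.
  · ext α
    rw [V.mem_magicSet_iff]
    constructor
    · intro h
      have hα : α ≠ 0 := by
        rintro rfl
        exact h _ (V.isUnit_pencil_zero hk)
      refine ⟨hα, ?_⟩
      rw [V.mem_spectrum_T_iff hk (inv_ne_zero hα), inv_inv]
      exact h _
    · rintro ⟨hα, h⟩ k' hk'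
      rw [V.mem_spectrum_T_iff hk (inv_ne_zero hα), inv_inv] at h
      exact h (V.isUnit_pencil_of_isUnit hk' hk)
  · rw [V.mem_magicSet_iff] at hα
    push Not at hα
    obtain ⟨k, hk⟩ := hα
    refine ⟨Set.ext fun z => ?_, fun z hz => V.isSimpleEigenvalue hk hz⟩
    rw [hspec]
    exact ⟨fun h => by_contra fun hz => h (V.isUnit_pencil_of_isUnit hk hz),
      fun hz => V.not_isUnit_pencil_dirac hz⟩
  · exact Set.eq_univ_of_forall fun z => (hspec α z).mpr (V.mem_magicSet_iff.mp hα z)
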